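/- For $m\ge 0$ let $C_m=\frac1{m+1}\binom{2m}{m}$ be the $m$-th Catalan number (the number of triangulations of a convex $(m+2)$-gon). For $N\ge 3$ let $P_N=\{a_1,\dots,a_N\}\subset\mathbb R^2$ be the vertex set of a regular $N$-gon, labelled in cyclic order, and for $1\le k\le N-1$ let $\Delta_N^{(k)}=\operatorname{conv}\{\sum_{i\in B}e_i : B\subseteq[N],\ |B|=k\}\subset\mathbb R^N$ be the hypersimplex and $\pi:\mathbb R^N\to\mathbb R^2$ the linear map with $\pi(e_i)=a_i$. A hypertriangulation of $P_N^{(k)}$ is a fine $\pi$-induced subdivision of the point configuration $\{\sum_{i\in B}a_i : |B|=k\}$ (points labelled by the $k$-subsets $B$), i.e. a polyhedral subdivision all of whose cells are images $\pi(F)$ of faces $F$ of $\Delta_N^{(k)}$ with $\dim \pi(F)=\dim F$. Let $C_N^{(k)}$ be the number of hypertriangulations of $P_N^{(k)}$ (the hypercatalan number). A triangulation $T$ of a convex polygon is a maximal set of pairwise noncrossing diagonals, and $\deg_T(i)$ is the number of diagonals of $T$ incident to the vertex $i$. Let $n\ge 4$. Then: 1. For every triangulation $T$ of a convex $(n+2)$-gon,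 $$2^{\,n-2}\;\le\;\prod_{i\in[n+2]} C_{\deg_T(i)}\;\le\;2^{\frac52 n-7}.$$ 2. The ratio of the hypercatalan number of the $(n+2)$-gon to the number $C_n$ of its triangulations satisfies $$2^{\,n-2}\;\le\;\frac{C_{n+2}^{(2)}}{C_n}\;\le\;2^{\frac52 n-7}.$$ (Equivalently, for an $N$-gon with $N=n+2\ge 6$: $2^{N-4}\le C_N^{(2)}/C_{N-2}\le 2^{\frac52N-12}$.) -/

import Mathlib

namespace Hyper

noncomputable section

/-! ### Induced polyhedral subdivisions of labelled point configurations

A labelled point configuration is a map `p : ι → E` together with a finite set `G : Finset ι` of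
labels.  Its cells are recorded by their sets of labels. -/

/-- `F` is (the label set of) a nonempty face of the cell `C` of the configuration `p`: the labels
of `C` at which some linear functional attains its minimum over `C`. -/
def IsFaceOf {ι E : Type*} [AddCommGroup E] [Module ℝ E] (p : ι → E) (F C : Finset ι) : Prop :=
  F.Nonempty ∧ ∃ w : E →ₗ[ℝ] ℝ, ∀ i, i ∈ F ↔ i ∈ C ∧ ∀ j ∈ C, w (p i) ≤ w (p j)

/-- The polytope spanned by the points of a cell. -/
def cellHull {ι E : Type*} [AddCommGroup E] [Module ℝ E] (p : ι → E) (C : Finset ι) : Set E :=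
  convexHull ℝ (p '' (C : Set ι))

/-- Polyhedral subdivisions of the labelled configuration `(p, G)`, given by all their (nonempty)
cells of all dimensions: closed under taking faces, covering the convex hull, and with distinct
cells having disjoint relative interiors. -/
structure IsPolyhedralSubdivision {ι E : Type*} [AddCommGroup E] [Module ℝ E] [TopologicalSpace E]
    (p : ι → E) (G : Finset ι) (S : Set (Finset ι)) : Prop where
  subset : ∀ C ∈ S, C ⊆ G
  nonempty : ∀ C ∈ S, C.Nonempty
  closed : ∀ C ∈ S, ∀ F, IsFaceOf p F C → F ∈ S
  covers : cellHull p G ⊆ ⋃ C ∈ S, cellHull p C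
  disjoint : ∀ C ∈ S, ∀ D ∈ S, C ≠ D →
    Disjoint (intrinsicInterior ℝ (cellHull p C)) (intrinsicInterior ℝ (cellHull p D))

/-- Let `Q` be the polytope with vertices `v i`, `i ∈ G`, and let `π` be a linear projection.
A `π`-induced subdivision is a polyhedral subdivision of the configuration `π (v i)`, `i ∈ G`, all
of whose cells are images of faces of `Q`. -/
structure IsInducedSubdivision {ι V E : Type*} [AddCommGroup V] [Module ℝ V] [AddCommGroup E]
    [Module ℝ E] [TopologicalSpace E] (v : ι → V) (π : V →ₗ[ℝ] E) (G : Finset ι)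
    (S : Set (Finset ι)) : Prop where
  subdivision : IsPolyhedralSubdivision (fun i => π (v i)) G S
  isFace : ∀ C ∈ S, IsFaceOf v C G

/-- A `π`-induced subdivision is fine if `π` preserves the dimension of every face of `Q` whose
image is a cell. -/
structure IsFineInducedSubdivision {ι V E : Type*} [AddCommGroup V] [Module ℝ V] [AddCommGroup E]
    [Module ℝ E] [TopologicalSpace E] (v : ι → V) (π : V →ₗ[ℝ] E) (G : Finset ι)
    (S : Set (Finset ι)) : Prop where
  induced : IsInducedSubdivision v π G S
  fine : ∀ C ∈ S, Module.finrank ℝ (vectorSpan ℝ (v '' (C : Set ι))) =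
    Module.finrank ℝ (vectorSpan ℝ ((fun i => π (v i)) '' (C : Set ι)))

/-! ### Hypertriangulations of the regular polygon -/

/-- The `i`-th vertex of the regular `n`-gon. -/
def polygon (n : ℕ) (i : Fin n) : EuclideanSpace ℝ (Fin 2) :=
  !₂[Real.cos (2 * Real.pi * (i : ℝ) / n), Real.sin (2 * Real.pi * (i : ℝ) / n)]

/-- The indicator vector `∑ i ∈ B, e i`, a vertex of the cube; for `B` ranging over the `k`-subsets
of `Fin n` these are the vertices of the `k`-th hypersimplex. -/
def cubeVertex (n : ℕ) (B : Finset (Fin n)) : Fin n → ℝ :=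
  ∑ i ∈ B, Pi.single i 1

/-- The linear map `ℝⁿ → ℝ²` with `e i ↦ a i`, so that the indicator vector of `B` is sent to
`∑ i ∈ B, a i`. -/
def projection {n : ℕ} (a : Fin n → EuclideanSpace ℝ (Fin 2)) :
    (Fin n → ℝ) →ₗ[ℝ] EuclideanSpace ℝ (Fin 2) :=
  Fintype.linearCombination ℝ a

/-- Hypertriangulations of level `k` of a planar configuration `a`: fine subdivisions induced by the
projection of the `k`-th hypersimplex to the `k`-th deleted sum of `a`. -/
def IsHypertriangulation {n : ℕ} (a : Fin n → EuclideanSpace ℝ (Fin 2)) (k : ℕ)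
    (S : Set (Finset (Finset (Fin n)))) : Prop :=
  IsFineInducedSubdivision (cubeVertex n) (projection a)
    (Finset.powersetCard k (Finset.univ : Finset (Fin n))) S

/-- The hypercatalan number: the number of hypertriangulations of level `k` of the regular
`n`-gon. -/
def hypercatalan (n k : ℕ) : ℕ :=
  Set.ncard {S : Set (Finset (Finset (Fin n))) | IsHypertriangulation (polygon n) k S}

/-! ### Triangulations of a convex polygon

The vertices of the polygon are labelled cyclically by `Fin n`. A diagonal is a pair `i < j` of
non-adjacent vertices. -/

/-- `d` is a diagonal, i.e. `d.1 < d.2` and they are not the endpoints of a side. -/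
def IsDiagonal {n : ℕ} (d : Fin n × Fin n) : Prop :=
  (d.1 : ℕ) + 1 < d.2 ∧ ¬ ((d.1 : ℕ) = 0 ∧ (d.2 : ℕ) + 1 = n)

/-- Two diagonals cross (in their interiors) if their endpoints alternate. -/
def Crosses {n : ℕ} (d e : Fin n × Fin n) : Prop :=
  (d.1 < e.1 ∧ e.1 < d.2 ∧ d.2 < e.2) ∨ (e.1 < d.1 ∧ d.1 < e.2 ∧ e.2 < d.2)

/-- A triangulation of the convex `n`-gon, given by its set of diagonals: an inclusion-maximal set
of pairwise noncrossing diagonals. -/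
structure IsTriangulation {n : ℕ} (T : Finset (Fin n × Fin n)) : Prop where
  isDiagonal : ∀ d ∈ T, IsDiagonal d
  noncrossing : ∀ d ∈ T, ∀ e ∈ T, ¬ Crosses d e
  maximal : ∀ d, IsDiagonal d → (∀ e ∈ T, ¬ Crosses d e) → d ∈ T

/-- The degree of a vertex: the number of diagonals of `T` incident to it. -/
def degree {n : ℕ} (T : Finset (Fin n × Fin n)) (i : Fin n) : ℕ :=
  (T.filter fun d => d.1 = i ∨ d.2 = i).card

end

end Hyper

/-! The core is the identity $C_N^{(2)}=\sum_T\prod_i C_{\deg_T(i)}$, summed over the triangulations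
$T$ of the $N$-gon. It exhibits the ratio $C_N^{(2)}/C_{N-2}$ as an average of the products in the
first claim, so both claims reduce to bounding one product.

Why the identity holds. In a fine subdivision the cells have dimension at most two, and the faces of
the second hypersimplex then leave two kinds of triangles (`IsHypertriangulation.cell_shape`):
`blackCell t`, the three pairs inside a triple `t`, and `starCell a t`, the pairs joining `a` to the
members of a triple `t`. Let `B` be the set of triples of the first kind and `V a` those of the
second kind at `a`. Being a subdivision amounts to a local balance: every oriented edge has as many
triangles on its left as on its right, up to the contribution of the outer boundary. Read off for
the edge from `{a, x}` to `{a, y}`, this is `IsStarSystem`. Summing the balance over `y` shows that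
`B` triangulates the $N$-gon; given `B`, the balance says that `V a` triangulates the polygon on the
neighbours of `a`. That polygon has $\deg(a)+2$ vertices and the choices at different `a` are
independent, whence the product of Catalan numbers (`isStarSystem_iff`, `card_starSystems`,
`hypercatalan_two`).

From balance to a subdivision one counts signed crossings of a horizontal ray with triangle
boundaries. Interior edges cancel, so a generic point lies in as many triangles as the boundary
winds around it, namely one (`IsBalanced.card_inTriangle`). Conversely, an edge cell of a
subdivision has exactly one triangle on each side that does not face outwards
(`IsTriangular.isBalanced`).

Triangulations are treated as two-chains with prescribed boundary (`IsTri`), so that the balance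
condition is literally their definition. Splitting at the apex of the triangle on a root edge gives
the Catalan recursion (`card_triSet`) and a dual binary tree (`IsTri.exists_tree`).

The bounds. One has $2^{d-1}\le C_d$ for $d\ge1$ and $C_d\le 2^{2d-3}$ for $d\ge2$. There are $n+2$
degrees with sum $2n-2$, so the resulting exponents depend only on the numbers $e_0,e_1$ of vertices
of degree 0 and 1. The lower bound uses $e_0\ge2$; the upper bound amounts to $6e_0+2e_1\le 3n+6$.
Both are proved by induction on the dual tree (`BTree.lower`, `BTree.upper`). The upper bound is
kept in squared form, since $\frac52n-7$ need not be an integer. -/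

namespace Hyper

/-! ### Binary trees and bounds on products of Catalan numbers -/

/-- Plane binary trees, as duals of triangulated polygons with a root edge. -/
inductive BTree where
  | leaf : BTree
  | node : BTree → BTree → BTree

namespace BTree

/-- The number of triangles. -/
def size : BTree → ℕ
  | leaf => 0
  | node s t => size s + size t + 1

/-- The number of triangles at the left end of the root edge. -/
def left : BTree → ℕ
  | leaf => 0
  | node s _ => left s + 1

/-- The number of triangles at the right end of the root edge. -/
def right : BTree → ℕ
  | leaf => 0
  | node _ t => right t + 1

/-- The sum of a weight of the number of triangles over the vertices off the root edge. -/
def inner (g : ℕ → ℕ) : BTree → ℕ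
  | leaf => 0
  | node s t => inner g s + inner g t + g (right s + left t + 1)

/-- For a triangulated polygon there are `size` vertices off the root edge and `3 * size` incidences
of vertices and triangles. Hence `inner + left + right` is `size` plus the number of ears (vertices
in a single triangle) off the root edge. The clauses say that there is one such ear, and a second
one when neither root end is an ear. -/
theorem inner_lower (t : BTree) :
    (t.size = 0 ∧ t.left = 0 ∧ t.right = 0 ∧ t.inner (fun d => d - 2) = 0) ∨
    (1 ≤ t.size ∧ 1 ≤ t.left ∧ 1 ≤ t.right ∧
      t.size + 1 ≤ t.inner (fun d => d - 2) + t.left + t.right ∧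
      (2 ≤ t.left → 2 ≤ t.right → t.size + 2 ≤ t.inner (fun d => d - 2) + t.left + t.right)) := by
  induction t with
  | leaf => left; simp [size, left, right, inner]
  | node s t hs ht =>
    right
    simp only [size, left, right, inner]
    omega

/-- Twice an upper bound of the binary logarithm of `catalan (d - 1)`. -/
def logWeight (d : ℕ) : ℕ := if d = 3 then 2 else 4 * d - 10

/-- Truncated subtraction gives 0 up to `d = 2`, and `4 * d - 10` is already 2 at `d = 3`, so two
regimes suffice. -/
theorem logWeight_cases (d : ℕ) :
    (d ≤ 2 ∧ logWeight d = 0) ∨ (3 ≤ d ∧ logWeight d + 10 = 4 * d) := by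
  unfold logWeight
  split_ifs <;> omega

/-- A weighted count of the triangles at the ends of the root edge, bounded over all trees. -/
def potential (t : BTree) : ℤ := t.inner logWeight + 4 * (t.left + t.right) - 5 * t.size

/-- With `m = right s + left t`, the new inner vertex lies in `m + 1` triangles and the potential
grows by `logWeight (m + 1) - 4 * m + 3`, which is 3, -1 or -3. -/
theorem potential_node (s t : BTree) :
    (right s + left t = 0 ∧ potential (node s t) = s.potential + t.potential + 3) ∨
    (right s + left t = 1 ∧ potential (node s t) = s.potential + t.potential - 1) ∨
    (2 ≤ right s + left t ∧ potential (node s t) = s.potential + t.potential - 3) := by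
  have h := logWeight_cases (right s + left t + 1)
  simp only [potential, size, left, right, inner]
  push_cast
  omega

-- The clauses are the thresholds needed for `upper`. If both root ends lie in at least three
-- triangles, the goal there reads `potential ≤ 6`; an end in two triangles lowers the threshold by
-- 2, an end in one triangle by 6. The exact values for sizes up to 2 and the bound 1 at size 3
-- serve only to carry the induction.
set_option maxHeartbeats 2000000 in
theorem potential_bound (t : BTree) :
    (t.size = 0 ∧ t.left = 0 ∧ t.right = 0 ∧ t.potential = 0) ∨
    (t.size = 1 ∧ t.left = 1 ∧ t.right = 1 ∧ t.potential = 3) ∨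
    (t.size = 2 ∧ 1 ≤ t.left ∧ 1 ≤ t.right ∧ t.left + t.right = 3 ∧ t.potential = 2) ∨
    (3 ≤ t.size ∧ 1 ≤ t.left ∧ 1 ≤ t.right ∧ 3 ≤ t.left + t.right ∧ t.potential ≤ 3 ∧
      (t.left = 1 ∨ t.right = 1 → t.potential ≤ 1) ∧
      (4 ≤ t.size → t.left = 1 ∨ t.right = 1 → t.potential ≤ 0) ∧
      (4 ≤ t.size → t.left + t.right = 3 → t.potential ≤ -2) ∧
      (4 ≤ t.size → t.left = 2 → t.right = 2 → t.potential ≤ 2)) := by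
  induction t with
  | leaf => left; simp [size, left, right, inner, potential]
  | node s t hs ht =>
    have h := potential_node s t
    generalize potential (node s t) = p at *
    simp only [size, left, right]
    generalize potential s = p₁ at *
    generalize potential t = p₂ at *
    generalize size s = n₁ at *
    generalize size t = n₂ at *
    generalize left s = l₁ at *
    generalize left t = l₂ at *
    generalize right s = r₁ at *
    generalize right t = r₂ at *
    rcases hs with hs | hs | hs | hs <;> rcases ht with ht | ht | ht | ht <;>
      rcases h with h | h | h <;> omega

theorem lower (t : BTree) :
    t.size - 2 ≤ t.inner (fun d => d - 2) + (t.left - 2) + (t.right - 2) := by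
  have := inner_lower t
  omega

theorem upper (t : BTree) (ht : 4 ≤ t.size) :
    t.inner logWeight + logWeight t.left + logWeight t.right ≤ 5 * t.size - 14 := by
  have := potential_bound t
  simp only [potential] at this
  have := logWeight_cases t.left
  have := logWeight_cases t.right
  omega

end BTree

/-! ### Growth of the Catalan numbers -/

/-- The ratio of consecutive Catalan numbers is at most 4, and at least 2 from `d = 1` on; the two
power bounds below follow from this. -/
theorem catalan_recurrence (d : ℕ) : (d + 2) * catalan (d + 1) = (4 * d + 2) * catalan d := by
  have h1 := succ_mul_catalan_eq_centralBinom d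
  have h2 := succ_mul_catalan_eq_centralBinom (d + 1)
  have h3 := Nat.succ_mul_centralBinom_succ d
  rw [← h1, ← h2] at h3
  have h4 : (d + 1) * ((d + 2) * catalan (d + 1)) = (d + 1) * ((4 * d + 2) * catalan d) := by
    rw [show (d + 1) * ((4 * d + 2) * catalan d) = 2 * (2 * d + 1) * ((d + 1) * catalan d) by ring]
    exact h3
  exact Nat.eq_of_mul_eq_mul_left (by omega) h4

theorem two_pow_le_catalan (d : ℕ) : 2 ^ (d - 1) ≤ catalan d := by
  induction d with
  | zero => simp
  | succ d ih =>
    rcases Nat.eq_zero_or_pos d with rfl | hd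
    · simp
    · have h := catalan_recurrence d
      have h2 : 2 ^ (d + 1 - 1) = 2 * 2 ^ (d - 1) := by
        rw [← pow_succ']; congr 1; omega
      rw [h2]
      have : (d + 2) * (2 * catalan d) ≤ (d + 2) * catalan (d + 1) := by
        rw [h, ← mul_assoc]
        exact Nat.mul_le_mul_right _ (by omega)
      have := Nat.le_of_mul_le_mul_left this (by omega)
      omega

/-- Starting the factors of 4 at $C_2=2$ rather than at $C_0$ gains the constant that the upper
bound needs. -/
theorem catalan_le_two_pow (d : ℕ) : catalan (d + 2) ≤ 2 ^ (2 * d + 1) := by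
  induction d with
  | zero => simp [catalan_two]
  | succ d ih =>
    have h := catalan_recurrence (d + 2)
    have : (d + 4) * catalan (d + 3) ≤ (d + 4) * (4 * catalan (d + 2)) := by
      rw [h, ← mul_assoc]
      exact Nat.mul_le_mul_right _ (by omega)
    have := Nat.le_of_mul_le_mul_left this (by omega)
    calc catalan (d + 1 + 2) ≤ 4 * catalan (d + 2) := this
      _ ≤ 4 * 2 ^ (2 * d + 1) := by omega
      _ = 2 ^ (2 * (d + 1) + 1) := by ring

theorem catalan_sq_le (d : ℕ) : catalan (d - 1) ^ 2 ≤ 2 ^ BTree.logWeight d := by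
  rcases Nat.lt_or_ge d 3 with hd | hd
  · have : catalan (d - 1) = 1 := by interval_cases d <;> simp
    rw [this]
    exact Nat.one_le_two_pow.trans' (by simp)
  · obtain ⟨e, rfl⟩ := Nat.exists_eq_add_of_le' hd
    have h := catalan_le_two_pow e
    have h2 : BTree.logWeight (e + 3) = (2 * e + 1) * 2 := by
      have := BTree.logWeight_cases (e + 3)
      omega
    rw [h2, pow_mul]
    exact Nat.pow_le_pow_left h 2

/-! ### Triangulations of polygons as two-dimensional chains -/

section Chains

variable {N : ℕ}

/-- The labels `i`, `j`, `k` are in counterclockwise cyclic order. -/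
def ccw (i j k : Fin N) : Prop :=
  ((i : ℕ) < j ∧ (j : ℕ) < k) ∨ ((j : ℕ) < k ∧ (k : ℕ) < i) ∨ ((k : ℕ) < i ∧ (i : ℕ) < j)

instance (i j k : Fin N) : Decidable (ccw i j k) := by unfold ccw; infer_instance

theorem ccw.rotate {i j k : Fin N} (h : ccw i j k) : ccw j k i := by
  unfold ccw at *; omega

theorem ccw.ne {i j k : Fin N} (h : ccw i j k) : i ≠ j ∧ j ≠ k ∧ i ≠ k := by
  simp only [ccw, ne_eq, Fin.ext_iff] at *; omega

theorem ccw_or {i j k : Fin N} (h₁ : i ≠ j) (h₂ : j ≠ k) (h₃ : i ≠ k) : ccw i j k ∨ ccw i k j := by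
  simp only [ccw, ne_eq, Fin.ext_iff] at *; omega

theorem ccw.not_swap {i j k : Fin N} (h : ccw i j k) : ¬ ccw i k j := by
  simp only [ccw] at *; omega

/-- `j` follows `i` in the cyclic order on `X`. -/
def Adj (X : Finset (Fin N)) (i j : Fin N) : Prop :=
  i ∈ X ∧ j ∈ X ∧ i ≠ j ∧ ∀ z ∈ X, ¬ ccw i z j

instance (X : Finset (Fin N)) (i j : Fin N) : Decidable (Adj X i j) := by
  unfold Adj; infer_instance

/-- The number of triangles of `W` to the left of the oriented edge `i j`. -/
def leftCount (W : Finset (Finset (Fin N))) (i j : Fin N) : ℤ :=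
  ∑ k, if ccw i j k ∧ ({i, j, k} : Finset (Fin N)) ∈ W then 1 else 0

/-- The boundary of the polygon with vertex set `X`. -/
def polygonBoundary (X : Finset (Fin N)) (i j : Fin N) : ℤ :=
  (if Adj X i j then 1 else 0) - (if Adj X j i then 1 else 0)

/-- `W` is a set of triangles whose boundary is that of the polygon with vertex set `X`. -/
structure IsTri (X : Finset (Fin N)) (W : Finset (Finset (Fin N))) : Prop where
  card_eq : ∀ t ∈ W, t.card = 3
  boundary : ∀ i j, i ≠ j → leftCount W i j - leftCount W j i = polygonBoundary X i j

theorem leftCount_nonneg (W : Finset (Finset (Fin N))) (i j : Fin N) : 0 ≤ leftCount W i j :=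
  Finset.sum_nonneg fun k _ => by split_ifs <;> simp

theorem leftCount_pos {W : Finset (Finset (Fin N))} {i j : Fin N} :
    0 < leftCount W i j ↔ ∃ k, ccw i j k ∧ ({i, j, k} : Finset (Fin N)) ∈ W := by
  constructor
  · intro h
    by_contra! hc
    have : leftCount W i j = 0 := Finset.sum_eq_zero fun k _ => if_neg fun hk => hc k hk.1 hk.2
    omega
  · rintro ⟨k, hk⟩
    refine Finset.sum_pos' (fun k _ => by split_ifs <;> simp) ⟨k, Finset.mem_univ _, ?_⟩
    rw [if_pos hk]; norm_num

theorem leftCount_eq_zero {W : Finset (Finset (Fin N))} {i j : Fin N}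
    (h : ∀ k, ccw i j k → ({i, j, k} : Finset (Fin N)) ∉ W) : leftCount W i j = 0 :=
  Finset.sum_eq_zero fun k _ => if_neg fun hk => h k hk.1 hk.2

theorem triple_rotate (i j k : Fin N) : ({i, j, k} : Finset (Fin N)) = {j, k, i} := by
  ext; simp only [Finset.mem_insert, Finset.mem_singleton]; tauto

theorem exists_ccw_of_card {t : Finset (Fin N)} (ht : t.card = 3) {v : Fin N} (hv : v ∈ t) :
    ∃ x y, ccw v x y ∧ t = {v, x, y} := by
  have h2 : (t.erase v).card = 2 := by rw [Finset.card_erase_of_mem hv, ht]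
  obtain ⟨x, y, hxy, he⟩ := Finset.card_eq_two.1 h2
  have ht' : t = {v, x, y} := by rw [← Finset.insert_erase hv, he]
  have hx : x ∈ t.erase v := by simp [he]
  have hy : y ∈ t.erase v := by simp [he]
  rcases ccw_or (Finset.ne_of_mem_erase hx).symm hxy (Finset.ne_of_mem_erase hy).symm with h | h
  · exact ⟨x, y, h, ht'⟩
  · exact ⟨y, x, h, by rw [ht', Finset.pair_comm]⟩

theorem exists_ccw_edge {t : Finset (Fin N)} (ht : t.card = 3) {v w : Fin N} (hv : v ∈ t)
    (hw : w ∈ t) (hvw : v ≠ w) :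
    ∃ x, (ccw v w x ∨ ccw w v x) ∧ t = {v, w, x} := by
  obtain ⟨x, y, h, rfl⟩ := exists_ccw_of_card ht hv
  simp only [Finset.mem_insert, Finset.mem_singleton] at hw
  rcases hw with rfl | rfl | rfl
  · exact absurd rfl hvw
  · exact ⟨y, Or.inl h, rfl⟩
  · exact ⟨x, Or.inr h.rotate.rotate, by rw [Finset.pair_comm]⟩

theorem exists_sorted {t : Finset (Fin N)} (ht : t.card = 3) :
    ∃ x y z : Fin N, (x : ℕ) < y ∧ (y : ℕ) < z ∧ t = {x, y, z} := by
  obtain ⟨v, hv⟩ := Finset.card_pos.1 (by omega : 0 < t.card)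
  obtain ⟨x, y, h, rfl⟩ := exists_ccw_of_card ht hv
  rcases h with h | h | h
  · exact ⟨v, x, y, h.1, h.2, rfl⟩
  · exact ⟨x, y, v, h.1, h.2, triple_rotate _ _ _⟩
  · exact ⟨y, v, x, h.1, h.2, (triple_rotate _ _ _).symm⟩

/-- The position of `k` in counterclockwise order starting from `v`. -/
def cyclicKey (v k : Fin N) : ℕ := if (v : ℕ) ≤ k then k - v else k + N - v

theorem ccw_iff_cyclicKey (v x y : Fin N) :
    ccw v x y ↔ 0 < cyclicKey v x ∧ cyclicKey v x < cyclicKey v y := by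
  have := v.isLt
  have := x.isLt
  have := y.isLt
  unfold ccw cyclicKey
  split_ifs <;> omega

/-- At a vertex `v` outside `X` the boundary vanishes, so the triangles at `v` continue one another
counterclockwise. The triangle `v z k` with `k` last in the order starting at `v` would need a
successor `v k k'` with `k'` even later. -/
theorem IsTri.mem_of_mem {X : Finset (Fin N)} {W : Finset (Finset (Fin N))} (h : IsTri X W)
    {t : Finset (Fin N)} (ht : t ∈ W) {v : Fin N} (hv : v ∈ t) : v ∈ X := by
  by_contra hvX
  have hne : (Finset.univ.filter fun k => ∃ z, ccw v z k ∧
      ({v, z, k} : Finset (Fin N)) ∈ W).Nonempty := by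
    obtain ⟨x, y, hxy, rfl⟩ := exists_ccw_of_card (h.card_eq t ht) hv
    exact ⟨y, Finset.mem_filter.2 ⟨Finset.mem_univ _, x, hxy, ht⟩⟩
  obtain ⟨k, hk, hmax⟩ := Finset.exists_max_image _ (cyclicKey v) hne
  obtain ⟨z, hz, hzW⟩ := (Finset.mem_filter.1 hk).2
  have h1 : 0 < leftCount W k v :=
    leftCount_pos.2 ⟨z, hz.rotate.rotate, by rwa [triple_rotate]⟩
  have h2 := h.boundary v k hz.ne.2.2
  have h3 : polygonBoundary X v k = 0 := by simp [polygonBoundary, Adj, hvX]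
  obtain ⟨k', hk', hkW⟩ := leftCount_pos.1 (by omega : 0 < leftCount W v k)
  have := hmax k' (Finset.mem_filter.2 ⟨Finset.mem_univ _, k, hk', hkW⟩)
  have := (ccw_iff_cyclicKey v k k').1 hk'
  omega

/-- The cyclic order on `X` descends only once, from the largest element to the smallest. This
identifies the root edge in the boundary. -/
theorem adj_last_first {X : Finset (Fin N)} {a b : Fin N} (ha : a ∈ X) (hb : b ∈ X)
    (hX : ∀ v ∈ X, (a : ℕ) ≤ v ∧ (v : ℕ) ≤ b) {i j : Fin N} (hij : (i : ℕ) < j) :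
    Adj X j i ↔ i = a ∧ j = b := by
  constructor
  · rintro ⟨hj, hi, -, h⟩
    have h1 := h a ha
    have h2 := h b hb
    have h3 := hX i hi
    have h4 := hX j hj
    simp only [ccw, Fin.ext_iff] at *
    omega
  · rintro ⟨rfl, rfl⟩
    refine ⟨hb, ha, by simp only [ne_eq, Fin.ext_iff]; omega, fun z hz => ?_⟩
    have := hX z hz
    unfold ccw
    omega

/-- The data of a triangle on the root edge of the polygon with vertex set `X`. -/
structure IsApex (X : Finset (Fin N)) (a k b : Fin N) : Prop where
  left_mem : a ∈ X
  mem : k ∈ X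
  right_mem : b ∈ X
  bounds : ∀ v ∈ X, (a : ℕ) ≤ v ∧ (v : ℕ) ≤ b
  left_lt : (a : ℕ) < k
  lt_right : (k : ℕ) < b

/-- The edge from `b` to `a` has boundary coefficient 1, hence a triangle on its left. The vertex
`y` only ensures that `X` is not a two-gon, whose two sides cancel. -/
theorem IsTri.exists_apex {X : Finset (Fin N)} {W : Finset (Finset (Fin N))} (h : IsTri X W)
    {a y b : Fin N} (hy : IsApex X a y b) :
    ∃ k, IsApex X a k b ∧ ({a, k, b} : Finset (Fin N)) ∈ W := by
  have hab : (a : ℕ) < b := hy.left_lt.trans hy.lt_right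
  have h1 := h.boundary b a (by simp only [ne_eq, Fin.ext_iff]; omega)
  have h2 : polygonBoundary X b a = 1 := by
    rw [polygonBoundary, if_pos ((adj_last_first hy.left_mem hy.right_mem hy.bounds hab).2
      ⟨rfl, rfl⟩), if_neg]
    · rfl
    · rintro ⟨-, -, -, h⟩
      exact h y hy.mem (Or.inl ⟨hy.left_lt, hy.lt_right⟩)
  have h3 := leftCount_nonneg W a b
  obtain ⟨k, hk, hkW⟩ := leftCount_pos.1 (by omega : 0 < leftCount W b a)
  have hkX := h.mem_of_mem hkW (v := k) (by simp)
  refine ⟨k, ⟨hy.left_mem, hkX, hy.right_mem, hy.bounds, ?_, ?_⟩, ?_⟩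
  · unfold ccw at hk; omega
  · unfold ccw at hk; omega
  · rwa [triple_rotate] at hkW

/-- Nothing of `X` lies beyond the root edge, so no right-hand triangle can compensate: the number
of triangles on it is its boundary coefficient, at most 1. -/
theorem IsTri.apex_unique {X : Finset (Fin N)} {W : Finset (Finset (Fin N))} (h : IsTri X W)
    {a k k' b : Fin N} (hk : IsApex X a k b) (hk' : IsApex X a k' b)
    (hW : ({a, k, b} : Finset (Fin N)) ∈ W) (hW' : ({a, k', b} : Finset (Fin N)) ∈ W) :
    k = k' := by
  by_contra hne
  have hab : (a : ℕ) < b := hk.left_lt.trans hk.lt_right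
  have h1 := h.boundary b a (by simp only [ne_eq, Fin.ext_iff]; omega)
  have h2 : polygonBoundary X b a ≤ 1 := by
    unfold polygonBoundary
    split_ifs <;> simp
  have h3 : leftCount W a b = 0 := by
    refine leftCount_eq_zero fun z hz hzW => ?_
    have := hk.bounds z (h.mem_of_mem hzW (by simp))
    unfold ccw at hz
    omega
  have h4 : (2 : ℤ) ≤ leftCount W b a := by
    have hsub : ({k, k'} : Finset (Fin N)) ⊆ Finset.univ := Finset.subset_univ _
    have := Finset.sum_le_sum_of_subset_of_nonneg (f := fun z : Fin N =>
      if ccw b a z ∧ ({b, a, z} : Finset (Fin N)) ∈ W then (1 : ℤ) else 0) hsub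
      (fun z _ _ => by split_ifs <;> simp)
    rw [Finset.sum_pair hne, if_pos, if_pos] at this
    · exact this
    · exact ⟨Or.inr (Or.inl ⟨hk'.left_lt, hk'.lt_right⟩), by rwa [triple_rotate]⟩
    · exact ⟨Or.inr (Or.inl ⟨hk.left_lt, hk.lt_right⟩), by rwa [triple_rotate]⟩
  omega

/-- An edge `x z` passing over `k`, other than the root edge, is interior, so it has a triangle on
its outer side, and one of the edges of that triangle passes over `k` and is longer. By induction
the longer edge is the root edge, which yields a second apex. The induction is on the deficit `N -
(z - x)`. -/
theorem IsTri.not_cross {X : Finset (Fin N)} {W : Finset (Finset (Fin N))} (h : IsTri X W)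
    {a k b : Fin N} (hk : IsApex X a k b) (hW : ({a, k, b} : Finset (Fin N)) ∈ W)
    {t : Finset (Fin N)} (ht : t ∈ W) {x z : Fin N} (hx : x ∈ t) (hz : z ∈ t)
    (hxk : (x : ℕ) < k) (hkz : (k : ℕ) < z) : x = a ∧ z = b := by
  induction hn : N - ((z : ℕ) - x) using Nat.strong_induction_on generalizing x z t with
  | _ n ih =>
  by_contra hne
  have hxX := h.mem_of_mem ht hx
  have hzX := h.mem_of_mem ht hz
  have hxz : x ≠ z := by simp only [ne_eq, Fin.ext_iff]; omega
  have h1 := h.boundary x z hxz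
  have h2 : polygonBoundary X x z = 0 := by
    rw [polygonBoundary, if_neg, if_neg, sub_zero]
    · rwa [adj_last_first hk.left_mem hk.right_mem hk.bounds (by omega)]
    · rintro ⟨-, -, -, h⟩
      exact h k hk.mem (Or.inl ⟨hxk, hkz⟩)
  have h3 : 0 < leftCount W x z := by
    obtain ⟨y, hy | hy, rfl⟩ := exists_ccw_edge (h.card_eq t ht) hx hz hxz
    · exact leftCount_pos.2 ⟨y, hy, ht⟩
    · have : 0 < leftCount W z x := leftCount_pos.2 ⟨y, hy, by rwa [Finset.insert_comm]⟩
      omega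
  obtain ⟨w, hw, hwW⟩ := leftCount_pos.1 h3
  have hzN := z.isLt
  have hwN := w.isLt
  by_cases hlt : (w : ℕ) < x
  · have h5 := ih (N - (z - w)) (by omega) hwW (x := w) (z := z) (by simp) (by simp)
      (by omega) hkz rfl
    rw [h5.1, h5.2] at hwW
    have hxa : IsApex X a x b := ⟨hk.left_mem, hxX, hk.right_mem, hk.bounds, h5.1 ▸ hlt,
      by have := h5.2 ▸ hkz; omega⟩
    have := h.apex_unique hk hxa hW (by rwa [triple_rotate])
    simp only [Fin.ext_iff] at this
    omega
  · have hgt : (z : ℕ) < w := by unfold ccw at hw; omega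
    have h5 := ih (N - (w - x)) (by omega) hwW (x := x) (z := w) (by simp) (by simp)
      hxk (by omega) rfl
    rw [h5.1, h5.2] at hwW
    have hza : IsApex X a z b := ⟨hk.left_mem, hzX, hk.right_mem, hk.bounds,
      by have := h5.1 ▸ hxk; omega, h5.2 ▸ hgt⟩
    have := h.apex_unique hk hza hW hwW
    simp only [Fin.ext_iff] at this
    omega

/-- The part of a vertex set or of the vertices before or at `k`. -/
def below (X : Finset (Fin N)) (k : Fin N) : Finset (Fin N) := X.filter fun v => (v : ℕ) ≤ k

/-- The part of a vertex set after or at `k`. -/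
def above (X : Finset (Fin N)) (k : Fin N) : Finset (Fin N) := X.filter fun v => (k : ℕ) ≤ v

theorem mem_below {X : Finset (Fin N)} {k v : Fin N} : v ∈ below X k ↔ v ∈ X ∧ (v : ℕ) ≤ k :=
  Finset.mem_filter

theorem mem_above {X : Finset (Fin N)} {k v : Fin N} : v ∈ above X k ↔ v ∈ X ∧ (k : ℕ) ≤ v :=
  Finset.mem_filter

theorem IsTri.eq_or_below_or_above {X : Finset (Fin N)} {W : Finset (Finset (Fin N))}
    (h : IsTri X W) {a k b : Fin N} (hk : IsApex X a k b)
    (hW : ({a, k, b} : Finset (Fin N)) ∈ W) {t : Finset (Fin N)} (ht : t ∈ W) :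
    t = {a, k, b} ∨ (∀ v ∈ t, (v : ℕ) ≤ k) ∨ (∀ v ∈ t, (k : ℕ) ≤ v) := by
  obtain ⟨x, y, z, hxy, hyz, rfl⟩ := exists_sorted (h.card_eq t ht)
  by_cases hc : (x : ℕ) < k ∧ (k : ℕ) < z
  · left
    obtain ⟨rfl, rfl⟩ := h.not_cross hk hW ht (x := x) (z := z) (by simp) (by simp) hc.1 hc.2
    have hy : IsApex X x y z := ⟨hk.left_mem, h.mem_of_mem ht (by simp), hk.right_mem, hk.bounds,
      hxy, hyz⟩
    rw [h.apex_unique hk hy hW ht]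
  · right
    simp only [Finset.mem_insert, Finset.mem_singleton, forall_eq_or_imp, forall_eq]
    omega

theorem leftCount_insert {W : Finset (Finset (Fin N))} {t : Finset (Fin N)} (ht : t ∉ W)
    (i j : Fin N) : leftCount (insert t W) i j = leftCount W i j + leftCount {t} i j := by
  unfold leftCount
  rw [← Finset.sum_add_distrib]
  refine Finset.sum_congr rfl fun k _ => ?_
  by_cases h1 : ({i, j, k} : Finset (Fin N)) = t
  · simp [h1, ht]
  · simp [h1]

theorem leftCount_union {A B : Finset (Finset (Fin N))} (h : Disjoint A B) (i j : Fin N) :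
    leftCount (A ∪ B) i j = leftCount A i j + leftCount B i j := by
  unfold leftCount
  rw [← Finset.sum_add_distrib]
  refine Finset.sum_congr rfl fun k _ => ?_
  by_cases h1 : ({i, j, k} : Finset (Fin N)) ∈ A
  · simp [h1, Finset.disjoint_left.1 h h1]
  · simp [h1]

theorem triple_eq_iff {x y z i j k : Fin N} (h : ccw x y z) (h' : ccw i j k) :
    ({i, j, k} : Finset (Fin N)) = {x, y, z} ↔
      (i = x ∧ j = y ∧ k = z) ∨ (i = y ∧ j = z ∧ k = x) ∨ (i = z ∧ j = x ∧ k = y) := by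
  constructor
  · intro he
    have hi : i ∈ ({x, y, z} : Finset (Fin N)) := by simp [← he]
    have hj : j ∈ ({x, y, z} : Finset (Fin N)) := by simp [← he]
    have hk : k ∈ ({x, y, z} : Finset (Fin N)) := by simp [← he]
    simp only [Finset.mem_insert, Finset.mem_singleton] at hi hj hk
    have h1 := h'.ne
    have h2 := h.not_swap
    have h3 := h.rotate.not_swap
    have h4 := h.rotate.rotate.not_swap
    rcases hi with rfl | rfl | rfl <;> rcases hj with rfl | rfl | rfl <;>
      rcases hk with rfl | rfl | rfl <;> simp_all
  · rintro (⟨rfl, rfl, rfl⟩ | ⟨rfl, rfl, rfl⟩ | ⟨rfl, rfl, rfl⟩)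
    · rfl
    · rw [triple_rotate, triple_rotate]
    · rw [triple_rotate]

theorem leftCount_singleton {x y z : Fin N} (h : ccw x y z) (i j : Fin N) :
    leftCount {({x, y, z} : Finset (Fin N))} i j =
      if (i = x ∧ j = y) ∨ (i = y ∧ j = z) ∨ (i = z ∧ j = x) then 1 else 0 := by
  unfold leftCount
  simp only [Finset.mem_singleton]
  have key : ∀ w, ccw i j w ∧ ({i, j, w} : Finset (Fin N)) = {x, y, z} ↔
      (i = x ∧ j = y ∧ w = z) ∨ (i = y ∧ j = z ∧ w = x) ∨ (i = z ∧ j = x ∧ w = y) := by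
    intro w
    constructor
    · rintro ⟨h1, h2⟩
      exact (triple_eq_iff h h1).1 h2
    · intro h1
      have h2 : ccw i j w := by
        rcases h1 with ⟨rfl, rfl, rfl⟩ | ⟨rfl, rfl, rfl⟩ | ⟨rfl, rfl, rfl⟩
        exacts [h, h.rotate, h.rotate.rotate]
      exact ⟨h2, (triple_eq_iff h h2).2 h1⟩
  simp only [key]
  obtain ⟨n1, n2, n3⟩ := h.ne
  by_cases h1 : i = x ∧ j = y
  · obtain ⟨rfl, rfl⟩ := h1
    simp [n1, n3]
  · by_cases h2 : i = y ∧ j = z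
    · obtain ⟨rfl, rfl⟩ := h2
      simp [n1.symm, n2]
    · by_cases h3 : i = z ∧ j = x
      · obtain ⟨rfl, rfl⟩ := h3
        simp [n2.symm, n3.symm]
      · rw [if_neg (by tauto)]
        exact Finset.sum_eq_zero fun w _ => if_neg (by tauto)

theorem leftCount_zero_of_notMem {A : Finset (Finset (Fin N))} {S : Fin N → Prop}
    (hA : ∀ t ∈ A, ∀ v ∈ t, S v) {i j : Fin N} (h : ¬ (S i ∧ S j)) : leftCount A i j = 0 :=
  leftCount_eq_zero fun k _ hk => h ⟨hA _ hk i (by simp), hA _ hk j (by simp)⟩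

theorem isApex_below {X : Finset (Fin N)} {a k b : Fin N} (hk : IsApex X a k b) :
    a ∈ below X k ∧ k ∈ below X k ∧ ∀ v ∈ below X k, (a : ℕ) ≤ v ∧ (v : ℕ) ≤ k :=
  ⟨mem_below.2 ⟨hk.left_mem, hk.left_lt.le⟩, mem_below.2 ⟨hk.mem, le_rfl⟩,
    fun v hv => ⟨(hk.bounds v (mem_below.1 hv).1).1, (mem_below.1 hv).2⟩⟩

theorem isApex_above {X : Finset (Fin N)} {a k b : Fin N} (hk : IsApex X a k b) :
    k ∈ above X k ∧ b ∈ above X k ∧ ∀ v ∈ above X k, (k : ℕ) ≤ v ∧ (v : ℕ) ≤ b :=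
  ⟨mem_above.2 ⟨hk.mem, le_rfl⟩, mem_above.2 ⟨hk.right_mem, hk.lt_right.le⟩,
    fun v hv => ⟨(mem_above.1 hv).2, (hk.bounds v (mem_above.1 hv).1).2⟩⟩

theorem polygonBoundary_eq_zero {X : Finset (Fin N)} {i j : Fin N} (h : ¬ (i ∈ X ∧ j ∈ X)) :
    polygonBoundary X i j = 0 := by
  rw [polygonBoundary, if_neg, if_neg, sub_zero]
  · exact fun h' => h ⟨h'.2.1, h'.1⟩
  · exact fun h' => h ⟨h'.1, h'.2.1⟩

theorem polygonBoundary_swap (X : Finset (Fin N)) (i j : Fin N) :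
    polygonBoundary X i j = - polygonBoundary X j i := by
  unfold polygonBoundary; ring

/-- The boundary of the polygon `X` is that of its two parts cut off by the triangle `a k b`,
plus the boundary of this triangle. -/
theorem polygonBoundary_split {X : Finset (Fin N)} {a k b : Fin N} (hk : IsApex X a k b)
    (i j : Fin N) (hij : i ≠ j) :
    polygonBoundary X i j = polygonBoundary (below X k) i j + polygonBoundary (above X k) i j +
      (leftCount {({a, k, b} : Finset (Fin N))} i j -
        leftCount {({a, k, b} : Finset (Fin N))} j i) := by
  wlog hlt : (i : ℕ) < j generalizing i j
  · have := this j i hij.symm (by simp only [ne_eq, Fin.ext_iff] at hij; omega)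
    rw [polygonBoundary_swap, this, polygonBoundary_swap (below X k) i j,
      polygonBoundary_swap (above X k) i j]
    ring
  have hab := hk.left_lt.trans hk.lt_right
  have hccw : ccw a k b := Or.inl ⟨hk.left_lt, hk.lt_right⟩
  rw [leftCount_singleton hccw, leftCount_singleton hccw]
  have e1 : ∀ x y : Fin N, x = y ↔ (x : ℕ) = y := fun x y => Fin.ext_iff
  have hl := hk.left_lt
  have hr := hk.lt_right
  have A1 := adj_last_first hk.left_mem hk.right_mem hk.bounds hlt
  have A2 := adj_last_first (isApex_below hk).1 (isApex_below hk).2.1 (isApex_below hk).2.2 hlt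
  have A3 := adj_last_first (isApex_above hk).1 (isApex_above hk).2.1 (isApex_above hk).2.2 hlt
  have B1 : Adj X i j ↔ Adj (below X k) i j ∨ Adj (above X k) i j := by
    constructor
    · rintro ⟨h1, h2, h3, h4⟩
      have := h4 k hk.mem
      by_cases hjk : (j : ℕ) ≤ k
      · exact Or.inl ⟨mem_below.2 ⟨h1, by omega⟩, mem_below.2 ⟨h2, hjk⟩, h3,
          fun z hz => h4 z (mem_below.1 hz).1⟩
      · refine Or.inr ⟨mem_above.2 ⟨h1, ?_⟩, mem_above.2 ⟨h2, by omega⟩, h3,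
          fun z hz => h4 z (mem_above.1 hz).1⟩
        unfold ccw at this; omega
    · rintro (⟨h1, h2, h3, h4⟩ | ⟨h1, h2, h3, h4⟩)
      · rw [mem_below] at h1 h2
        refine ⟨h1.1, h2.1, h3, fun z hz hc => h4 z (mem_below.2 ⟨hz, ?_⟩) hc⟩
        unfold ccw at hc; omega
      · rw [mem_above] at h1 h2
        refine ⟨h1.1, h2.1, h3, fun z hz hc => h4 z (mem_above.2 ⟨hz, ?_⟩) hc⟩
        unfold ccw at hc; omega
  have B2 : ¬ (Adj (below X k) i j ∧ Adj (above X k) i j) := by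
    rintro ⟨⟨-, h2, -, -⟩, ⟨h1, -, -, -⟩⟩
    rw [mem_below] at h2
    rw [mem_above] at h1
    omega
  unfold polygonBoundary
  rw [if_congr A1 rfl rfl, if_congr A2 rfl rfl, if_congr A3 rfl rfl, if_congr B1 rfl rfl]
  simp only [e1]
  by_cases c1 : Adj (below X k) i j <;> by_cases c2 : Adj (above X k) i j <;>
    simp only [c1, c2, true_and, and_self, not_true] at B2 <;>
    simp only [c1, c2, if_true, if_false, or_true, or_false] <;>
    split_ifs <;> omega

/-- Triangulations of the polygon `X` with triangle `a k b` on the root edge are pairs of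
triangulations of the two parts cut off by this triangle. -/
theorem isTri_join {X : Finset (Fin N)} {a k b : Fin N} (hk : IsApex X a k b)
    {A B : Finset (Finset (Fin N))} (hA3 : ∀ t ∈ A, t.card = 3) (hB3 : ∀ t ∈ B, t.card = 3)
    (hA : ∀ t ∈ A, ∀ v ∈ t, (v : ℕ) ≤ k) (hB : ∀ t ∈ B, ∀ v ∈ t, (k : ℕ) ≤ v) :
    IsTri X (insert {a, k, b} (A ∪ B)) ↔ IsTri (below X k) A ∧ IsTri (above X k) B := by
  have hl := hk.left_lt
  have hr := hk.lt_right
  have hdisj : Disjoint A B := by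
    rw [Finset.disjoint_left]
    intro t h1 h2
    have : t ⊆ {k} := fun v hv => by
      have := hA t h1 v hv
      have := hB t h2 v hv
      simp only [Finset.mem_singleton, Fin.ext_iff]; omega
    have := Finset.card_le_card this
    rw [hA3 t h1] at this
    simp at this
  have hnot : ({a, k, b} : Finset (Fin N)) ∉ A ∪ B := by
    rw [Finset.mem_union]
    rintro (h | h)
    · have := hA _ h b (by simp); omega
    · have := hB _ h a (by simp); omega
  have hccw : ccw a k b := Or.inl ⟨hl, hr⟩
  -- The boundary defects of `A` and `B` add up to that of the union. They cannot cancel: by `zA`,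
  -- `zB` and `hor`, at each pair of distinct vertices one of the two defects is zero, because the
  -- parts share only `k`.
  have key : ∀ i j, i ≠ j →
      (leftCount (insert {a, k, b} (A ∪ B)) i j - leftCount (insert {a, k, b} (A ∪ B)) j i =
        polygonBoundary X i j ↔
      (leftCount A i j - leftCount A j i - polygonBoundary (below X k) i j) +
      (leftCount B i j - leftCount B j i - polygonBoundary (above X k) i j) = 0) := by
    intro i j hij
    rw [leftCount_insert hnot, leftCount_insert hnot, leftCount_union hdisj, leftCount_union hdisj,
      polygonBoundary_split hk i j hij]
    constructor <;> intro h <;> linarith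
  have zA : ∀ i j : Fin N, ¬ ((i : ℕ) ≤ k ∧ (j : ℕ) ≤ k) →
      leftCount A i j - leftCount A j i - polygonBoundary (below X k) i j = 0 := by
    intro i j h
    rw [leftCount_zero_of_notMem hA h, leftCount_zero_of_notMem hA (fun h' => h h'.symm),
      polygonBoundary_eq_zero (fun h' => h ⟨(mem_below.1 h'.1).2, (mem_below.1 h'.2).2⟩)]
    rfl
  have zB : ∀ i j : Fin N, ¬ ((k : ℕ) ≤ i ∧ (k : ℕ) ≤ j) →
      leftCount B i j - leftCount B j i - polygonBoundary (above X k) i j = 0 := by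
    intro i j h
    rw [leftCount_zero_of_notMem hB h, leftCount_zero_of_notMem hB (fun h' => h h'.symm),
      polygonBoundary_eq_zero (fun h' => h ⟨(mem_above.1 h'.1).2, (mem_above.1 h'.2).2⟩)]
    rfl
  have hor : ∀ i j : Fin N, i ≠ j →
      ¬ ((i : ℕ) ≤ k ∧ (j : ℕ) ≤ k) ∨ ¬ ((k : ℕ) ≤ i ∧ (k : ℕ) ≤ j) := by
    intro i j h
    simp only [ne_eq, Fin.ext_iff] at h
    omega
  constructor
  · intro h
    refine ⟨⟨hA3, fun i j hij => ?_⟩, ⟨hB3, fun i j hij => ?_⟩⟩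
    · have h1 := (key i j hij).1 (h.boundary i j hij)
      rcases hor i j hij with h2 | h2
      · have := zA i j h2; linarith
      · have := zB i j h2; linarith
    · have h1 := (key i j hij).1 (h.boundary i j hij)
      rcases hor i j hij with h2 | h2
      · have := zA i j h2; linarith
      · have := zB i j h2; linarith
  · rintro ⟨h1, h2⟩
    refine ⟨?_, fun i j hij => (key i j hij).2 ?_⟩
    · intro t ht
      rcases Finset.mem_insert.1 ht with rfl | ht
      · obtain ⟨n1, n2, n3⟩ := hccw.ne
        exact Finset.card_eq_three.2 ⟨_, _, _, n1, n3, n2, rfl⟩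
      · rcases Finset.mem_union.1 ht with ht | ht
        exacts [hA3 t ht, hB3 t ht]
    · rw [h1.boundary i j hij, h2.boundary i j hij]; ring

/-- The triangles of `W` before or at `k`. -/
def trianglesBelow (W : Finset (Finset (Fin N))) (k : Fin N) : Finset (Finset (Fin N)) :=
  W.filter fun t => ∀ v ∈ t, (v : ℕ) ≤ k

/-- The triangles of `W` after or at `k`. -/
def trianglesAbove (W : Finset (Finset (Fin N))) (k : Fin N) : Finset (Finset (Fin N)) :=
  W.filter fun t => ∀ v ∈ t, (k : ℕ) ≤ v

theorem IsTri.eq_join {X : Finset (Fin N)} {W : Finset (Finset (Fin N))} (h : IsTri X W)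
    {a k b : Fin N} (hk : IsApex X a k b) (hW : ({a, k, b} : Finset (Fin N)) ∈ W) :
    W = insert {a, k, b} (trianglesBelow W k ∪ trianglesAbove W k) := by
  ext t
  simp only [trianglesBelow, trianglesAbove, Finset.mem_insert, Finset.mem_union,
    Finset.mem_filter]
  constructor
  · intro ht
    rcases h.eq_or_below_or_above hk hW ht with h1 | h1 | h1
    · exact Or.inl h1
    · exact Or.inr (Or.inl ⟨ht, h1⟩)
    · exact Or.inr (Or.inr ⟨ht, h1⟩)
  · rintro (rfl | h1 | h1)
    exacts [hW, h1.1, h1.1]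

theorem IsTri.split {X : Finset (Fin N)} {W : Finset (Finset (Fin N))} (h : IsTri X W)
    {a k b : Fin N} (hk : IsApex X a k b) (hW : ({a, k, b} : Finset (Fin N)) ∈ W) :
    IsTri (below X k) (trianglesBelow W k) ∧ IsTri (above X k) (trianglesAbove W k) := by
  refine (isTri_join hk (A := trianglesBelow W k) (B := trianglesAbove W k)
    (fun t ht => h.card_eq t (Finset.mem_filter.1 ht).1)
    (fun t ht => h.card_eq t (Finset.mem_filter.1 ht).1)
    (fun t ht => (Finset.mem_filter.1 ht).2) (fun t ht => (Finset.mem_filter.1 ht).2)).1 ?_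
  rwa [← h.eq_join hk hW]

/-- The degenerate two-gon is the base case of all recursions: each of its vertices follows the
other, so its boundary is zero. -/
theorem isTri_pair_iff {X : Finset (Fin N)} (hX : X.card = 2) {W : Finset (Finset (Fin N))} :
    IsTri X W ↔ W = ∅ := by
  constructor
  · intro h
    refine Finset.eq_empty_of_forall_notMem fun t ht => ?_
    have := Finset.card_le_card (fun v hv => h.mem_of_mem ht hv : t ⊆ X)
    rw [h.card_eq t ht] at this
    omega
  · rintro rfl
    refine ⟨by simp, fun i j hij => ?_⟩
    have h0 : ∀ i j : Fin N, leftCount ∅ i j = 0 := fun i j => leftCount_eq_zero (by simp)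
    rw [h0, h0]
    by_cases h : i ∈ X ∧ j ∈ X
    · have hX' : X = {i, j} := by
        refine (Finset.eq_of_subset_of_card_le ?_ ?_).symm
        · intro v; simp only [Finset.mem_insert, Finset.mem_singleton]
          rintro (rfl | rfl)
          exacts [h.1, h.2]
        · rw [hX, Finset.card_pair hij]
      have h1 : Adj X i j := ⟨h.1, h.2, hij, by
        rw [hX']; simp [ccw]; omega⟩
      have h2 : Adj X j i := ⟨h.2, h.1, hij.symm, by
        rw [hX']; simp [ccw]; omega⟩
      simp [polygonBoundary, h1, h2]
    · rw [polygonBoundary_eq_zero h]; rfl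

/-- A vertex set with at least three elements has a candidate apex. -/
theorem exists_isApex {X : Finset (Fin N)} (hX : 3 ≤ X.card) : ∃ a k b, IsApex X a k b := by
  have hne : X.Nonempty := Finset.card_pos.1 (by omega)
  have hc : ((X.erase (X.min' hne)).erase (X.max' hne)).Nonempty := by
    rw [← Finset.card_pos]
    have h1 := Finset.pred_card_le_card_erase (s := X) (a := X.min' hne)
    have h2 := Finset.pred_card_le_card_erase (s := X.erase (X.min' hne)) (a := X.max' hne)
    omega
  obtain ⟨k, hk⟩ := hc
  rw [Finset.mem_erase, Finset.mem_erase] at hk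
  refine ⟨X.min' hne, k, X.max' hne, X.min'_mem _, hk.2.2, X.max'_mem _, fun v hv =>
    ⟨X.min'_le v hv, X.le_max' v hv⟩, ?_, ?_⟩
  · exact lt_of_le_of_ne (X.min'_le k hk.2.2) (fun h => hk.2.1 (Fin.ext h.symm))
  · exact lt_of_le_of_ne (X.le_max' k hk.2.2) (fun h => hk.1 (Fin.ext h))

theorem card_below_add_card_above {X : Finset (Fin N)} {k : Fin N} (hk : k ∈ X) :
    (below X k).card + (above X k).card = X.card + 1 := by
  have h1 : below X k ∪ above X k = X := by
    ext v
    simp only [Finset.mem_union, mem_below, mem_above]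
    have := le_total (v : ℕ) k
    tauto
  have h2 : below X k ∩ above X k = {k} := by
    ext v
    simp only [Finset.mem_inter, mem_below, mem_above, Finset.mem_singleton, Fin.ext_iff]
    constructor
    · rintro ⟨⟨-, h1⟩, -, h2⟩; omega
    · intro h
      have : v = k := Fin.ext h
      subst this
      simp [hk]
  rw [← Finset.card_union_add_card_inter, h1, h2, Finset.card_singleton]

theorem two_le_card_below {X : Finset (Fin N)} {a k b : Fin N} (hk : IsApex X a k b) :
    2 ≤ (below X k).card := by
  have : ({a, k} : Finset (Fin N)) ⊆ below X k := by
    intro v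
    simp only [Finset.mem_insert, Finset.mem_singleton]
    rintro (rfl | rfl)
    exacts [(isApex_below hk).1, (isApex_below hk).2.1]
  have h := Finset.card_le_card this
  rwa [Finset.card_pair] at h
  have := hk.left_lt
  simp only [ne_eq, Fin.ext_iff]; omega

theorem two_le_card_above {X : Finset (Fin N)} {a k b : Fin N} (hk : IsApex X a k b) :
    2 ≤ (above X k).card := by
  have : ({k, b} : Finset (Fin N)) ⊆ above X k := by
    intro v
    simp only [Finset.mem_insert, Finset.mem_singleton]
    rintro (rfl | rfl)
    exacts [(isApex_above hk).1, (isApex_above hk).2.1]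
  have h := Finset.card_le_card this
  rwa [Finset.card_pair] at h
  have := hk.lt_right
  simp only [ne_eq, Fin.ext_iff]; omega

/-- Structural induction on triangulations. -/
@[elab_as_elim]
theorem IsTri.induction {P : Finset (Fin N) → Finset (Finset (Fin N)) → Prop}
    (pair : ∀ X : Finset (Fin N), X.card = 2 → P X ∅)
    (join : ∀ (X : Finset (Fin N)) (a k b : Fin N) (A B : Finset (Finset (Fin N))),
      IsApex X a k b → IsTri (below X k) A → IsTri (above X k) B →
      P (below X k) A → P (above X k) B → P X (insert {a, k, b} (A ∪ B)))
    {X : Finset (Fin N)} (hX : 2 ≤ X.card) {W : Finset (Finset (Fin N))} (h : IsTri X W) :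
    P X W := by
  induction hn : X.card using Nat.strong_induction_on generalizing X W with
  | _ n ih =>
  rcases hX.lt_or_eq with hX' | hX'
  · obtain ⟨a, y, b, hy⟩ := exists_isApex hX'
    obtain ⟨k, hk, hkW⟩ := h.exists_apex hy
    have h1 := card_below_add_card_above hk.mem
    have h2 := two_le_card_below hk
    have h3 := two_le_card_above hk
    obtain ⟨h4, h5⟩ := h.split hk hkW
    rw [h.eq_join hk hkW]
    exact join X a k b _ _ hk h4 h5 (ih _ (by omega) h2 h4 rfl) (ih _ (by omega) h3 h5 rfl)
  · rw [(isTri_pair_iff hX'.symm).1 h]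
    exact pair X hX'.symm

theorem below_mem {X : Finset (Fin N)} {k : Fin N} {A : Finset (Finset (Fin N))}
    (h : IsTri (below X k) A) : ∀ t ∈ A, ∀ v ∈ t, (v : ℕ) ≤ k :=
  fun _ ht _ hv => (mem_below.1 (h.mem_of_mem ht hv)).2

theorem above_mem {X : Finset (Fin N)} {k : Fin N} {A : Finset (Finset (Fin N))}
    (h : IsTri (above X k) A) : ∀ t ∈ A, ∀ v ∈ t, (k : ℕ) ≤ v :=
  fun _ ht _ hv => (mem_above.1 (h.mem_of_mem ht hv)).2

theorem join_trianglesBelow {X : Finset (Fin N)} {a k b : Fin N} (hk : IsApex X a k b)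
    {A B : Finset (Finset (Fin N))} (hA : IsTri (below X k) A) (hB : IsTri (above X k) B) :
    trianglesBelow (insert {a, k, b} (A ∪ B)) k = A := by
  ext t
  simp only [trianglesBelow, Finset.mem_filter, Finset.mem_insert, Finset.mem_union]
  constructor
  · rintro ⟨rfl | h | h, h'⟩
    · have := h' b (by simp)
      have := hk.lt_right
      omega
    · exact h
    · obtain ⟨x, y, z, h1, h2, rfl⟩ := exists_sorted (hB.card_eq t h)
      have := h' z (by simp)
      have := above_mem hB _ h x (by simp)
      omega
  · exact fun h => ⟨Or.inr (Or.inl h), below_mem hA t h⟩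

theorem join_trianglesAbove {X : Finset (Fin N)} {a k b : Fin N} (hk : IsApex X a k b)
    {A B : Finset (Finset (Fin N))} (hA : IsTri (below X k) A) (hB : IsTri (above X k) B) :
    trianglesAbove (insert {a, k, b} (A ∪ B)) k = B := by
  ext t
  simp only [trianglesAbove, Finset.mem_filter, Finset.mem_insert, Finset.mem_union]
  constructor
  · rintro ⟨rfl | h | h, h'⟩
    · have := h' a (by simp)
      have := hk.left_lt
      omega
    · obtain ⟨x, y, z, h1, h2, rfl⟩ := exists_sorted (hA.card_eq t h)
      have := h' x (by simp)
      have := below_mem hA _ h z (by simp)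
      omega
    · exact h
  · exact fun h => ⟨Or.inr (Or.inr h), above_mem hB t h⟩

/-! ### Counting triangulations of a polygon -/

open scoped Classical in
/-- The set of triangulations of the polygon with vertex set `X`. -/
noncomputable def triSet (X : Finset (Fin N)) : Finset (Finset (Finset (Fin N))) :=
  Finset.univ.filter fun W => IsTri X W

theorem mem_triSet {X : Finset (Fin N)} {W : Finset (Finset (Fin N))} :
    W ∈ triSet X ↔ IsTri X W := by simp [triSet]

theorem isTri_join_of {X : Finset (Fin N)} {a k b : Fin N} (hk : IsApex X a k b)
    {A B : Finset (Finset (Fin N))} (hA : IsTri (below X k) A) (hB : IsTri (above X k) B) :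
    IsTri X (insert {a, k, b} (A ∪ B)) :=
  (isTri_join hk hA.card_eq hB.card_eq (below_mem hA) (above_mem hB)).2 ⟨hA, hB⟩

/-- The number of triangulations of a polygon with `m + 2` vertices is the `m`-th Catalan
number. -/
theorem card_triSet {m : ℕ} {X : Finset (Fin N)} (hX : X.card = m + 2) :
    (triSet X).card = catalan m := by
  induction m using Nat.strong_induction_on generalizing X with
  | _ m ih =>
  rcases m with _ | m
  · have : triSet X = {∅} := by
      ext W
      rw [mem_triSet, isTri_pair_iff hX, Finset.mem_singleton]
    rw [this]; simp
  · obtain ⟨a, y, b, hy⟩ := exists_isApex (by omega : 3 ≤ X.card)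
    have hab := hy.left_lt.trans hy.lt_right
    have hne : a ≠ b := by simp only [ne_eq, Fin.ext_iff]; omega
    set I := (X.erase a).erase b with hI
    have memI : ∀ k, k ∈ I ↔ IsApex X a k b := by
      intro k
      rw [hI, Finset.mem_erase, Finset.mem_erase]
      constructor
      · rintro ⟨h1, h2, h3⟩
        have := hy.bounds k h3
        simp only [ne_eq, Fin.ext_iff] at h1 h2
        exact ⟨hy.left_mem, h3, hy.right_mem, hy.bounds, by omega, by omega⟩
      · intro hk
        have := hk.left_lt
        have := hk.lt_right
        refine ⟨?_, ?_, hk.mem⟩ <;> simp only [ne_eq, Fin.ext_iff] <;> omega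
    have cardI : I.card = m + 1 := by
      rw [hI, Finset.card_erase_of_mem, Finset.card_erase_of_mem hy.left_mem, hX]
      · rfl
      · exact Finset.mem_erase.2 ⟨hne.symm, hy.right_mem⟩
    have h1 : (triSet X).card =
        (I.sigma fun k => triSet (below X k) ×ˢ triSet (above X k)).card := by
      symm
      refine Finset.card_bij (fun p _ => insert {a, p.1, b} (p.2.1 ∪ p.2.2)) ?_ ?_ ?_
      · rintro ⟨k, A, B⟩ hp
        simp only [Finset.mem_sigma, Finset.mem_product, mem_triSet] at hp
        exact mem_triSet.2 (isTri_join_of ((memI k).1 hp.1) hp.2.1 hp.2.2)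
      · rintro ⟨k, A, B⟩ hp ⟨k', A', B'⟩ hp' he
        simp only [Finset.mem_sigma, Finset.mem_product, mem_triSet] at hp hp'
        simp only at he
        have hk := (memI k).1 hp.1
        have hk' := (memI k').1 hp'.1
        have ht := isTri_join_of hk hp.2.1 hp.2.2
        have : k = k' := ht.apex_unique hk hk' (Finset.mem_insert_self _ _)
          (he ▸ Finset.mem_insert_self _ _)
        subst this
        have hA := join_trianglesBelow hk hp.2.1 hp.2.2
        have hB := join_trianglesAbove hk hp.2.1 hp.2.2
        rw [he] at hA hB
        rw [join_trianglesBelow hk hp'.2.1 hp'.2.2] at hA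
        rw [join_trianglesAbove hk hp'.2.1 hp'.2.2] at hB
        rw [hA, hB]
      · intro W hW
        rw [mem_triSet] at hW
        obtain ⟨k, hk, hkW⟩ := hW.exists_apex hy
        refine ⟨⟨k, trianglesBelow W k, trianglesAbove W k⟩, ?_, (hW.eq_join hk hkW).symm⟩
        simp only [Finset.mem_sigma, Finset.mem_product, mem_triSet]
        exact ⟨(memI k).2 hk, hW.split hk hkW⟩
    have h2 : ∀ k ∈ I, (below X k).card - 2 ∈ Finset.range (m + 1) := by
      intro k hk
      have h3 := card_below_add_card_above ((memI k).1 hk).mem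
      have h4 := two_le_card_below ((memI k).1 hk)
      have h5 := two_le_card_above ((memI k).1 hk)
      rw [Finset.mem_range]
      omega
    have hinj : Set.InjOn (fun k => (below X k).card - 2) I := by
      have key : ∀ k ∈ I, ∀ k' ∈ I, (k : ℕ) < k' → (below X k).card < (below X k').card := by
        intro k hk k' hk' hlt
        refine Finset.card_lt_card ⟨fun v hv => ?_, fun h => ?_⟩
        · rw [mem_below] at hv ⊢
          exact ⟨hv.1, hv.2.trans hlt.le⟩
        · have := (mem_below.1 (h (mem_below.2 ⟨((memI k').1 hk').mem, le_rfl⟩))).2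
          omega
      intro k hk k' hk' he
      have h4 := two_le_card_below ((memI k).1 hk)
      have h4' := two_le_card_below ((memI k').1 hk')
      simp only at he
      rcases lt_trichotomy (k : ℕ) k' with h | h | h
      · have := key k hk k' hk' h; omega
      · exact Fin.ext h
      · have := key k' hk' k hk h; omega
    -- Indexing the apex by the number of triangles below it turns the sum over apices into the
    -- Catalan convolution.
    have himg : I.image (fun k => (below X k).card - 2) = Finset.range (m + 1) := by
      refine Finset.eq_of_subset_of_card_le (Finset.image_subset_iff.2 h2) ?_
      rw [Finset.card_image_of_injOn hinj, cardI, Finset.card_range]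
    rw [h1, Finset.card_sigma, catalan_succ,
      Fin.sum_univ_eq_sum_range (fun i => catalan i * catalan (m - i)) (m + 1), ← himg,
      Finset.sum_image hinj]
    refine Finset.sum_congr rfl fun k hk => ?_
    have h3 := card_below_add_card_above ((memI k).1 hk).mem
    have h4 := two_le_card_below ((memI k).1 hk)
    have h5 := two_le_card_above ((memI k).1 hk)
    rw [Finset.card_product, ih ((below X k).card - 2) (by omega) (by omega),
      ih (m - ((below X k).card - 2)) (by omega) (by omega)]

/-! ### Vertex degrees, the dual tree and the degree products -/

/-- The number of triangles of `W` at the vertex `v`. -/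
def triangleDegree (W : Finset (Finset (Fin N))) (v : Fin N) : ℕ := (W.filter fun t => v ∈ t).card

theorem triangleDegree_eq_zero {X : Finset (Fin N)} {W : Finset (Finset (Fin N))} (h : IsTri X W)
    {v : Fin N} (hv : v ∉ X) : triangleDegree W v = 0 := by
  rw [triangleDegree, Finset.card_eq_zero, Finset.filter_eq_empty_iff]
  exact fun t ht hvt => hv (h.mem_of_mem ht hvt)

theorem triangleDegree_join {X : Finset (Fin N)} {a k b : Fin N} (hk : IsApex X a k b)
    {A B : Finset (Finset (Fin N))} (hA : IsTri (below X k) A) (hB : IsTri (above X k) B)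
    (v : Fin N) :
    triangleDegree (insert {a, k, b} (A ∪ B)) v =
      triangleDegree A v + triangleDegree B v + if v = a ∨ v = k ∨ v = b then 1 else 0 := by
  have hdisj : Disjoint A B := by
    rw [Finset.disjoint_left]
    intro t h1 h2
    obtain ⟨x, y, z, h3, h4, rfl⟩ := exists_sorted (hA.card_eq t h1)
    have := below_mem hA _ h1 z (by simp)
    have := above_mem hB _ h2 x (by simp)
    omega
  have hnot : ({a, k, b} : Finset (Fin N)) ∉ A ∪ B := by
    have := hk.left_lt
    have := hk.lt_right
    rw [Finset.mem_union]
    rintro (h | h)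
    · have := below_mem hA _ h b (by simp); omega
    · have := above_mem hB _ h a (by simp); omega
  unfold triangleDegree
  rw [Finset.filter_insert, Finset.filter_union]
  have h1 : ((A.filter fun t => v ∈ t) ∪ B.filter fun t => v ∈ t).card =
      (A.filter fun t => v ∈ t).card + (B.filter fun t => v ∈ t).card :=
    Finset.card_union_of_disjoint (Finset.disjoint_filter_filter hdisj)
  simp only [Finset.mem_insert, Finset.mem_singleton]
  split_ifs with h
  · rw [Finset.card_insert_of_notMem, h1]
    rw [← Finset.filter_union]
    exact fun h => hnot (Finset.mem_filter.1 h).1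
  · rw [h1, add_zero]

/-- The dual tree of a triangulation. -/
theorem IsTri.exists_tree {X : Finset (Fin N)} (hX : 2 ≤ X.card) {W : Finset (Finset (Fin N))}
    (h : IsTri X W) :
    ∀ a b, a ∈ X → b ∈ X → (∀ v ∈ X, (a : ℕ) ≤ v ∧ (v : ℕ) ≤ b) →
      ∃ t : BTree, t.size + 2 = X.card ∧ t.left = triangleDegree W a ∧
        t.right = triangleDegree W b ∧
        ∀ g, t.inner g = ∑ v ∈ (X.erase a).erase b, g (triangleDegree W v) := by
  refine IsTri.induction ?_ ?_ hX h
  · intro X hX a b ha hb hab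
    refine ⟨.leaf, by simp [BTree.size, hX], rfl, rfl, fun g => ?_⟩
    have hne : a ≠ b := by
      rintro rfl
      have : X ⊆ {a} := fun v hv => by
        have := hab v hv
        simp only [Finset.mem_singleton, Fin.ext_iff]; omega
      have := Finset.card_le_card this
      simp [hX] at this
    have : (X.erase a).erase b = ∅ := by
      rw [← Finset.card_eq_zero, Finset.card_erase_of_mem, Finset.card_erase_of_mem ha, hX]
      exact Finset.mem_erase.2 ⟨hne.symm, hb⟩
    simp [this, BTree.inner]
  · intro X a k b A B hk hA hB ihA ihB a' b' ha' hb' hab'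
    have hl := hk.left_lt
    have hr := hk.lt_right
    obtain rfl : a = a' := by
      have := hk.bounds a' ha'
      have := hab' a hk.left_mem
      exact Fin.ext (by omega)
    obtain rfl : b = b' := by
      have := hk.bounds b' hb'
      have := hab' b hk.right_mem
      exact Fin.ext (by omega)
    obtain ⟨s, hs1, hs2, hs3, hs4⟩ := ihA a k (isApex_below hk).1 (isApex_below hk).2.1
      (isApex_below hk).2.2
    obtain ⟨t, ht1, ht2, ht3, ht4⟩ := ihB k b (isApex_above hk).1 (isApex_above hk).2.1
      (isApex_above hk).2.2
    have hcard := card_below_add_card_above hk.mem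
    have zA : ∀ v : Fin N, (k : ℕ) < v → triangleDegree A v = 0 := fun v hv =>
      triangleDegree_eq_zero hA fun h => by have := (mem_below.1 h).2; omega
    have zB : ∀ v : Fin N, (v : ℕ) < k → triangleDegree B v = 0 := fun v hv =>
      triangleDegree_eq_zero hB fun h => by have := (mem_above.1 h).2; omega
    have hD := triangleDegree_join hk hA hB
    refine ⟨.node s t, ?_, ?_, ?_, fun g => ?_⟩
    · simp only [BTree.size]; omega
    · rw [hD, BTree.left, hs2, zB a hl]; simp
    · rw [hD, BTree.right, ht3, zA b hr]; simp
    · have hset : (X.erase a).erase b = insert k ((((below X k).erase a).erase k) ∪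
          (((above X k).erase k).erase b)) := by
        ext v
        simp only [Finset.mem_erase, Finset.mem_insert, Finset.mem_union, mem_below, mem_above,
          ne_eq, Fin.ext_iff]
        constructor
        · rintro ⟨h1, h2, h3⟩
          by_cases hvk : (v : ℕ) = k
          · exact Or.inl hvk
          · rcases Nat.lt_or_gt_of_ne hvk with h | h
            · exact Or.inr (Or.inl ⟨hvk, h2, h3, h.le⟩)
            · exact Or.inr (Or.inr ⟨h1, hvk, h3, h.le⟩)
        · rintro (h | ⟨h1, h2, h3, h4⟩ | ⟨h1, h2, h3, h4⟩)
          · have : v = k := Fin.ext h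
            subst this
            exact ⟨by omega, by omega, hk.mem⟩
          · exact ⟨by omega, h2, h3⟩
          · exact ⟨h1, by omega, h3⟩
      rw [BTree.inner, hs4, ht4, hset, Finset.sum_insert, Finset.sum_union, add_comm]
      · congr 1
        · rw [hD, hs3, ht2]; simp
        · congr 1
          · refine Finset.sum_congr rfl fun v hv => ?_
            simp only [Finset.mem_erase, mem_below, ne_eq] at hv
            have : ¬ (v : ℕ) = k := fun h => hv.1 (Fin.ext h)
            rw [hD, zB v (by omega), if_neg]
            · rfl
            · simp only [Fin.ext_iff] at hv ⊢
              omega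
          · refine Finset.sum_congr rfl fun v hv => ?_
            simp only [Finset.mem_erase, mem_above, ne_eq] at hv
            have : ¬ (v : ℕ) = k := fun h => hv.2.1 (Fin.ext h)
            rw [hD, zA v (by omega), if_neg]
            · simp
            · simp only [Fin.ext_iff] at hv ⊢
              omega
      · rw [Finset.disjoint_left]
        intro v h1 h2
        simp only [Finset.mem_erase, mem_below, mem_above, ne_eq, Fin.ext_iff] at h1 h2
        omega
      · simp

/-- A vertex in `d` triangles is incident to `d - 1` diagonals; hence the argument `d - 1` of the
Catalan numbers and the exponent `d - 2` in the lower bound. -/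
theorem IsTri.catalan_prod_bounds {n : ℕ} (hn : 4 ≤ n) {W : Finset (Finset (Fin (n + 2)))}
    (h : IsTri Finset.univ W) :
    2 ^ (n - 2) ≤ ∏ v, catalan (triangleDegree W v - 1) ∧
      (∏ v, catalan (triangleDegree W v - 1)) ^ 2 ≤ 2 ^ (5 * n - 14) := by
  obtain ⟨t, h1, h2, h3, h4⟩ := h.exists_tree (by simp) 0 (Fin.last (n + 1)) (Finset.mem_univ _)
    (Finset.mem_univ _) (fun v _ => ⟨Nat.zero_le _, Fin.le_last v⟩)
  have hsize : t.size = n := by simpa using h1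
  have hlast : Fin.last (n + 1) ∈ (Finset.univ : Finset (Fin (n + 2))).erase 0 := by
    simp [Fin.ext_iff]
  have hsum : ∀ g : ℕ → ℕ, ∑ v, g (triangleDegree W v) = t.inner g + g t.left + g t.right := by
    intro g
    rw [h4, h2, h3, ← Finset.add_sum_erase _ _ (Finset.mem_univ (0 : Fin (n + 2))),
      ← Finset.add_sum_erase _ _ hlast]
    ring
  constructor
  · have := t.lower
    rw [← hsum, hsize] at this
    calc 2 ^ (n - 2) ≤ 2 ^ ∑ v, (triangleDegree W v - 2) :=
          Nat.pow_le_pow_right (by norm_num) (by omega)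
      _ = ∏ v, 2 ^ (triangleDegree W v - 2) := (Finset.prod_pow_eq_pow_sum _ _ _).symm
      _ ≤ _ := Finset.prod_le_prod' fun v _ => by
        have := two_pow_le_catalan (triangleDegree W v - 1)
        rwa [Nat.sub_sub] at this
  · have := t.upper (by omega)
    rw [← hsum, hsize] at this
    calc (∏ v, catalan (triangleDegree W v - 1)) ^ 2
        = ∏ v, catalan (triangleDegree W v - 1) ^ 2 := (Finset.prod_pow _ _ _).symm
      _ ≤ ∏ v, 2 ^ BTree.logWeight (triangleDegree W v) :=
        Finset.prod_le_prod' fun v _ => catalan_sq_le _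
      _ = 2 ^ ∑ v, BTree.logWeight (triangleDegree W v) := Finset.prod_pow_eq_pow_sum _ _ _
      _ ≤ _ := Nat.pow_le_pow_right (by norm_num) this

/-- The edges of a triangulation do not cross. -/
theorem IsTri.noncrossing {X : Finset (Fin N)} (hX : 2 ≤ X.card) {W : Finset (Finset (Fin N))}
    (h : IsTri X W) : ∀ s ∈ W, ∀ t ∈ W, ∀ i ∈ s, ∀ k ∈ s, ∀ j ∈ t, ∀ l ∈ t,
      ¬ ((i : ℕ) < j ∧ (j : ℕ) < k ∧ (k : ℕ) < l) := by
  refine IsTri.induction ?_ ?_ hX h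
  · simp
  · intro X a k b A B hk hA hB ihA ihB s hs t ht i hi k' hk' j hj l hl
    have h1 := hk.left_lt
    have h2 := hk.lt_right
    have bnd : ∀ t ∈ insert {a, k, b} (A ∪ B), ∀ v ∈ t, (a : ℕ) ≤ v ∧ (v : ℕ) ≤ b := fun t ht v hv =>
      hk.bounds v ((isTri_join_of hk hA hB).mem_of_mem ht hv)
    have b1 := bnd s hs i hi
    have b2 := bnd t ht l hl
    rw [Finset.mem_insert, Finset.mem_union] at hs ht
    have mA := below_mem hA
    have mB := above_mem hB
    rcases hs with rfl | hs | hs <;> rcases ht with rfl | ht | ht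
    · simp only [Finset.mem_insert, Finset.mem_singleton, Fin.ext_iff] at hi hk' hj hl; omega
    · have := mA t ht j hj
      have := mA t ht l hl
      simp only [Finset.mem_insert, Finset.mem_singleton, Fin.ext_iff] at hi hk'; omega
    · have := mB t ht j hj
      have := mB t ht l hl
      simp only [Finset.mem_insert, Finset.mem_singleton, Fin.ext_iff] at hi hk'; omega
    · have := mA s hs i hi
      have := mA s hs k' hk'
      simp only [Finset.mem_insert, Finset.mem_singleton, Fin.ext_iff] at hj hl; omega
    · exact ihA s hs t ht i hi k' hk' j hj l hl
    · have := mA s hs i hi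
      have := mA s hs k' hk'
      have := mB t ht j hj
      have := mB t ht l hl
      omega
    · have := mB s hs i hi
      have := mB s hs k' hk'
      simp only [Finset.mem_insert, Finset.mem_singleton, Fin.ext_iff] at hj hl; omega
    · have := mB s hs i hi
      have := mB s hs k' hk'
      have := mA t ht j hj
      have := mA t ht l hl
      omega
    · exact ihB s hs t ht i hi k' hk' j hj l hl

/-! ### The triangles of a triangulation given by its diagonals -/

/-- `i < j` and `i`, `j` are the ends of a diagonal in `T` or of a side of the polygon. -/
def IsEdge (T : Finset (Fin N × Fin N)) (i j : Fin N) : Prop :=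
  (i : ℕ) < j ∧ ((i, j) ∈ T ∨ (i : ℕ) + 1 = j ∨ ((i : ℕ) = 0 ∧ (j : ℕ) + 1 = N))

theorem IsTriangulation.edge_noncrossing {T : Finset (Fin N × Fin N)} (hT : IsTriangulation T)
    {x y z w : Fin N} (hxz : IsEdge T x z) (hyw : IsEdge T y w) (h1 : (x : ℕ) < y)
    (h2 : (y : ℕ) < z) (h3 : (z : ℕ) < w) : False := by
  have := w.isLt
  rcases hxz.2 with h | h | h
  · rcases hyw.2 with h' | h' | h'
    · exact hT.noncrossing _ h _ h' (Or.inl ⟨h1, h2, h3⟩)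
    · omega
    · omega
  · omega
  · omega

/-- This is maximality, rephrased so that sides and diagonals are treated alike. -/
theorem IsTriangulation.edge_of_noncrossing {T : Finset (Fin N × Fin N)}
    (hT : IsTriangulation T) {i j : Fin N} (hij : (i : ℕ) < j)
    (h : ∀ x y, IsEdge T x y → ¬ ((i : ℕ) < x ∧ (x : ℕ) < j ∧ (j : ℕ) < y) ∧
      ¬ ((x : ℕ) < i ∧ (i : ℕ) < y ∧ (y : ℕ) < j)) : IsEdge T i j := by
  refine ⟨hij, ?_⟩
  by_contra! hc
  refine hc.1 (hT.maximal (i, j) ⟨?_, ?_⟩ ?_)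
  · have := hc.2.1
    simp only
    omega
  · have := hc.2.2
    simp only
    omega
  · rintro ⟨x, y⟩ hxy hcr
    have hd := (hT.isDiagonal _ hxy).1
    simp only at hd
    have := h x y ⟨by omega, Or.inl hxy⟩
    simp only [Crosses, Fin.lt_def] at hcr
    omega

/-- The apex is the last neighbour `k` of `i` before `j`. An edge crossing `k j` would cross `i j`
or `i k`, or it would join `i` to a vertex between `k` and `j`, against the choice of `k`. -/
theorem IsTriangulation.exists_apex {T : Finset (Fin N × Fin N)} (hT : IsTriangulation T)
    {i j : Fin N} (hij : IsEdge T i j) (hlt : (i : ℕ) + 1 < j) :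
    ∃ k, IsEdge T i k ∧ IsEdge T k j := by
  classical
  have hne : (Finset.univ.filter fun k : Fin N => IsEdge T i k ∧ (k : ℕ) < j).Nonempty := by
    refine ⟨⟨i + 1, by omega⟩, ?_⟩
    refine Finset.mem_filter.2 ⟨Finset.mem_univ _, ⟨?_, Or.inr (Or.inl rfl)⟩, ?_⟩ <;> simp only <;> omega
  obtain ⟨k, hk, hmax⟩ := Finset.exists_max_image _ (fun k : Fin N => (k : ℕ)) hne
  obtain ⟨hik, hkj⟩ := (Finset.mem_filter.1 hk).2
  refine ⟨k, hik, hT.edge_of_noncrossing hkj ?_⟩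
  have hik' := hik.1
  intro x y hxy
  have hxy' := hxy.1
  constructor
  · rintro ⟨h1, h2, h3⟩
    exact hT.edge_noncrossing hij hxy (by omega) h2 h3
  · rintro ⟨h1, h2, h3⟩
    rcases lt_trichotomy (x : ℕ) i with h | h | h
    · exact hT.edge_noncrossing hxy hij h (by omega) h3
    · have : x = i := Fin.ext h
      subst this
      have := hmax y (Finset.mem_filter.2 ⟨Finset.mem_univ _, hxy, h3⟩)
      omega
    · exact hT.edge_noncrossing hik hxy h h1 h2

open scoped Classical in
/-- The number of neighbours of `v` between `i` and `j`. -/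
noncomputable def neighborCount (T : Finset (Fin N × Fin N)) (i j v : Fin N) : ℕ :=
  ((Finset.Icc i j).filter fun x => IsEdge T v x ∨ IsEdge T x v).card

/-- An edge that passes over `k` inside the interval must be `i j` itself, since otherwise it
crosses `i k` or `k j`. So neighbours stay on one side of `k`, except that `i` and `j` see each
other, in parallel with `triangleDegree_join`. -/
theorem neighborCount_split {T : Finset (Fin N × Fin N)} (hT : IsTriangulation T)
    {i k j : Fin N} (hij : IsEdge T i j) (hik : IsEdge T i k) (hkj : IsEdge T k j) (v : Fin N)
    (hi : (i : ℕ) ≤ v) (hj : (v : ℕ) ≤ j) :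
    neighborCount T i j v = (if (v : ℕ) ≤ k then neighborCount T i k v else 0) +
      (if (k : ℕ) ≤ v then neighborCount T k j v else 0) +
      if v = i ∨ v = j then 1 else 0 := by
  classical
  have h1 := hik.1
  have h2 := hkj.1
  have cross : ∀ x z, IsEdge T x z → (i : ℕ) ≤ x → (x : ℕ) < k → (k : ℕ) < z → (z : ℕ) ≤ j →
      x = i ∧ z = j := by
    intro x z hxz h3 h4 h5 h6
    rcases h3.lt_or_eq with h3 | h3
    · exact (hT.edge_noncrossing hik hxz h3 h4 h5).elim
    · rcases h6.lt_or_eq with h6 | h6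
      · exact (hT.edge_noncrossing hxz hkj h4 h5 h6).elim
      · exact ⟨Fin.ext h3.symm, Fin.ext h6⟩
  unfold neighborCount
  rcases lt_trichotomy (v : ℕ) k with hv | hv | hv
  · rw [if_pos hv.le, if_neg (by omega), add_zero]
    by_cases hvi : v = i
    · subst hvi
      rw [if_pos (Or.inl rfl), ← Finset.card_insert_of_notMem (a := j)]
      · congr 1
        ext x
        simp only [Finset.mem_filter, Finset.mem_Icc, Finset.mem_insert, Fin.le_def]
        constructor
        · rintro ⟨h3, h4⟩
          by_cases hxk : (x : ℕ) ≤ k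
          · exact Or.inr ⟨⟨h3.1, hxk⟩, h4⟩
          · left
            rcases h4 with h4 | h4
            · exact (cross v x h4 le_rfl h1 (by omega) h3.2).2
            · have := h4.1; omega
        · rintro (rfl | ⟨h3, h4⟩)
          · exact ⟨⟨hij.1.le, le_rfl⟩, Or.inl hij⟩
          · exact ⟨⟨h3.1, by omega⟩, h4⟩
      · simp only [Finset.mem_filter, Finset.mem_Icc, Fin.le_def]
        omega
    · rw [if_neg, add_zero]
      · congr 1
        ext x
        simp only [Finset.mem_filter, Finset.mem_Icc, Fin.le_def]
        constructor
        · rintro ⟨h3, h4⟩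
          refine ⟨⟨h3.1, ?_⟩, h4⟩
          by_contra hxk
          rcases h4 with h4 | h4
          · exact hvi (cross v x h4 hi hv (by omega) h3.2).1
          · have := h4.1; omega
        · rintro ⟨h3, h4⟩
          exact ⟨⟨h3.1, by omega⟩, h4⟩
      · rintro (h | rfl)
        · exact hvi h
        · omega
  · have : v = k := Fin.ext hv
    subst this
    rw [if_pos le_rfl, if_pos le_rfl, if_neg, add_zero, ← Finset.card_union_of_disjoint]
    · congr 1
      ext x
      simp only [Finset.mem_filter, Finset.mem_Icc, Finset.mem_union, Fin.le_def]
      constructor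
      · rintro ⟨h3, h4⟩
        rcases le_total (x : ℕ) v with h | h
        · exact Or.inl ⟨⟨h3.1, h⟩, h4⟩
        · exact Or.inr ⟨⟨h, h3.2⟩, h4⟩
      · rintro (⟨h3, h4⟩ | ⟨h3, h4⟩)
        · exact ⟨⟨h3.1, by omega⟩, h4⟩
        · exact ⟨⟨by omega, h3.2⟩, h4⟩
    · rw [Finset.disjoint_left]
      intro x h3 h4
      simp only [Finset.mem_filter, Finset.mem_Icc, Fin.le_def] at h3 h4
      rcases h3.2 with h | h
      · have := h.1; omega
      · have := h.1; omega
    · simp only [Fin.ext_iff]; omega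
  · rw [if_neg (by omega), if_pos hv.le, zero_add]
    by_cases hvj : v = j
    · subst hvj
      rw [if_pos (Or.inr rfl), ← Finset.card_insert_of_notMem (a := i)]
      · congr 1
        ext x
        simp only [Finset.mem_filter, Finset.mem_Icc, Finset.mem_insert, Fin.le_def]
        constructor
        · rintro ⟨h3, h4⟩
          by_cases hxk : (k : ℕ) ≤ x
          · exact Or.inr ⟨⟨hxk, h3.2⟩, h4⟩
          · left
            rcases h4 with h4 | h4
            · have := h4.1; omega
            · exact (cross x v h4 h3.1 (by omega) hv le_rfl).1
        · rintro (rfl | ⟨h3, h4⟩)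
          · exact ⟨⟨le_rfl, hij.1.le⟩, Or.inr hij⟩
          · exact ⟨⟨by omega, h3.2⟩, h4⟩
      · simp only [Finset.mem_filter, Finset.mem_Icc, Fin.le_def]
        omega
    · rw [if_neg, add_zero]
      · congr 1
        ext x
        simp only [Finset.mem_filter, Finset.mem_Icc, Fin.le_def]
        constructor
        · rintro ⟨h3, h4⟩
          refine ⟨⟨?_, h3.2⟩, h4⟩
          by_contra hxk
          rcases h4 with h4 | h4
          · have := h4.1; omega
          · exact hvj (cross x v h4 h3.1 (by omega) hv hj).2
        · rintro ⟨h3, h4⟩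
          exact ⟨⟨by omega, h3.2⟩, h4⟩
      · rintro (rfl | h)
        · omega
        · exact hvj h

/-- The chain is assembled recursively from apex triangles. The `+ 1` is carried along because a fan
of `d` triangles at a vertex has `d + 1` spokes. -/
theorem IsTriangulation.exists_isTri_Icc {T : Finset (Fin N × Fin N)} (hT : IsTriangulation T)
    {i j : Fin N} (hij : IsEdge T i j) :
    ∃ W, IsTri (Finset.Icc i j) W ∧
      ∀ v : Fin N, (i : ℕ) ≤ v → (v : ℕ) ≤ j → neighborCount T i j v = triangleDegree W v + 1 := by
  classical
  induction hn : (j : ℕ) - i using Nat.strong_induction_on generalizing i j with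
  | _ n ih =>
  have hlt := hij.1
  by_cases hside : (i : ℕ) + 1 = j
  · refine ⟨∅, (isTri_pair_iff ?_).2 rfl, fun v h1 h2 => ?_⟩
    · rw [Fin.card_Icc]; omega
    · simp only [triangleDegree, Finset.filter_empty, Finset.card_empty, neighborCount]
      rw [Finset.card_eq_one]
      have hv : v = i ∨ v = j := by simp only [Fin.ext_iff]; omega
      rcases hv with rfl | rfl
      · refine ⟨j, ?_⟩
        ext x
        simp only [Finset.mem_filter, Finset.mem_Icc, Finset.mem_singleton, Fin.le_def]
        constructor
        · rintro ⟨h3, h4 | h4⟩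
          · have := h4.1; exact Fin.ext (by omega)
          · have := h4.1; omega
        · rintro rfl
          exact ⟨⟨by omega, le_rfl⟩, Or.inl hij⟩
      · refine ⟨i, ?_⟩
        ext x
        simp only [Finset.mem_filter, Finset.mem_Icc, Finset.mem_singleton, Fin.le_def]
        constructor
        · rintro ⟨h3, h4 | h4⟩
          · have := h4.1; omega
          · have := h4.1; exact Fin.ext (by omega)
        · rintro rfl
          exact ⟨⟨le_rfl, by omega⟩, Or.inr hij⟩
  · obtain ⟨k, hik, hkj⟩ := hT.exists_apex hij (by omega)
    have h1 := hik.1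
    have h2 := hkj.1
    obtain ⟨A, hA, dA⟩ := ih (k - i) (by omega) hik rfl
    obtain ⟨B, hB, dB⟩ := ih (j - k) (by omega) hkj rfl
    have hk : IsApex (Finset.Icc i j) i k j :=
      ⟨Finset.mem_Icc.2 ⟨le_rfl, hlt.le⟩, Finset.mem_Icc.2 ⟨h1.le, h2.le⟩,
        Finset.mem_Icc.2 ⟨hlt.le, le_rfl⟩, fun v hv => ⟨(Finset.mem_Icc.1 hv).1, (Finset.mem_Icc.1 hv).2⟩, h1, h2⟩
    have eA : below (Finset.Icc i j) k = Finset.Icc i k := by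
      ext v; simp only [mem_below, Finset.mem_Icc, Fin.le_def]; omega
    have eB : above (Finset.Icc i j) k = Finset.Icc k j := by
      ext v; simp only [mem_above, Finset.mem_Icc, Fin.le_def]; omega
    rw [← eA] at hA
    rw [← eB] at hB
    refine ⟨_, isTri_join_of hk hA hB, fun v h3 h4 => ?_⟩
    rw [neighborCount_split hT hij hik hkj v h3 h4, triangleDegree_join hk hA hB]
    have zA : (k : ℕ) < v → triangleDegree A v = 0 := fun hv =>
      triangleDegree_eq_zero hA fun h => by have := (mem_below.1 h).2; omega
    have zB : (v : ℕ) < k → triangleDegree B v = 0 := fun hv =>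
      triangleDegree_eq_zero hB fun h => by have := (mem_above.1 h).2; omega
    have dA' := dA v h3
    have dB' := fun h => dB v h h4
    simp only [Fin.ext_iff]
    rcases lt_trichotomy (v : ℕ) k with hv | hv | hv
    · rw [if_pos hv.le, if_neg (by omega), dA' hv.le, zB hv]
      split_ifs <;> omega
    · rw [if_pos hv.le, if_pos hv.ge, dA' hv.le, dB' hv.ge]
      split_ifs <;> omega
    · rw [if_neg (by omega), if_pos hv.le, dB' hv.le, zA hv]
      split_ifs <;> omega

/-- The number of vertices joined to `v` by a side or a diagonal. -/
theorem IsTriangulation.neighborCount_eq {n : ℕ} {T : Finset (Fin (n + 3) × Fin (n + 3))}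
    (hT : IsTriangulation T) (v : Fin (n + 3)) :
    neighborCount T 0 (Fin.last (n + 2)) v = degree T v + 2 := by
  classical
  set D : Finset (Fin (n + 3)) := Finset.univ.filter fun x => (v, x) ∈ T ∨ (x, v) ∈ T with hD
  have hcard : degree T v = D.card := by
    rw [degree]
    refine Finset.card_bij' (fun d _ => if d.1 = v then d.2 else d.1)
      (fun x _ => if (v, x) ∈ T then (v, x) else (x, v)) ?_ ?_ ?_ ?_
    · rintro ⟨x, y⟩ h
      simp only [Finset.mem_filter] at h
      simp only [hD, Finset.mem_filter, Finset.mem_univ, true_and]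
      split_ifs with h1
      · subst h1; exact Or.inl h.1
      · right
        rcases h.2 with h2 | h2
        · exact absurd h2 h1
        · subst h2; exact h.1
    · intro x h
      simp only [hD, Finset.mem_filter, Finset.mem_univ, true_and] at h
      simp only [Finset.mem_filter]
      split_ifs with h1
      · exact ⟨h1, Or.inl rfl⟩
      · exact ⟨h.resolve_left h1, Or.inr rfl⟩
    · rintro ⟨x, y⟩ h
      simp only [Finset.mem_filter] at h
      have hd := (hT.isDiagonal _ h.1).1
      simp only at hd ⊢
      by_cases h1 : x = v
      · subst h1; simp [h.1]
      · have h2 : y = v := h.2.resolve_left h1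
        subst h2
        rw [if_neg h1, if_neg]
        intro h3
        have := (hT.isDiagonal _ h3).1
        simp only at this
        omega
    · intro x h
      simp only [hD, Finset.mem_filter, Finset.mem_univ, true_and] at h
      by_cases h1 : (v, x) ∈ T
      · simp [h1]
      · have h2 := h.resolve_left h1
        have h3 := (hT.isDiagonal _ h2).1
        simp only at h3
        rw [if_neg h1, if_neg]
        intro (h4 : x = v)
        rw [h4] at h3
        omega
  have hv := v.isLt
  -- `p` and `s` are the cyclic predecessor and successor of `v`; the two sides ending there account
  -- for the summand 2.
  obtain ⟨p, hp⟩ : ∃ p : Fin (n + 3), (p : ℕ) = if (v : ℕ) = 0 then n + 2 else (v : ℕ) - 1 :=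
    ⟨⟨if (v : ℕ) = 0 then n + 2 else v - 1, by split_ifs <;> omega⟩, rfl⟩
  have hp' : ((v : ℕ) = 0 ∧ (p : ℕ) = n + 2) ∨ (0 < (v : ℕ) ∧ (p : ℕ) + 1 = v) := by
    split_ifs at hp <;> omega
  obtain ⟨s, hs⟩ : ∃ s : Fin (n + 3), (s : ℕ) = if (v : ℕ) = n + 2 then 0 else (v : ℕ) + 1 :=
    ⟨⟨if (v : ℕ) = n + 2 then 0 else v + 1, by split_ifs <;> omega⟩, rfl⟩
  have hs' : ((v : ℕ) = n + 2 ∧ (s : ℕ) = 0) ∨ ((v : ℕ) < n + 2 ∧ (s : ℕ) = v + 1) := by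
    split_ifs at hs <;> omega
  clear hp hs
  have hset : ((Finset.Icc 0 (Fin.last (n + 2))).filter fun x => IsEdge T v x ∨ IsEdge T x v) =
      insert p (insert s D) := by
    ext x
    have hx := x.isLt
    have hvx : (v, x) ∈ T → (v : ℕ) < x := fun h => by
      have := (hT.isDiagonal _ h).1; simp only at this; omega
    have hxv : (x, v) ∈ T → (x : ℕ) < v := fun h => by
      have := (hT.isDiagonal _ h).1; simp only at this; omega
    have hmem : x ∈ Finset.Icc 0 (Fin.last (n + 2)) :=
      Finset.mem_Icc.2 ⟨Fin.zero_le _, Fin.le_last _⟩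
    rw [Finset.mem_filter, Finset.mem_insert, Finset.mem_insert, hD, Finset.mem_filter]
    simp only [hmem, Finset.mem_univ, true_and, IsEdge]
    rw [Fin.ext_iff, Fin.ext_iff]
    by_cases c1 : (v, x) ∈ T
    · simp only [c1, hvx c1, true_or, or_true, and_self]
    · by_cases c2 : (x, v) ∈ T
      · simp only [c2, hxv c2, true_or, or_true, and_self]
      · simp only [c1, c2, false_or, or_false]
        omega
  have nD : ∀ x : Fin (n + 3), x = p ∨ x = s → x ∉ D := by
    intro x hx h
    simp only [hD, Finset.mem_filter, Finset.mem_univ, true_and] at h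
    simp only [Fin.ext_iff] at hx
    rcases h with h | h
    · have := hT.isDiagonal _ h
      simp only [IsDiagonal] at this
      omega
    · have := hT.isDiagonal _ h
      simp only [IsDiagonal] at this
      omega
  have hps : p ≠ s := by
    simp only [ne_eq, Fin.ext_iff]
    omega
  unfold neighborCount
  rw [hset, Finset.card_insert_of_notMem, Finset.card_insert_of_notMem (nD s (Or.inr rfl)), hcard]
  rw [Finset.mem_insert, not_or]
  exact ⟨hps, nD p (Or.inl rfl)⟩

/-- The triangles of a triangulation given by its diagonals. -/
theorem IsTriangulation.exists_isTri {n : ℕ} {T : Finset (Fin (n + 3) × Fin (n + 3))}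
    (hT : IsTriangulation T) :
    ∃ W, IsTri Finset.univ W ∧ ∀ v, degree T v = triangleDegree W v - 1 := by
  obtain ⟨W, hW, h⟩ := hT.exists_isTri_Icc (i := 0) (j := Fin.last (n + 2))
    ⟨by simp, Or.inr (Or.inr ⟨by simp, by simp⟩)⟩
  refine ⟨W, ?_, fun v => ?_⟩
  · convert hW
    ext v
    simp [Fin.le_last]
  · have := h v (Nat.zero_le _) (Fin.le_last v)
    rw [hT.neighborCount_eq] at this
    omega

theorem IsTriangulation.catalan_prod_bounds {n : ℕ} (hn : 4 ≤ n)
    {T : Finset (Fin (n + 2) × Fin (n + 2))} (hT : IsTriangulation T) :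
    2 ^ (n - 2) ≤ ∏ v, catalan (degree T v) ∧
      (∏ v, catalan (degree T v)) ^ 2 ≤ 2 ^ (5 * n - 14) := by
  obtain ⟨m, rfl⟩ := Nat.exists_eq_add_of_le' (by omega : 1 ≤ n)
  obtain ⟨W, hW, h⟩ := hT.exists_isTri
  simp only [h]
  exact hW.catalan_prod_bounds hn

end Chains

section Stars

variable {N : ℕ}

/-! ### Star systems -/

/-- `x` and `y` are the predecessor and the successor of `a` in the cyclic order. -/
def Flank (a x y : Fin N) : Prop :=
  ccw x a y ∧ ∀ b, b ≠ a → b ≠ x → b ≠ y → ccw x y b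

instance (a x y : Fin N) : Decidable (Flank a x y) := by unfold Flank; infer_instance

/-- The triangle `a x y` of `B`, seen from `a`. -/
def link (B : Finset (Finset (Fin N))) (a x y : Fin N) : ℤ :=
  if ccw a x y ∧ ({a, x, y} : Finset (Fin N)) ∈ B then 1 else 0

/-- The indicator function of `Flank`. -/
def flank (a x y : Fin N) : ℤ := if Flank a x y then 1 else 0

/-- A set `B` of triangles and for each vertex `a` a set of triangles `V a` filling the cycle formed
by the edges opposite to `a` in the triangles of `B` and the edge that cuts off `a`. -/
structure IsStarSystem (B : Finset (Finset (Fin N))) (V : Fin N → Finset (Finset (Fin N))) :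
    Prop where
  card_eq : ∀ t ∈ B, t.card = 3
  star_card_eq : ∀ a, ∀ t ∈ V a, t.card = 3
  notMem : ∀ a, ∀ t ∈ V a, a ∉ t
  boundary : ∀ a x y, a ≠ x → a ≠ y → x ≠ y →
    leftCount (V a) x y + link B a y x - (leftCount (V a) y x + link B a x y) =
      flank a x y - flank a y x

theorem adj_univ_iff {i j : Fin N} (hN : 2 ≤ N) :
    Adj Finset.univ i j ↔ (i : ℕ) + 1 = j ∨ ((i : ℕ) + 1 = N ∧ (j : ℕ) = 0) := by
  have hi := i.isLt
  have hj := j.isLt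
  constructor
  · rintro ⟨-, -, h1, h2⟩
    by_contra hc
    simp only [ne_eq, Fin.ext_iff] at h1
    by_cases h3 : (i : ℕ) + 1 = N
    · have := h2 ⟨0, by omega⟩ (Finset.mem_univ _)
      simp only [ccw] at this
      omega
    · have := h2 ⟨i + 1, by omega⟩ (Finset.mem_univ _)
      simp only [ccw] at this
      omega
  · intro h
    refine ⟨Finset.mem_univ _, Finset.mem_univ _, ?_, fun z _ => ?_⟩
    · simp only [ne_eq, Fin.ext_iff]; omega
    · have := z.isLt
      simp only [ccw]; omega

theorem exists_next (hN : 2 ≤ N) (i : Fin N) : ∃ j, Adj Finset.univ i j := by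
  by_cases h : (i : ℕ) + 1 = N
  · exact ⟨⟨0, by omega⟩, (adj_univ_iff hN).2 (Or.inr ⟨h, rfl⟩)⟩
  · exact ⟨⟨i + 1, by omega⟩, (adj_univ_iff hN).2 (Or.inl rfl)⟩

theorem exists_prev (hN : 2 ≤ N) (j : Fin N) : ∃ i, Adj Finset.univ i j := by
  by_cases h : (j : ℕ) = 0
  · exact ⟨⟨N - 1, by omega⟩, (adj_univ_iff hN).2 (Or.inr ⟨by simp only; omega, h⟩)⟩
  · exact ⟨⟨j - 1, by omega⟩, (adj_univ_iff hN).2 (Or.inl (by simp only; omega))⟩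

theorem Adj.right_unique {X : Finset (Fin N)} {i j k : Fin N} (hj : Adj X i j) (hk : Adj X i k) :
    j = k := by
  by_contra h
  rcases ccw_or hj.2.2.1 h hk.2.2.1 with h1 | h1
  · exact hk.2.2.2 j hj.2.1 h1
  · exact hj.2.2.2 k hk.2.1 h1

theorem Adj.left_unique {X : Finset (Fin N)} {i j k : Fin N} (hi : Adj X i k) (hj : Adj X j k) :
    i = j := by
  by_contra h
  rcases ccw_or h hj.2.2.1 hi.2.2.1 with h1 | h1
  · exact hi.2.2.2 j hj.1 h1
  · exact hj.2.2.2 i hi.1 h1.rotate.rotate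

theorem flank_iff (hN : 3 ≤ N) {a x y : Fin N} :
    Flank a x y ↔ Adj Finset.univ x a ∧ Adj Finset.univ a y := by
  rw [adj_univ_iff (by omega), adj_univ_iff (by omega)]
  have ha := a.isLt
  have hx := x.isLt
  have hy := y.isLt
  constructor
  · rintro ⟨h1, h2⟩
    rw [← adj_univ_iff (by omega), ← adj_univ_iff (by omega)]
    refine ⟨⟨Finset.mem_univ _, Finset.mem_univ _, h1.ne.1, fun z _ hz => ?_⟩,
      ⟨Finset.mem_univ _, Finset.mem_univ _, h1.ne.2.1, fun z _ hz => ?_⟩⟩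
    · have hzy : z ≠ y := by rintro rfl; exact h1.not_swap hz
      have := h2 z hz.ne.2.1 hz.ne.1.symm hzy
      simp only [ccw] at *
      omega
    · have hzx : z ≠ x := by rintro rfl; exact h1.rotate.not_swap hz
      have := h2 z hz.ne.1.symm hzx hz.ne.2.1
      simp only [ccw] at *
      omega
  · intro h
    refine ⟨by simp only [ccw]; omega, fun b h1 h2 h3 => ?_⟩
    have hb := b.isLt
    simp only [ne_eq, Fin.ext_iff] at h1 h2 h3
    simp only [ccw]; omega

theorem sum_flank_right (hN : 3 ≤ N) (a x : Fin N) :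
    ∑ y, flank a x y = if Adj Finset.univ x a then 1 else 0 := by
  obtain ⟨s, hs⟩ := exists_next (by omega) a
  rw [Finset.sum_eq_single s]
  · exact if_congr ((flank_iff hN).trans ⟨fun h => h.1, fun h => ⟨h, hs⟩⟩) rfl rfl
  · intro y _ hy
    exact if_neg fun h => hy (((flank_iff hN).1 h).2.right_unique hs)
  · simp

theorem sum_flank_left (hN : 3 ≤ N) (a x : Fin N) :
    ∑ y, flank a y x = if Adj Finset.univ a x then 1 else 0 := by
  obtain ⟨p, hp⟩ := exists_prev (by omega) a
  rw [Finset.sum_eq_single p]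
  · exact if_congr ((flank_iff hN).trans ⟨fun h => h.2, fun h => ⟨hp, h⟩⟩) rfl rfl
  · intro y _ hy
    exact if_neg fun h => hy (((flank_iff hN).1 h).1.left_unique hp)
  · simp

theorem ccw_rotate_iff (i j k : Fin N) : ccw i j k ↔ ccw j k i :=
  ⟨ccw.rotate, fun h => h.rotate.rotate⟩

theorem sum_link_right (B : Finset (Finset (Fin N))) (a x : Fin N) :
    ∑ y, link B a x y = leftCount B a x := rfl

theorem sum_link_left (B : Finset (Finset (Fin N))) (a x : Fin N) :
    ∑ y, link B a y x = leftCount B x a := by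
  refine Finset.sum_congr rfl fun y _ => ?_
  exact if_congr (by rw [ccw_rotate_iff x a y, triple_rotate x a y]) rfl rfl

/-- Each triangle at `x` has one edge leaving `x` and one entering it. -/
theorem sum_leftCount (W : Finset (Finset (Fin N))) (x : Fin N) :
    ∑ y, leftCount W x y = ∑ y, leftCount W y x := by
  unfold leftCount
  rw [Finset.sum_comm]
  refine Finset.sum_congr rfl fun k _ => Finset.sum_congr rfl fun y _ => ?_
  exact if_congr (by rw [← ccw_rotate_iff k x y, ← triple_rotate k x y]) rfl rfl

theorem not_ccw_of_eq {i j k : Fin N} (h : i = j ∨ j = k ∨ i = k) : ¬ ccw i j k := by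
  intro hc
  have := hc.ne
  tauto

/-- The degenerate values of `y` are admitted, every term being zero there, so that the equation can
be summed over all `y`. -/
theorem IsStarSystem.boundary' {B : Finset (Finset (Fin N))} {V : Fin N → Finset (Finset (Fin N))}
    (h : IsStarSystem B V) (a x y : Fin N) (hx : a ≠ x) :
    leftCount (V a) x y + link B a y x - (leftCount (V a) y x + link B a x y) =
      flank a x y - flank a y x := by
  by_cases hy : a = y ∨ x = y
  · have h1 : leftCount (V a) x y = 0 := leftCount_eq_zero fun k hk hW => by
      rcases hy with rfl | rfl
      · exact h.notMem a _ hW (by simp)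
      · exact not_ccw_of_eq (by simp) hk
    have h2 : leftCount (V a) y x = 0 := leftCount_eq_zero fun k hk hW => by
      rcases hy with rfl | rfl
      · exact h.notMem a _ hW (by simp)
      · exact not_ccw_of_eq (by simp) hk
    have h3 : link B a x y = 0 := if_neg fun h => not_ccw_of_eq (by tauto) h.1
    have h4 : link B a y x = 0 :=
      if_neg fun h => not_ccw_of_eq (by rcases hy with rfl | rfl <;> simp) h.1
    have h5 : flank a x y = 0 :=
      if_neg fun h => not_ccw_of_eq (by rcases hy with rfl | rfl <;> simp) h.1
    have h6 : flank a y x = 0 :=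
      if_neg fun h => not_ccw_of_eq (by rcases hy with rfl | rfl <;> simp) h.1
    rw [h1, h2, h3, h4, h5, h6]; rfl
  · rw [not_or] at hy
    exact h.boundary a x y hx hy.1 hy.2

/-- Summing the star equation at `a` over `y` kills the contribution of `V a`, a boundary having
zero divergence at `x`. The links sum to the coefficients of `B` at the edge between `a` and `x`,
and the flanks to the boundary of the polygon. -/
theorem IsStarSystem.isTri {B : Finset (Finset (Fin N))} {V : Fin N → Finset (Finset (Fin N))}
    (hN : 3 ≤ N) (h : IsStarSystem B V) : IsTri Finset.univ B := by
  refine ⟨h.card_eq, fun x a hxa => ?_⟩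
  have h1 := Finset.sum_congr (rfl : (Finset.univ : Finset (Fin N)) = Finset.univ)
    fun y _ => h.boundary' a x y hxa.symm
  simp only [Finset.sum_sub_distrib, Finset.sum_add_distrib] at h1
  rw [sum_flank_right hN, sum_flank_left hN, sum_link_left, sum_link_right, sum_leftCount] at h1
  unfold polygonBoundary
  linarith

/-! ### Neighbour polygons and the count of star systems -/

/-- The vertices joined to `a` by an edge of a triangle in `B`. -/
def starSet (B : Finset (Finset (Fin N))) (a : Fin N) : Finset (Fin N) :=
  Finset.univ.filter fun x => x ≠ a ∧ ∃ t ∈ B, a ∈ t ∧ x ∈ t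

theorem mem_starSet {B : Finset (Finset (Fin N))} {a x : Fin N} :
    x ∈ starSet B a ↔ x ≠ a ∧ ∃ t ∈ B, a ∈ t ∧ x ∈ t := by simp [starSet]

theorem mem_starSet_of_triple {B : Finset (Finset (Fin N))} {a x y : Fin N} (h : ccw a x y)
    (hB : ({a, x, y} : Finset (Fin N)) ∈ B) : x ∈ starSet B a ∧ y ∈ starSet B a :=
  ⟨mem_starSet.2 ⟨h.ne.1.symm, _, hB, by simp, by simp⟩,
    mem_starSet.2 ⟨h.ne.2.2.symm, _, hB, by simp, by simp⟩⟩

theorem IsTri.noncrossing_ccw {X : Finset (Fin N)} (hX : 2 ≤ X.card)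
    {W : Finset (Finset (Fin N))} (h : IsTri X W) {s t : Finset (Fin N)} (hs : s ∈ W) (ht : t ∈ W)
    {x y a z : Fin N} (hx : x ∈ s) (hy : y ∈ s) (ha : a ∈ t) (hz : z ∈ t) (h1 : ccw a x y)
    (h2 : ccw x z y) : False := by
  have n1 := h.noncrossing hX s hs t ht x hx y hy z hz a ha
  have n2 := h.noncrossing hX s hs t ht y hy x hx a ha z hz
  have n3 := h.noncrossing hX t ht s hs a ha z hz x hx y hy
  have n4 := h.noncrossing hX t ht s hs z hz a ha y hy x hx
  unfold ccw at h1 h2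
  omega

theorem IsTri.next_mem_starSet {B : Finset (Finset (Fin N))} (hN : 3 ≤ N)
    (h : IsTri Finset.univ B) {a s : Fin N} (hs : Adj Finset.univ a s) : s ∈ starSet B a := by
  have h1 := h.boundary a s hs.2.2.1
  have h2 : ¬ Adj Finset.univ s a := by
    have := hs
    rw [adj_univ_iff (by omega)] at this ⊢
    omega
  rw [polygonBoundary, if_pos hs, if_neg h2] at h1
  have := leftCount_nonneg B s a
  obtain ⟨k, hk, hkB⟩ := leftCount_pos.1 (by omega : 0 < leftCount B a s)
  exact (mem_starSet_of_triple hk hkB).1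

theorem IsTri.prev_mem_starSet {B : Finset (Finset (Fin N))} (hN : 3 ≤ N)
    (h : IsTri Finset.univ B) {a p : Fin N} (hp : Adj Finset.univ p a) : p ∈ starSet B a := by
  have h1 := h.boundary p a hp.2.2.1
  have h2 : ¬ Adj Finset.univ a p := by
    have := hp
    rw [adj_univ_iff (by omega)] at this ⊢
    omega
  rw [polygonBoundary, if_pos hp, if_neg h2] at h1
  have := leftCount_nonneg B a p
  obtain ⟨k, hk, hkB⟩ := leftCount_pos.1 (by omega : 0 < leftCount B p a)
  exact mem_starSet.2 ⟨hp.2.2.1, _, hkB, by simp, by simp⟩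

theorem IsTri.adj_of_triple {B : Finset (Finset (Fin N))} (hN : 3 ≤ N)
    (h : IsTri Finset.univ B) {a x y : Fin N} (hc : ccw a x y)
    (hB : ({a, x, y} : Finset (Fin N)) ∈ B) : Adj (starSet B a) x y := by
  refine ⟨(mem_starSet_of_triple hc hB).1, (mem_starSet_of_triple hc hB).2, hc.ne.2.1,
    fun z hz hzc => ?_⟩
  obtain ⟨-, t, ht, hat, hzt⟩ := mem_starSet.1 hz
  exact h.noncrossing_ccw (by simp; omega) hB ht (by simp) (by simp) hat hzt hc hzc

/-- Unless `x` precedes `a`, the boundary coefficient of the edge from `a` to `x` is nonnegative, so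
a triangle on the right forces one on the left. -/
theorem IsTri.exists_triple {B : Finset (Finset (Fin N))}
    (h : IsTri Finset.univ B) {a x : Fin N} (hx : x ∈ starSet B a)
    (hxa : ¬ Adj Finset.univ x a) : ∃ y, ccw a x y ∧ ({a, x, y} : Finset (Fin N)) ∈ B := by
  obtain ⟨hne, t, ht, hat, hxt⟩ := mem_starSet.1 hx
  rw [← leftCount_pos]
  have h1 := h.boundary a x hne.symm
  have h2 : 0 ≤ polygonBoundary Finset.univ a x := by
    rw [polygonBoundary, if_neg hxa]
    split_ifs <;> simp
  have h3 := leftCount_nonneg B x a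
  obtain ⟨k, hk | hk, rfl⟩ := exists_ccw_edge (h.card_eq t ht) hat hxt hne.symm
  · exact leftCount_pos.2 ⟨k, hk, ht⟩
  · have : 0 < leftCount B x a := leftCount_pos.2 ⟨k, hk, by rwa [Finset.insert_comm]⟩
    omega

/-- The triangles at `a` form a fan from its successor to its predecessor. Consecutive neighbours
span a triangle of the fan; the one remaining pair, predecessor to successor, closes the cycle by
cutting off `a`. -/
theorem IsTri.adj_starSet_iff {B : Finset (Finset (Fin N))} (hN : 3 ≤ N)
    (h : IsTri Finset.univ B) {a x y : Fin N} :
    Adj (starSet B a) x y ↔ Flank a x y ∨ (ccw a x y ∧ ({a, x, y} : Finset (Fin N)) ∈ B) := by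
  have hflank : Flank a x y → Adj (starSet B a) x y := by
    intro hf
    have h1 := (flank_iff hN).1 hf
    refine ⟨h.prev_mem_starSet hN h1.1, h.next_mem_starSet hN h1.2, hf.1.ne.2.2,
      fun z hz hzc => ?_⟩
    have := hf.2 z (mem_starSet.1 hz).1 hzc.ne.1.symm hzc.ne.2.1
    exact this.not_swap hzc
  constructor
  · intro hxy
    by_cases hxa : Adj Finset.univ x a
    · left
      obtain ⟨s, hs⟩ := exists_next (by omega) a
      have hsy : s = y := by
        by_contra hne
        have hf : Flank a x s := (flank_iff hN).2 ⟨hxa, hs⟩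
        have hya := (mem_starSet.1 hxy.2.1).1
        exact hxy.2.2.2 s (h.next_mem_starSet hN hs) (hf.2 y hya hxy.2.2.1.symm (Ne.symm hne))
      exact (flank_iff hN).2 ⟨hxa, hsy ▸ hs⟩
    · right
      obtain ⟨k, hk, hkB⟩ := h.exists_triple hxy.1 hxa
      rw [hxy.right_unique (h.adj_of_triple hN hk hkB)]
      exact ⟨hk, hkB⟩
  · rintro (hf | ⟨hc, hB⟩)
    · exact hflank hf
    · exact h.adj_of_triple hN hc hB

theorem IsTri.polygonBoundary_starSet {B : Finset (Finset (Fin N))} (hN : 3 ≤ N)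
    (h : IsTri Finset.univ B) (a x y : Fin N) :
    polygonBoundary (starSet B a) x y =
      (flank a x y + link B a x y) - (flank a y x + link B a y x) := by
  have key : ∀ x y, (if Adj (starSet B a) x y then (1 : ℤ) else 0) =
      flank a x y + link B a x y := by
    intro x y
    have hex : ¬ (Flank a x y ∧ ccw a x y) := fun hh => hh.1.1.rotate.not_swap hh.2
    rw [if_congr (h.adj_starSet_iff hN) rfl rfl, flank, link]
    by_cases h1 : Flank a x y
    · have h2 : ¬ ccw a x y := fun h2 => hex ⟨h1, h2⟩
      simp [h1, h2]
    · simp [h1]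
  rw [polygonBoundary, key, key]

/-- Once `B` is known to be a triangulation, the flank and link terms are exactly the boundary of
the neighbour polygon of `a`, so each star equation becomes the defining equation of `IsTri`. -/
theorem isStarSystem_iff (hN : 3 ≤ N) {B : Finset (Finset (Fin N))}
    {V : Fin N → Finset (Finset (Fin N))} :
    IsStarSystem B V ↔ IsTri Finset.univ B ∧ ∀ a, IsTri (starSet B a) (V a) := by
  constructor
  · intro h
    have hB := h.isTri hN
    refine ⟨hB, fun a => ⟨h.star_card_eq a, fun x y hxy => ?_⟩⟩
    have ha : a ∉ starSet B a := fun h => (mem_starSet.1 h).1 rfl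
    by_cases hax : a = x
    · subst hax
      rw [polygonBoundary_eq_zero (fun h => ha h.1),
        leftCount_eq_zero fun k _ hW => h.notMem a _ hW (by simp),
        leftCount_eq_zero fun k _ hW => h.notMem a _ hW (by simp)]
      rfl
    · have := h.boundary' a x y hax
      rw [hB.polygonBoundary_starSet hN]
      linarith
  · rintro ⟨hB, hV⟩
    refine ⟨hB.card_eq, fun a => (hV a).card_eq, fun a t ht hat =>
      (mem_starSet.1 ((hV a).mem_of_mem ht hat)).1 rfl, fun a x y _ _ hxy => ?_⟩
    have := (hV a).boundary x y hxy
    rw [hB.polygonBoundary_starSet hN] at this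
    linarith

/-- Every neighbour `x` other than the predecessor of `a` starts exactly one triangle, on the left
of the edge from `a` to `x`. -/
theorem IsTri.card_starSet {B : Finset (Finset (Fin N))} (hN : 3 ≤ N)
    (h : IsTri Finset.univ B) (a : Fin N) :
    (starSet B a).card = triangleDegree B a + 1 := by
  obtain ⟨p, hp⟩ := exists_prev (by omega) a
  have hpm := h.prev_mem_starSet hN hp
  have hcard : ((starSet B a).erase p).card = triangleDegree B a := by
    have hex : ∀ x ∈ (starSet B a).erase p, ∃ y, ccw a x y ∧ ({a, x, y} : Finset (Fin N)) ∈ B :=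
      fun x hx => h.exists_triple (Finset.mem_of_mem_erase hx) fun hxa =>
        Finset.ne_of_mem_erase hx (hxa.left_unique hp)
    choose! f hf using hex
    refine Finset.card_bij (fun x _ => {a, x, f x}) ?_ ?_ ?_
    · intro x hx
      exact Finset.mem_filter.2 ⟨(hf x hx).2, by simp⟩
    · intro x hx x' hx' he
      rcases (triple_eq_iff (hf x' hx').1 (hf x hx).1).1 he with h1 | h1 | h1
      · exact h1.2.1
      · exact absurd h1.1 (hf x' hx').1.ne.1
      · exact absurd h1.1 (hf x' hx').1.ne.2.2
    · intro t ht
      obtain ⟨ht, hat⟩ := Finset.mem_filter.1 ht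
      obtain ⟨x, y, hxy, rfl⟩ := exists_ccw_of_card (h.card_eq t ht) hat
      have hx : x ∈ (starSet B a).erase p := by
        refine Finset.mem_erase.2 ⟨?_, (mem_starSet_of_triple hxy ht).1⟩
        rintro rfl
        exact hp.2.2.2 y (Finset.mem_univ _) hxy.rotate
      refine ⟨x, hx, ?_⟩
      rw [(h.adj_of_triple hN hxy ht).right_unique
        (h.adj_of_triple hN (hf x hx).1 (hf x hx).2)]
  rw [← hcard, Finset.card_erase_of_mem hpm]
  have := Finset.card_pos.2 ⟨p, hpm⟩
  omega

theorem IsTri.one_le_triangleDegree {B : Finset (Finset (Fin N))} (hN : 3 ≤ N)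
    (h : IsTri Finset.univ B) (a : Fin N) : 1 ≤ triangleDegree B a := by
  obtain ⟨s, hs⟩ := exists_next (by omega) a
  obtain ⟨-, t, ht, hat, -⟩ := mem_starSet.1 (h.next_mem_starSet hN hs)
  exact Finset.card_pos.2 ⟨t, Finset.mem_filter.2 ⟨ht, hat⟩⟩

open scoped Classical in
/-- The set of star systems. -/
noncomputable def starSystems (N : ℕ) :
    Finset (Finset (Finset (Fin N)) × (Fin N → Finset (Finset (Fin N)))) :=
  Finset.univ.filter fun p => IsStarSystem p.1 p.2

theorem card_starSystems (hN : 3 ≤ N) :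
    (starSystems N).card =
      ∑ B ∈ triSet (Finset.univ : Finset (Fin N)), ∏ a, catalan (triangleDegree B a - 1) := by
  have h1 : (starSystems N).card = ((triSet (Finset.univ : Finset (Fin N))).sigma
      fun B => Fintype.piFinset fun a => triSet (starSet B a)).card := by
    refine Finset.card_bij' (fun p _ => ⟨p.1, p.2⟩) (fun q _ => (q.1, q.2)) ?_ ?_ ?_ ?_
    · intro p hp
      simp only [starSystems, Finset.mem_filter, isStarSystem_iff hN] at hp
      simp only [Finset.mem_sigma, Fintype.mem_piFinset, mem_triSet]
      exact hp.2
    · rintro ⟨B, V⟩ hp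
      simp only [Finset.mem_sigma, Fintype.mem_piFinset, mem_triSet] at hp
      simp only [starSystems, Finset.mem_filter, isStarSystem_iff hN]
      exact ⟨Finset.mem_univ _, hp⟩
    · intros; rfl
    · intros; rfl
  rw [h1, Finset.card_sigma]
  refine Finset.sum_congr rfl fun B hB => ?_
  rw [mem_triSet] at hB
  rw [Fintype.card_piFinset]
  refine Finset.prod_congr rfl fun a _ => card_triSet ?_
  have := hB.one_le_triangleDegree hN a
  rw [hB.card_starSet hN]
  omega

theorem card_starSystems_bounds {n : ℕ} (hn : 4 ≤ n) :
    2 ^ (n - 2) * catalan n ≤ (starSystems (n + 2)).card ∧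
      (starSystems (n + 2)).card ^ 2 ≤ 2 ^ (5 * n - 14) * catalan n ^ 2 := by
  have hc : (triSet (Finset.univ : Finset (Fin (n + 2)))).card = catalan n := card_triSet (by simp)
  rw [card_starSystems (by omega), ← hc]
  constructor
  · rw [mul_comm, ← smul_eq_mul]
    exact Finset.card_nsmul_le_sum _ _ _ fun B hB => ((mem_triSet.1 hB).catalan_prod_bounds hn).1
  -- The products are bounded only through their squares, so the sum is estimated by Cauchy–Schwarz;
  -- no loss results because the bound is uniform.
  · refine (sq_sum_le_card_mul_sum_sq).trans ?_
    rw [sq (Finset.card _), ← mul_assoc, mul_comm (2 ^ _), mul_assoc]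
    refine Nat.mul_le_mul_left _ ?_
    rw [mul_comm, ← smul_eq_mul]
    exact Finset.sum_le_card_nsmul _ _ _ fun B hB => ((mem_triSet.1 hB).catalan_prod_bounds hn).2

end Stars

open Filter Topology

/-! ### Relative interiors of convex hulls of finite families -/

section RelativeInterior

variable {E : Type*} [NormedAddCommGroup E] [NormedSpace ℝ E]

/-- The line from `y` through `x` lies in the affine span, so it stays in the relative interior for
a short while beyond `x`. -/
theorem exists_extension_of_mem_intrinsicInterior {s : Set E} {x y : E}
    (hx : x ∈ intrinsicInterior ℝ s) (hy : y ∈ s) : ∃ ε : ℝ, 0 < ε ∧ x + ε • (x - y) ∈ s := by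
  obtain ⟨x', hx', rfl⟩ := mem_intrinsicInterior.1 hx
  have : Nonempty (affineSpan ℝ s) := ⟨x'⟩
  let y' : affineSpan ℝ s := ⟨y, subset_affineSpan _ _ hy⟩
  let γ : ℝ → affineSpan ℝ s := fun t => AffineMap.lineMap x' y' (-t)
  have hγ : Continuous γ := AffineMap.lineMap_continuous.comp continuous_neg
  have h0 : γ 0 = x' := by simp [γ]
  have h1 : ∀ᶠ t in 𝓝 (0 : ℝ), γ t ∈ interior ((↑) ⁻¹' s : Set (affineSpan ℝ s)) :=
    hγ.continuousAt.eventually (by rw [h0]; exact isOpen_interior.mem_nhds hx')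
  have h2 : ∀ᶠ t in 𝓝[>] (0 : ℝ), γ t ∈ interior ((↑) ⁻¹' s : Set (affineSpan ℝ s)) :=
    h1.filter_mono nhdsWithin_le_nhds
  obtain ⟨ε, h3, h4⟩ := (h2.and self_mem_nhdsWithin).exists
  refine ⟨ε, h4, ?_⟩
  have h5 : ((γ ε : affineSpan ℝ s) : E) ∈ s :=
    interior_subset (s := ((↑) ⁻¹' s : Set (affineSpan ℝ s))) h3
  have h6 : ((γ ε : affineSpan ℝ s) : E) = (x' : E) + ε • ((x' : E) - y) := by
    have : ((γ ε : affineSpan ℝ s) : E) = AffineMap.lineMap (x' : E) y (-ε) :=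
      (AffineMap.apply_lineMap (affineSpan ℝ s).subtype x' y' (-ε))
    rw [this, AffineMap.lineMap_apply, vsub_eq_sub, vadd_eq_add]
    module
  rwa [h6] at h5

/-- The homothety with centre `u` and ratio `t` is an open map of the affine span and, by convexity,
carries the relative interior into `s`. -/
theorem combo_mem_intrinsicInterior {s : Set E} (hs : Convex ℝ s) {z u : E}
    (hz : z ∈ intrinsicInterior ℝ s) (hu : u ∈ s) {t : ℝ} (ht : 0 < t) (ht1 : t ≤ 1) :
    t • z + (1 - t) • u ∈ intrinsicInterior ℝ s := by
  obtain ⟨z', hz', rfl⟩ := mem_intrinsicInterior.1 hz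
  have : Nonempty (affineSpan ℝ s) := ⟨z'⟩
  let u' : affineSpan ℝ s := ⟨u, subset_affineSpan _ _ hu⟩
  have hcoe : ∀ y : affineSpan ℝ s,
      ((AffineMap.homothety u' t y : affineSpan ℝ s) : E) = t • (y : E) + (1 - t) • u := by
    intro y
    rw [AffineMap.homothety_apply]
    simp only [AffineSubspace.coe_vadd, Submodule.coe_smul, AffineSubspace.coe_vsub, vsub_eq_sub,
      vadd_eq_add, u']
    module
  refine mem_intrinsicInterior.2 ⟨AffineMap.homothety u' t z', ?_, hcoe z'⟩
  have hopen := AffineMap.homothety_isOpenMap u' t ht.ne'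
  refine interior_maximal ?_ (hopen _ isOpen_interior) (Set.mem_image_of_mem _ hz')
  rintro _ ⟨y, hy, rfl⟩
  rw [Set.mem_preimage, hcoe]
  exact hs (interior_subset (s := ((↑) ⁻¹' s : Set (affineSpan ℝ s))) hy) hu ht.le
    (sub_nonneg.2 ht1) (add_sub_cancel t 1)

variable {ι : Type*}

theorem mem_cellHull {p : ι → E} {C : Finset ι} {x : E} :
    x ∈ cellHull p C ↔ ∃ w : ι → ℝ, (∀ i ∈ C, 0 ≤ w i) ∧ ∑ i ∈ C, w i = 1 ∧
      ∑ i ∈ C, w i • p i = x := by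
  classical
  constructor
  · intro hx
    have hconv : Convex ℝ {x : E | ∃ w : ι → ℝ, (∀ i ∈ C, 0 ≤ w i) ∧ ∑ i ∈ C, w i = 1 ∧
        ∑ i ∈ C, w i • p i = x} := by
      rintro _ ⟨w, hw, hw1, rfl⟩ _ ⟨v, hv, hv1, rfl⟩ a b ha hb hab
      refine ⟨fun i => a * w i + b * v i, fun i hi => ?_, ?_, ?_⟩
      · have := hw i hi
        have := hv i hi
        positivity
      · rw [Finset.sum_add_distrib, ← Finset.mul_sum, ← Finset.mul_sum, hw1, hv1]
        linarith
      · simp only [add_smul, mul_smul, Finset.sum_add_distrib, Finset.smul_sum]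
    refine convexHull_min ?_ hconv hx
    rintro _ ⟨i, hi, rfl⟩
    have hi' : i ∈ C := hi
    refine ⟨Pi.single i 1, fun j _ => ?_, ?_, ?_⟩
    · by_cases h : j = i
      · subst h; simp
      · simp [h]
    · simp [Finset.sum_pi_single', hi']
    · rw [Finset.sum_eq_single i]
      · simp
      · intro j _ hj; simp [hj]
      · exact fun h => absurd hi' h
  · rintro ⟨w, hw, hw1, rfl⟩
    exact (convex_convexHull ℝ _).sum_mem hw hw1 fun i hi =>
      subset_convexHull ℝ _ (Set.mem_image_of_mem p hi)

/-- The relative interior of the convex hull of a finite family consists of the convex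
combinations with positive weights. -/
theorem mem_intrinsicInterior_cellHull {E : Type*} [NormedAddCommGroup E] [NormedSpace ℝ E]
    [FiniteDimensional ℝ E] {p : ι → E} {C : Finset ι} (hC : C.Nonempty) {x : E} :
    x ∈ intrinsicInterior ℝ (cellHull p C) ↔ ∃ w : ι → ℝ, (∀ i ∈ C, 0 < w i) ∧
      ∑ i ∈ C, w i = 1 ∧ ∑ i ∈ C, w i • p i = x := by
  classical
  have pos_of_mem : ∀ x ∈ intrinsicInterior ℝ (cellHull p C), ∃ w : ι → ℝ, (∀ i ∈ C, 0 < w i) ∧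
      ∑ i ∈ C, w i = 1 ∧ ∑ i ∈ C, w i • p i = x := by
    intro x hx
    -- Prolonging the segment from the barycentre `y` beyond `x` to a point `z` of the hull makes
    -- `x` a mixture of `z` and `y`; the share of `y` makes all weights positive.
    set y : E := ∑ i ∈ C, ((C.card : ℝ)⁻¹) • p i with hy
    have hcard : (0 : ℝ) < C.card := by exact_mod_cast Finset.card_pos.2 hC
    have hy1 : ∑ i ∈ C, ((C.card : ℝ)⁻¹) = 1 := by
      rw [Finset.sum_const, nsmul_eq_mul, mul_inv_cancel₀ hcard.ne']
    have hyC : y ∈ cellHull p C :=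
      mem_cellHull.2 ⟨fun _ => (C.card : ℝ)⁻¹, fun _ _ => by positivity, hy1, rfl⟩
    obtain ⟨ε, hε, hz⟩ := exists_extension_of_mem_intrinsicInterior hx hyC
    obtain ⟨w, hw, hw1, hwz⟩ := mem_cellHull.1 hz
    have hε1 : (0 : ℝ) < 1 + ε := by linarith
    refine ⟨fun i => (1 + ε)⁻¹ * (w i + ε * (C.card : ℝ)⁻¹), fun i hi => ?_, ?_, ?_⟩
    · have := hw i hi
      positivity
    · rw [← Finset.mul_sum, Finset.sum_add_distrib, ← Finset.mul_sum, hw1, hy1]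
      field_simp
    · simp only [mul_smul, add_smul, ← Finset.smul_sum, Finset.sum_add_distrib]
      rw [hwz, Finset.smul_sum, ← hy]
      rw [inv_smul_eq_iff₀ hε1.ne']
      module
  refine ⟨pos_of_mem x, ?_⟩
  rintro ⟨w, hw, hw1, rfl⟩
  have hne : (cellHull p C).Nonempty := by
    obtain ⟨i, hi⟩ := hC
    exact ⟨p i, subset_convexHull ℝ _ (Set.mem_image_of_mem p hi)⟩
  obtain ⟨z, hz⟩ := hne.intrinsicInterior (convex_convexHull ℝ _)
  obtain ⟨v, hv, hv1, hvz⟩ := pos_of_mem z hz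
  obtain ⟨i₀, hi₀, hmin⟩ := C.exists_min_image w hC
  -- Half the least weight is small enough to subtract `δ` times a relative interior point `z` and
  -- keep nonnegative weights. The given point is then a mixture of `z` and a point of the hull.
  set δ := w i₀ / 2 with hδ
  have hδ0 : 0 < δ := by have := hw i₀ hi₀; positivity
  have hle : ∀ i ∈ C, v i ≤ 1 := fun i hi => by
    rw [← hv1]
    exact Finset.single_le_sum (fun j hj => (hv j hj).le) hi
  have hwle : w i₀ ≤ 1 := by
    rw [← hw1]
    exact Finset.single_le_sum (f := w) (fun j hj => (hw j hj).le) hi₀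
  have hδ1 : 0 < 1 - δ := by linarith
  have hu : ∑ i ∈ C, ((1 - δ)⁻¹ * (w i - δ * v i)) • p i ∈ cellHull p C := by
    refine mem_cellHull.2 ⟨fun i => (1 - δ)⁻¹ * (w i - δ * v i), fun i hi => ?_, ?_, rfl⟩
    · have h1 := hmin i hi
      have h2 := hle i hi
      have h3 : δ * v i ≤ δ := by nlinarith
      have : 0 ≤ w i - δ * v i := by linarith
      positivity
    · rw [← Finset.mul_sum, Finset.sum_sub_distrib, ← Finset.mul_sum, hw1, hv1]
      field_simp
  have := combo_mem_intrinsicInterior (convex_convexHull ℝ _) hz hu hδ0 (by linarith)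
  suffices e : ∑ i ∈ C, w i • p i =
      δ • z + (1 - δ) • ∑ i ∈ C, ((1 - δ)⁻¹ * (w i - δ * v i)) • p i by rwa [e]
  have e1 : ∑ i ∈ C, ((1 - δ)⁻¹ * (w i - δ * v i)) • p i =
      (1 - δ)⁻¹ • (∑ i ∈ C, w i • p i - δ • z) := by
    rw [← hvz, Finset.smul_sum, ← Finset.sum_sub_distrib, Finset.smul_sum]
    refine Finset.sum_congr rfl fun i _ => ?_
    module
  rw [e1, smul_smul, mul_inv_cancel₀ hδ1.ne']
  module

end RelativeInterior

/-! ### Oriented triangles in the plane -/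

section Plane

/-- The Euclidean plane. -/
abbrev Plane := EuclideanSpace ℝ (Fin 2)

/-- Twice the signed area of the triangle `p q r`. -/
def orient (p q r : Plane) : ℝ := (q 0 - p 0) * (r 1 - p 1) - (q 1 - p 1) * (r 0 - p 0)

theorem orient_rotate (p q r : Plane) : orient p q r = orient q r p := by
  unfold orient; ring

theorem orient_swap (p q r : Plane) : orient q p r = - orient p q r := by
  unfold orient; ring

theorem orient_self_left (p q : Plane) : orient p q p = 0 := by
  unfold orient; ring

theorem orient_self_right (p q : Plane) : orient p q q = 0 := by
  unfold orient; ring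

theorem orient_add_add_add (p q r x : Plane) :
    orient p q x + orient q r x + orient r p x = orient p q r := by
  unfold orient; ring

theorem orient_lineMap (p q x c : Plane) (t : ℝ) :
    orient p q (x + t • (c - x)) = (1 - t) * orient p q x + t * orient p q c := by
  simp only [orient, PiLp.add_apply, PiLp.smul_apply, PiLp.sub_apply, smul_eq_mul]
  ring

theorem continuous_orient (p q : Plane) : Continuous fun x : Plane => orient p q x := by
  unfold orient
  fun_prop

variable {ι : Type*}

theorem orient_sum (p q : Plane) (P : ι → Plane) (C : Finset ι) (w : ι → ℝ)
    (hw : ∑ i ∈ C, w i = 1) :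
    orient p q (∑ i ∈ C, w i • P i) = ∑ i ∈ C, w i * orient p q (P i) := by
  have h : ∀ l : Fin 2, (∑ i ∈ C, w i • P i) l = ∑ i ∈ C, w i * P i l := fun l => by
    simp [Finset.sum_apply]
  have e : ∀ i ∈ C, w i * orient p q (P i) =
      (q 0 - p 0) * (w i * P i 1) - (q 1 - p 1) * (w i * P i 0) -
        w i * ((q 0 - p 0) * p 1 - (q 1 - p 1) * p 0) := fun i _ => by
    unfold orient; ring
  rw [Finset.sum_congr rfl e, Finset.sum_sub_distrib, Finset.sum_sub_distrib, ← Finset.mul_sum,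
    ← Finset.mul_sum, ← Finset.sum_mul, hw, orient, h, h]
  ring

theorem orient_nonneg_of_mem_cellHull {p q : Plane} {P : ι → Plane} {C : Finset ι} {x : Plane}
    (hx : x ∈ cellHull P C) (h : ∀ i ∈ C, 0 ≤ orient p q (P i)) : 0 ≤ orient p q x := by
  obtain ⟨w, hw, hw1, rfl⟩ := mem_cellHull.1 hx
  rw [orient_sum _ _ _ _ _ hw1]
  exact Finset.sum_nonneg fun i hi => mul_nonneg (hw i hi) (h i hi)

theorem cellHull_mono {P : ι → Plane} {C D : Finset ι} (h : C ⊆ D) : cellHull P C ⊆ cellHull P D :=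
  convexHull_mono (Set.image_mono (by exact_mod_cast h))

theorem isClosed_cellHull (P : ι → Plane) (C : Finset ι) : IsClosed (cellHull P C) :=
  ((C.finite_toSet.image P).isCompact_convexHull ℝ).isClosed

theorem convex_cellHull (P : ι → Plane) (C : Finset ι) : Convex ℝ (cellHull P C) :=
  convex_convexHull ℝ _

theorem mem_cellHull_self {P : ι → Plane} {C : Finset ι} {i : ι} (hi : i ∈ C) :
    P i ∈ cellHull P C := subset_convexHull ℝ _ (Set.mem_image_of_mem P hi)

/-- Every point of a polytope lies in the relative interior of the hull of some labels. -/
theorem exists_support {P : ι → Plane} {D : Finset ι} {x : Plane} (hx : x ∈ cellHull P D) :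
    ∃ C ⊆ D, C.Nonempty ∧ x ∈ intrinsicInterior ℝ (cellHull P C) := by
  obtain ⟨w, hw, hw1, rfl⟩ := mem_cellHull.1 hx
  set C := D.filter fun l => 0 < w l with hC
  have hsub : C ⊆ D := Finset.filter_subset _ _
  have hzero : ∀ l ∈ D, l ∉ C → w l = 0 := fun l hl hlC => by
    have h1 := hw l hl
    have h2 : ¬ 0 < w l := fun h => hlC (Finset.mem_filter.2 ⟨hl, h⟩)
    linarith
  have hs : ∑ l ∈ C, w l = 1 := by
    rw [← hw1]; exact Finset.sum_subset hsub hzero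
  have hne : C.Nonempty := by
    rw [Finset.nonempty_iff_ne_empty]
    intro h
    rw [h] at hs
    simp at hs
  refine ⟨C, hsub, hne, (mem_intrinsicInterior_cellHull hne).2
    ⟨w, fun l hl => (Finset.mem_filter.1 hl).2, hs, ?_⟩⟩
  exact Finset.sum_subset hsub fun l hl hlC => by rw [hzero l hl hlC, zero_smul]

theorem ne_of_orient_pos {P : ι → Plane} {i j k : ι} (h : 0 < orient (P i) (P j) (P k)) :
    i ≠ j ∧ j ≠ k ∧ i ≠ k := by
  refine ⟨?_, ?_, ?_⟩ <;> rintro rfl <;> unfold orient at h <;> ring_nf at h <;>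
    exact lt_irrefl _ h

variable [DecidableEq ι] {P : ι → Plane} {i j k : ι}

theorem sum_triple {M : Type*} [AddCommMonoid M] (h : 0 < orient (P i) (P j) (P k)) (f : ι → M) :
    ∑ l ∈ ({i, j, k} : Finset ι), f l = f i + (f j + f k) := by
  obtain ⟨h1, h2, h3⟩ := ne_of_orient_pos h
  rw [Finset.sum_insert (by simp [h1, h3]), Finset.sum_insert (by simp [h2]),
    Finset.sum_singleton]

theorem triple_rotate' (i j k : ι) : ({i, j, k} : Finset ι) = {j, k, i} := by
  ext; simp only [Finset.mem_insert, Finset.mem_singleton]; tauto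

/-- The weight of the third vertex is determined by the orientation. -/
theorem orient_weights (h : 0 < orient (P i) (P j) (P k)) {w : ι → ℝ}
    (hw : ∑ l ∈ ({i, j, k} : Finset ι), w l = 1) :
    orient (P i) (P j) (∑ l ∈ ({i, j, k} : Finset ι), w l • P l) =
      w k * orient (P i) (P j) (P k) := by
  rw [orient_sum _ _ _ _ _ hw, sum_triple h, orient_self_left, orient_self_right]
  ring

theorem exists_weights_of_relint {C : Finset ι} (hCD : C ⊆ {i, j, k}) {x : Plane}
    (hx : x ∈ intrinsicInterior ℝ (cellHull P C)) :
    ∃ w : ι → ℝ, (∀ l ∈ C, 0 < w l) ∧ (∀ l, l ∉ C → w l = 0) ∧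
      ∑ l ∈ ({i, j, k} : Finset ι), w l = 1 ∧ ∑ l ∈ ({i, j, k} : Finset ι), w l • P l = x := by
  have hC : C.Nonempty := by
    rw [Finset.nonempty_iff_ne_empty]
    rintro rfl
    simp [cellHull] at hx
  obtain ⟨w, hw, hw1, hwx⟩ := (mem_intrinsicInterior_cellHull hC).1 hx
  refine ⟨fun l => if l ∈ C then w l else 0, fun l hl => by simp [hl, hw l hl],
    fun l hl => by simp [hl], ?_, ?_⟩
  · rw [Finset.sum_ite_mem, Finset.inter_eq_right.2 hCD, hw1]
  · simp only [ite_smul, zero_smul]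
    rw [Finset.sum_ite_mem, Finset.inter_eq_right.2 hCD, hwx]

/-- Up to a positive factor, the orientation with respect to `i j` is the barycentric weight of `k`.
-/
theorem mem_iff_of_relint (h : 0 < orient (P i) (P j) (P k)) {C : Finset ι} (hCD : C ⊆ {i, j, k})
    {x : Plane} (hx : x ∈ intrinsicInterior ℝ (cellHull P C)) :
    k ∈ C ↔ 0 < orient (P i) (P j) x := by
  obtain ⟨w, hw, hw0, hw1, rfl⟩ := exists_weights_of_relint hCD hx
  rw [orient_weights h hw1]
  by_cases hk : k ∈ C
  · simp [hk, mul_pos (hw k hk) h]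
  · simp [hk, hw0 k hk]

/-- Distinct faces of a triangle have disjoint relative interiors. -/
theorem face_unique (h : 0 < orient (P i) (P j) (P k)) {C C' : Finset ι} (hC : C ⊆ {i, j, k})
    (hC' : C' ⊆ {i, j, k}) {x : Plane} (hx : x ∈ intrinsicInterior ℝ (cellHull P C))
    (hx' : x ∈ intrinsicInterior ℝ (cellHull P C')) : C = C' := by
  have hk := (mem_iff_of_relint h hC hx).trans (mem_iff_of_relint h hC' hx').symm
  have h2 : 0 < orient (P j) (P k) (P i) := by rwa [← orient_rotate]
  have h3 : 0 < orient (P k) (P i) (P j) := by rwa [← orient_rotate]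
  have hi := (mem_iff_of_relint h2 (by rwa [← triple_rotate']) hx).trans
    (mem_iff_of_relint h2 (by rwa [← triple_rotate']) hx').symm
  have hj := (mem_iff_of_relint h3 (by rwa [triple_rotate']) hx).trans
    (mem_iff_of_relint h3 (by rwa [triple_rotate']) hx').symm
  ext l
  constructor
  · intro hl
    have := hC hl
    simp only [Finset.mem_insert, Finset.mem_singleton] at this
    rcases this with rfl | rfl | rfl
    exacts [hi.1 hl, hj.1 hl, hk.1 hl]
  · intro hl
    have := hC' hl
    simp only [Finset.mem_insert, Finset.mem_singleton] at this
    rcases this with rfl | rfl | rfl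
    exacts [hi.2 hl, hj.2 hl, hk.2 hl]

theorem barycentric (h : 0 < orient (P i) (P j) (P k)) (x : Plane) :
    ∃ w : ι → ℝ, w i = orient (P j) (P k) x / orient (P i) (P j) (P k) ∧
      w j = orient (P k) (P i) x / orient (P i) (P j) (P k) ∧
      w k = orient (P i) (P j) x / orient (P i) (P j) (P k) ∧
      ∑ l ∈ ({i, j, k} : Finset ι), w l = 1 ∧ ∑ l ∈ ({i, j, k} : Finset ι), w l • P l = x := by
  obtain ⟨h1, h2, h3⟩ := ne_of_orient_pos h
  set O := orient (P i) (P j) (P k) with hO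
  refine ⟨fun l => if l = i then orient (P j) (P k) x / O else if l = j then
    orient (P k) (P i) x / O else orient (P i) (P j) x / O, by simp, by simp [h1.symm],
    by simp [h2.symm, h3.symm], ?_, ?_⟩
  · rw [sum_triple h]
    simp only [if_true, h1.symm, h2.symm, h3.symm, if_false]
    have := orient_add_add_add (P i) (P j) (P k) x
    rw [← hO] at this
    field_simp
    linarith
  · rw [sum_triple h]
    simp only [if_true, h1.symm, h2.symm, h3.symm, if_false]
    have hne := h.ne'
    ext l
    fin_cases l
    all_goals
      simp only [PiLp.add_apply, PiLp.smul_apply, smul_eq_mul, Fin.zero_eta, Fin.mk_one]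
      field_simp
      rw [hO]
      unfold orient
      ring

theorem mem_cellHull_triple (h : 0 < orient (P i) (P j) (P k)) {x : Plane} :
    x ∈ cellHull P {i, j, k} ↔
      0 ≤ orient (P i) (P j) x ∧ 0 ≤ orient (P j) (P k) x ∧ 0 ≤ orient (P k) (P i) x := by
  constructor
  · intro hx
    refine ⟨orient_nonneg_of_mem_cellHull hx ?_, orient_nonneg_of_mem_cellHull hx ?_,
      orient_nonneg_of_mem_cellHull hx ?_⟩ <;>
    · simp only [Finset.mem_insert, Finset.mem_singleton, forall_eq_or_imp, forall_eq,
        orient_self_left, orient_self_right, le_refl, true_and, and_true]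
      first
        | exact h.le
        | (rw [← orient_rotate]; exact h.le)
        | (rw [orient_rotate]; exact h.le)
  · rintro ⟨h1, h2, h3⟩
    obtain ⟨w, hi, hj, hk, hw1, hwx⟩ := barycentric h x
    refine mem_cellHull.2 ⟨w, ?_, hw1, hwx⟩
    simp only [Finset.mem_insert, Finset.mem_singleton, forall_eq_or_imp, forall_eq, hi, hj, hk]
    exact ⟨div_nonneg h2 h.le, div_nonneg h3 h.le, div_nonneg h1 h.le⟩

/-- The strict inequalities that define the interior of a triangle. -/
def InTriangle (p q r x : Plane) : Prop :=
  0 < orient p q x ∧ 0 < orient q r x ∧ 0 < orient r p x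

theorem mem_relint_triple (h : 0 < orient (P i) (P j) (P k)) {x : Plane} :
    x ∈ intrinsicInterior ℝ (cellHull P {i, j, k}) ↔ InTriangle (P i) (P j) (P k) x := by
  have h2 : 0 < orient (P j) (P k) (P i) := by rwa [← orient_rotate]
  have h3 : 0 < orient (P k) (P i) (P j) := by rwa [← orient_rotate]
  constructor
  · intro hx
    exact ⟨(mem_iff_of_relint h subset_rfl hx).1 (by simp),
      (mem_iff_of_relint h2 (triple_rotate' i j k).subset hx).1 (by simp),
      (mem_iff_of_relint h3 (triple_rotate' k i j).symm.subset hx).1 (by simp)⟩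
  · rintro ⟨h1, h2, h3⟩
    obtain ⟨w, hi, hj, hk, hw1, hwx⟩ := barycentric h x
    refine (mem_intrinsicInterior_cellHull (by simp)).2 ⟨w, ?_, hw1, hwx⟩
    simp only [Finset.mem_insert, Finset.mem_singleton, forall_eq_or_imp, forall_eq, hi, hj, hk]
    exact ⟨div_pos h2 h, div_pos h3 h, div_pos h1 h⟩

/-- Every nonempty set of vertices of a triangle is a face. -/
theorem isFaceOf_triple (h : 0 < orient (P i) (P j) (P k)) {C : Finset ι} (hC : C.Nonempty)
    (hCD : C ⊆ {i, j, k}) : IsFaceOf P C {i, j, k} := by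
  refine ⟨hC, ?_⟩
  -- The functional is, up to scaling and an additive constant, the sum of the barycentric
  -- coordinates belonging to vertices outside `C`. It vanishes exactly on the face `C`.
  let c : ι → ℝ := fun l => if l ∈ C then 0 else 1
  let lin : Plane → Plane → (Plane →ₗ[ℝ] ℝ) := fun p q =>
    (q 0 - p 0) • (EuclideanSpace.proj (1 : Fin 2) : Plane →L[ℝ] ℝ).toLinearMap -
    (q 1 - p 1) • (EuclideanSpace.proj (0 : Fin 2) : Plane →L[ℝ] ℝ).toLinearMap
  have hlin : ∀ p q r, lin p q r = orient p q r + ((q 0 - p 0) * p 1 - (q 1 - p 1) * p 0) := by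
    intro p q r
    simp [lin, orient]
    ring
  let f : Plane →ₗ[ℝ] ℝ :=
    c i • lin (P j) (P k) + c j • lin (P k) (P i) + c k • lin (P i) (P j)
  obtain ⟨K, hK⟩ : ∃ K : ℝ, ∀ r, f r = c i * orient (P j) (P k) r + c j * orient (P k) (P i) r +
      c k * orient (P i) (P j) r + K := by
    refine ⟨c i * ((P k 0 - P j 0) * P j 1 - (P k 1 - P j 1) * P j 0) +
      c j * ((P i 0 - P k 0) * P k 1 - (P i 1 - P k 1) * P k 0) +
      c k * ((P j 0 - P i 0) * P i 1 - (P j 1 - P i 1) * P i 0), fun r => ?_⟩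
    simp only [f, LinearMap.add_apply, LinearMap.smul_apply, smul_eq_mul, hlin]
    ring
  set O := orient (P i) (P j) (P k) with hO
  have h2 : orient (P j) (P k) (P i) = O := (orient_rotate _ _ _).symm
  have h3 : orient (P k) (P i) (P j) = O := orient_rotate _ _ _
  have hval : ∀ l ∈ ({i, j, k} : Finset ι), f (P l) = c l * O + K := by
    simp only [Finset.mem_insert, Finset.mem_singleton, forall_eq_or_imp, forall_eq, hK,
      orient_self_left, orient_self_right, h2, h3, ← hO]
    refine ⟨by ring, by ring, by ring⟩
  refine ⟨f, fun l => ⟨fun hl => ⟨hCD hl, fun m hm => ?_⟩, ?_⟩⟩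
  · rw [hval l (hCD hl), hval m hm]
    have : c l = 0 := if_pos hl
    have : 0 ≤ c m := by simp only [c]; split_ifs <;> norm_num
    nlinarith
  · rintro ⟨hl, hmin⟩
    by_contra hlC
    obtain ⟨m, hm⟩ := hC
    have := hmin m (hCD hm)
    rw [hval l hl, hval m (hCD hm)] at this
    have h5 : c l = 1 := if_neg hlC
    have h6 : c m = 0 := if_pos hm
    rw [h5, h6] at this
    linarith

/-- Moving from the relative interior of the edge `i j` to the left one enters the triangle. -/
theorem eventually_inTriangle (h : 0 < orient (P i) (P j) (P k)) {x c : Plane}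
    (hx : x ∈ intrinsicInterior ℝ (cellHull P {i, j})) (hc : 0 < orient (P i) (P j) c) :
    ∀ᶠ t in 𝓝[>] (0 : ℝ), InTriangle (P i) (P j) (P k) (x + t • (c - x)) := by
  obtain ⟨h1, h2, h3⟩ := ne_of_orient_pos h
  have hsub : ({i, j} : Finset ι) ⊆ {i, j, k} := by intro l; simp; tauto
  have hsub2 : ({i, j} : Finset ι) ⊆ {j, k, i} := by intro l; simp; tauto
  have hsub3 : ({i, j} : Finset ι) ⊆ {k, i, j} := by intro l; simp; tauto
  have e2 : 0 < orient (P j) (P k) (P i) := by rwa [← orient_rotate]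
  have e3 : 0 < orient (P k) (P i) (P j) := by rwa [← orient_rotate]
  have x2 : 0 < orient (P j) (P k) x := (mem_iff_of_relint e2 hsub2 hx).1 (by simp)
  have x3 : 0 < orient (P k) (P i) x := (mem_iff_of_relint e3 hsub3 hx).1 (by simp)
  have x1 : 0 ≤ orient (P i) (P j) x := orient_nonneg_of_mem_cellHull
    (intrinsicInterior_subset hx) (by simp [orient_self_left, orient_self_right])
  have hcont : Continuous fun t : ℝ => x + t • (c - x) := by fun_prop
  have ev : ∀ p q : Plane, 0 < orient p q x →
      ∀ᶠ t in 𝓝[>] (0 : ℝ), 0 < orient p q (x + t • (c - x)) := by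
    intro p q hpq
    have : ContinuousAt (fun t : ℝ => orient p q (x + t • (c - x))) 0 :=
      ((continuous_orient p q).comp hcont).continuousAt
    exact (this.eventually (lt_mem_nhds (by simpa using hpq))).filter_mono nhdsWithin_le_nhds
  have hlt : ∀ᶠ t in 𝓝[>] (0 : ℝ), t < 1 :=
    (gt_mem_nhds zero_lt_one).filter_mono nhdsWithin_le_nhds
  filter_upwards [ev _ _ x2, ev _ _ x3, hlt, self_mem_nhdsWithin] with t ht2 ht3 ht1 ht0
  refine ⟨?_, ht2, ht3⟩
  rw [orient_lineMap]
  have : 0 < t := ht0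
  have := mul_pos this hc
  have := mul_nonneg (sub_nonneg.2 ht1.le) x1
  linarith

theorem isOpen_inTriangle (p q r : Plane) : IsOpen {x | InTriangle p q r x} :=
  (isOpen_lt continuous_const (continuous_orient p q)).inter
    ((isOpen_lt continuous_const (continuous_orient q r)).inter
      (isOpen_lt continuous_const (continuous_orient r p)))

end Plane

/-! ### Triangle systems with prescribed boundary tile the polygon -/

section Crossing

open scoped Classical in
/-- The signed number of crossings of the ray from `x` in the first coordinate direction with the
segment from `p` to `q`. -/
noncomputable def crossing (x p q : Plane) : ℤ :=
  (if p 1 < x 1 ∧ x 1 < q 1 ∧ 0 < orient p q x then 1 else 0) -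
    (if q 1 < x 1 ∧ x 1 < p 1 ∧ 0 < orient q p x then 1 else 0)

theorem crossing_swap (x p q : Plane) : crossing x q p = - crossing x p q := by
  unfold crossing; ring

open scoped Classical in
theorem crossing_triangle {x p q r : Plane} (h : 0 < orient p q r) (hp : p 1 ≠ x 1)
    (hq : q 1 ≠ x 1) (hr : r 1 ≠ x 1) (hpq : orient p q x ≠ 0) (hqr : orient q r x ≠ 0)
    (hrp : orient r p x ≠ 0) :
    crossing x p q + crossing x q r + crossing x r p = if InTriangle p q r x then 1 else 0 := by
  have hsum := orient_add_add_add p q r x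
  -- Barycentric weights balance the heights relative to `x`. Together with `hsum`, this excludes
  -- every sign pattern in which the crossing count would be wrong.
  have hrel : (p 1 - x 1) * orient q r x + (q 1 - x 1) * orient r p x +
      (r 1 - x 1) * orient p q x = 0 := by unfold orient; ring
  unfold crossing InTriangle
  rw [orient_swap p q x, orient_swap q r x, orient_swap r p x]
  generalize orient p q x = A at *
  generalize orient q r x = B at *
  generalize orient r p x = C at *
  generalize orient p q r = O at *
  generalize p 1 = a at *
  generalize q 1 = b at *
  generalize r 1 = c at *
  generalize x 1 = y at *
  have mneg : ∀ u v : ℝ, u < y → 0 < v → (u - y) * v < 0 := fun u v h1 h2 => by nlinarith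
  have mpos : ∀ u v : ℝ, y < u → 0 < v → 0 < (u - y) * v := fun u v h1 h2 => by nlinarith
  have mneg' : ∀ u v : ℝ, y < u → v < 0 → (u - y) * v < 0 := fun u v h1 h2 => by nlinarith
  have mpos' : ∀ u v : ℝ, u < y → v < 0 → 0 < (u - y) * v := fun u v h1 h2 => by nlinarith
  rcases lt_or_gt_of_ne hpq with hA | hA <;> rcases lt_or_gt_of_ne hqr with hB | hB <;>
    rcases lt_or_gt_of_ne hrp with hC | hC
  · linarith
  all_goals
    rcases lt_or_gt_of_ne hp with ha | ha <;> rcases lt_or_gt_of_ne hq with hb | hb <;>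
    rcases lt_or_gt_of_ne hr with hc | hc <;>
    first
    | simp [hA, hB, hC, ha, hb, hc, not_lt.2 hA.le, not_lt.2 hB.le, not_lt.2 hC.le,
        not_lt.2 ha.le, not_lt.2 hb.le, not_lt.2 hc.le]; done
    | exfalso
      have h1 := mneg a B
      have h2 := mpos a B
      have h3 := mneg' a B
      have h4 := mpos' a B
      have h5 := mneg b C
      have h6 := mpos b C
      have h7 := mneg' b C
      have h8 := mpos' b C
      have h9 := mneg c A
      have h10 := mpos c A
      have h11 := mneg' c A
      have h12 := mpos' c A
      simp only [hA, hB, hC, ha, hb, hc, not_lt.2 hA.le, not_lt.2 hB.le, not_lt.2 hC.le,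
        not_lt.2 ha.le, not_lt.2 hb.le, not_lt.2 hc.le, forall_const,
        false_implies] at h1 h2 h3 h4 h5 h6 h7 h8 h9 h10 h11 h12
      linarith

end Crossing

/-! ### Generic points -/

section Generic

variable {ι : Type*}

/-- `x` avoids all lines through two labelled points and all parallels to the first axis through
labelled points. -/
def IsGeneric (P : ι → Plane) (x : Plane) : Prop :=
  (∀ i, P i 1 ≠ x 1) ∧ ∀ i j, P i ≠ P j → orient (P i) (P j) x ≠ 0

/-- Along the direction `v` the function is affine with nonzero slope, so any zero is a limit of
nonzeros. -/
theorem isOpen_dense_ne_zero {f : Plane → ℝ} (hf : Continuous f) (v : Plane) {c : ℝ} (hc : c ≠ 0)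
    (h : ∀ x (t : ℝ), f (x + t • v) = f x + t * c) : IsOpen {x | f x ≠ 0} ∧ Dense {x | f x ≠ 0} := by
  refine ⟨isOpen_ne_fun hf continuous_const, fun x => ?_⟩
  by_cases hx : f x = 0
  · have hcont : Continuous fun t : ℝ => x + t • v := by fun_prop
    have ht : Tendsto (fun t : ℝ => x + t • v) (𝓝[≠] 0) (𝓝 x) := by
      have := hcont.tendsto 0
      simp only [zero_smul, add_zero] at this
      exact this.mono_left nhdsWithin_le_nhds
    refine mem_closure_of_tendsto ht ?_
    filter_upwards [self_mem_nhdsWithin] with t ht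
    have : f (x + t • v) ≠ 0 := by
      rw [h, hx, zero_add]
      exact mul_ne_zero ht hc
    exact this
  · exact subset_closure hx

theorem dense_isGeneric [Finite ι] (P : ι → Plane) : Dense {x | IsGeneric P x} := by
  have h1 : ∀ i, IsOpen {x : Plane | P i 1 ≠ x 1} ∧ Dense {x : Plane | P i 1 ≠ x 1} := by
    intro i
    have := isOpen_dense_ne_zero (f := fun x : Plane => x 1 - P i 1) (by fun_prop)
      (EuclideanSpace.single 1 1) (c := 1) one_ne_zero (fun x t => by simp; ring)
    have e : {x : Plane | P i 1 ≠ x 1} = {x : Plane | x 1 - P i 1 ≠ 0} := by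
      ext x
      exact ⟨fun h => sub_ne_zero.2 (Ne.symm h), fun h => (sub_ne_zero.1 h).symm⟩
    rwa [e]
  have h2 : ∀ ij : ι × ι, IsOpen {x : Plane | P ij.1 ≠ P ij.2 → orient (P ij.1) (P ij.2) x ≠ 0} ∧
      Dense {x : Plane | P ij.1 ≠ P ij.2 → orient (P ij.1) (P ij.2) x ≠ 0} := by
    rintro ⟨i, j⟩
    simp only
    by_cases hij : P i = P j
    · simp [hij]
    · simp only [ne_eq, hij, not_false_iff, forall_const]
      by_cases h0 : P j 0 - P i 0 = 0
      · have h1 : P j 1 - P i 1 ≠ 0 := by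
          intro h1
          apply hij
          ext l
          fin_cases l
          · simp only [Fin.zero_eta]; linarith
          · simp only [Fin.mk_one]; linarith
        exact isOpen_dense_ne_zero (continuous_orient _ _) (EuclideanSpace.single 0 1)
          (c := -(P j 1 - P i 1)) (neg_ne_zero.2 h1) (fun x t => by simp [orient]; ring)
      · exact isOpen_dense_ne_zero (continuous_orient _ _) (EuclideanSpace.single 1 1)
          (c := P j 0 - P i 0) h0 (fun x t => by simp [orient]; ring)
  have h3 := dense_iInter_of_isOpen (fun i => (h1 i).1) (fun i => (h1 i).2)
  have h4 := dense_iInter_of_isOpen (fun i => (h2 i).1) (fun i => (h2 i).2)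
  have h5 : IsOpen (⋂ i, {x : Plane | P i 1 ≠ x 1}) := isOpen_iInter_of_finite fun i => (h1 i).1
  refine (h3.inter_of_isOpen_left h4 h5).mono ?_
  rintro x ⟨hx1, hx2⟩
  rw [Set.mem_iInter] at hx1 hx2
  exact ⟨hx1, fun i j => hx2 (i, j)⟩

theorem exists_isGeneric [Finite ι] (P : ι → Plane) {U : Set Plane} (hU : IsOpen U)
    (hne : U.Nonempty) : ∃ x ∈ U, IsGeneric P x :=
  (dense_isGeneric P).inter_open_nonempty U hU hne

theorem exists_inTriangle {p q r : Plane} (h : 0 < orient p q r) : ∃ x, InTriangle p q r x := by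
  refine ⟨(3 : ℝ)⁻¹ • (p + q + r), ?_, ?_, ?_⟩ <;>
  · unfold orient at *
    simp only [PiLp.smul_apply, PiLp.add_apply, smul_eq_mul]
    nlinarith

/-- A closed set that contains the generic points of a full-dimensional polytope contains it. -/
theorem cellHull_subset_of_generic [Finite ι] {P : ι → Plane} {G : Finset ι} {i j k : ι}
    (hi : i ∈ G) (hj : j ∈ G) (hk : k ∈ G) (h : 0 < orient (P i) (P j) (P k)) {F : Set Plane}
    (hF : IsClosed F) (hG : ∀ x ∈ interior (cellHull P G), IsGeneric P x → x ∈ F) :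
    cellHull P G ⊆ F := by
  classical
  have hne : (interior (cellHull P G)).Nonempty := by
    obtain ⟨x, hx⟩ := exists_inTriangle h
    refine ⟨x, interior_maximal (fun y hy => ?_) (isOpen_inTriangle _ _ _) hx⟩
    have hsub : ({i, j, k} : Finset ι) ⊆ G := by
      intro l
      simp only [Finset.mem_insert, Finset.mem_singleton]
      rintro (rfl | rfl | rfl) <;> assumption
    exact cellHull_mono hsub (intrinsicInterior_subset ((mem_relint_triple h).2 hy))
  have h1 := (convex_cellHull P G).closure_interior_eq_closure_of_nonempty_interior hne
  have h2 : interior (cellHull P G) ⊆ F := by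
    refine ((dense_isGeneric P).open_subset_closure_inter isOpen_interior).trans ?_
    exact closure_minimal (fun x hx => hG x hx.1 hx.2) hF
  calc cellHull P G ⊆ closure (cellHull P G) := subset_closure
    _ = closure (interior (cellHull P G)) := h1.symm
    _ ⊆ F := closure_minimal h2 hF

end Generic

section Tiling

variable {ι : Type*} [Fintype ι]

open scoped Classical in
/-- The indicator function of a relation. -/
noncomputable def indicator (r : ι → ι → Prop) (i j : ι) : ℤ := if r i j then 1 else 0

/-- `rim` is the set of oriented edges of the convex hull of the labels in `G`. -/
structure IsRim {N : ℕ} (P : ι → Plane) (G : Finset ι) (q : Fin N → ι) (rim : ι → ι → Prop) :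
    Prop where
  mem : ∀ i j, rim i j → i ∈ G ∧ j ∈ G
  ne : ∀ i j, rim i j → P i ≠ P j
  nonneg : ∀ i j, rim i j → ∀ l ∈ G, 0 ≤ orient (P i) (P j) (P l)
  eq_zero : ∀ i j, rim i j → ∀ l ∈ G, orient (P i) (P j) (P l) = 0 → l = i ∨ l = j
  cycle : ∀ i j, rim i j ↔ ∃ a b, Adj Finset.univ a b ∧ i = q a ∧ j = q b

/-- Seen from a generic inner point, the first axis crosses the rim upwards exactly once. -/
theorem IsRim.sum_crossing {N : ℕ} (hN : 3 ≤ N) {P : ι → Plane} {G : Finset ι} {q : Fin N → ι}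
    {rim : ι → ι → Prop} (h : IsRim P G q rim) {x : Plane} (hx : IsGeneric P x)
    (hin : ∀ i j, rim i j → 0 < orient (P i) (P j) x) :
    ∑ e : ι × ι, indicator rim e.1 e.2 * crossing x (P e.1) (P e.2) = 1 := by
  classical
  have hup : ∀ e : ι × ι, indicator rim e.1 e.2 * crossing x (P e.1) (P e.2) =
      if rim e.1 e.2 ∧ P e.1 1 < x 1 ∧ x 1 < P e.2 1 then 1 else 0 := by
    rintro ⟨i, j⟩
    by_cases hr : rim i j
    · have h1 := hin i j hr
      have h2 : ¬ 0 < orient (P j) (P i) x := by rw [orient_swap]; linarith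
      simp [indicator, crossing, hr, h1, h2]
    · simp [indicator, hr]
  simp only [hup]
  have hpos : ∀ a b, Adj Finset.univ a b → 0 < orient (P (q a)) (P (q b)) x := fun a b hab =>
    hin _ _ ((h.cycle _ _).2 ⟨a, b, hab, rfl, rfl⟩)
  -- As long as the rim stays on one side of the horizontal line through `x` (above for `s = 1`,
  -- below for `s = -1`), the cotangent of the direction from `x` strictly decreases. A closed cycle
  -- therefore cannot stay on one side, which is `hsame`.
  have hmono : ∀ a b, Adj Finset.univ a b → ∀ s : ℝ, (s = 1 ∨ s = -1) →
      0 < s * (P (q a) 1 - x 1) → 0 < s * (P (q b) 1 - x 1) →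
      (P (q b) 0 - x 0) / (P (q b) 1 - x 1) < (P (q a) 0 - x 0) / (P (q a) 1 - x 1) := by
    intro a b hab s hs ha hb
    have h1 := hpos a b hab
    have h2 : orient (P (q a)) (P (q b)) x = (P (q a) 0 - x 0) * (P (q b) 1 - x 1) -
        (P (q b) 0 - x 0) * (P (q a) 1 - x 1) := by unfold orient; ring
    rw [h2] at h1
    rcases hs with rfl | rfl
    · rw [div_lt_div_iff₀ (by linarith) (by linarith)]
      linarith
    · rw [← neg_div_neg_eq, ← neg_div_neg_eq (P (q a) 0 - x 0),
        div_lt_div_iff₀ (by linarith) (by linarith)]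
      linarith
  have hN0 : (Finset.univ : Finset (Fin N)).Nonempty := ⟨⟨0, by omega⟩, Finset.mem_univ _⟩
  have hsame : ∀ s : ℝ, (s = 1 ∨ s = -1) → ¬ ∀ a, 0 < s * (P (q a) 1 - x 1) := by
    intro s hs hall
    obtain ⟨a, -, hmin⟩ := Finset.exists_min_image Finset.univ
      (fun a => (P (q a) 0 - x 0) / (P (q a) 1 - x 1)) hN0
    obtain ⟨b, hb⟩ := exists_next (by omega) a
    have := hmono a b hb s hs (hall a) (hall b)
    have := hmin b (Finset.mem_univ _)
    linarith
  have hexists : ∃ a b, Adj Finset.univ a b ∧ P (q a) 1 < x 1 ∧ x 1 < P (q b) 1 := by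
    by_contra! hc
    have step : ∀ a b, Adj Finset.univ a b → P (q a) 1 < x 1 → P (q b) 1 < x 1 :=
      fun a b hab ha => lt_of_le_of_ne (hc a b hab ha) (hx.1 _)
    have hneg : ∃ a, P (q a) 1 < x 1 := by
      by_contra! hc'
      exact hsame 1 (Or.inl rfl) fun a => by
        have := lt_of_le_of_ne (hc' a) (hx.1 (q a)).symm
        linarith
    obtain ⟨a, ha⟩ := hneg
    have hall : ∀ m : ℕ, ∀ b : Fin N, cyclicKey a b = m → P (q b) 1 < x 1 := by
      intro m
      induction m with
      | zero =>
        intro b hb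
        have : b = a := by
          have := a.isLt
          unfold cyclicKey at hb
          split_ifs at hb
          · exact Fin.ext (by omega)
          · omega
        rwa [this]
      | succ m ih =>
        intro b hb
        obtain ⟨c, hcb⟩ := exists_prev (by omega) b
        refine step c b hcb (ih c ?_)
        have := (adj_univ_iff (by omega)).1 hcb
        have := a.isLt
        have := b.isLt
        have := c.isLt
        unfold cyclicKey at hb ⊢
        split_ifs at hb ⊢ <;> omega
    exact hsame (-1) (Or.inr rfl) fun b => by
      have := hall _ b rfl
      linarith
  obtain ⟨a, b, hab, ha, hb⟩ := hexists
  have hr : rim (q a) (q b) := (h.cycle _ _).2 ⟨a, b, hab, rfl, rfl⟩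
  rw [Finset.sum_eq_single (q a, q b)]
  · simp only [hr, ha, hb, and_self, if_true]
  · rintro ⟨i, j⟩ - hne
    refine if_neg ?_
    rintro ⟨hij, hi, hj⟩
    simp only at hij hi hj
    have n1 := h.nonneg _ _ hr i (h.mem _ _ hij).1
    have n2 := h.nonneg _ _ hr j (h.mem _ _ hij).2
    have n3 := h.nonneg _ _ hij (q a) (h.mem _ _ hr).1
    have n4 := h.nonneg _ _ hij (q b) (h.mem _ _ hr).2
    -- For two upward rim edges, the nonnegative combinations in `e1` and `e2` are negatives of each
    -- other, hence zero. Then both ends of the second edge lie on the line of the first, and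
    -- `eq_zero` identifies the edges.
    have e1 : (P j 1 - x 1) * orient (P (q a)) (P (q b)) (P i) +
        (x 1 - P i 1) * orient (P (q a)) (P (q b)) (P j) =
        orient (P (q a)) (P (q b)) x * (P j 1 - P i 1) -
          orient (P i) (P j) x * (P (q b) 1 - P (q a) 1) := by unfold orient; ring
    have e2 : (P (q b) 1 - x 1) * orient (P i) (P j) (P (q a)) +
        (x 1 - P (q a) 1) * orient (P i) (P j) (P (q b)) =
        - (orient (P (q a)) (P (q b)) x * (P j 1 - P i 1) -
          orient (P i) (P j) x * (P (q b) 1 - P (q a) 1)) := by unfold orient; ring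
    have m1 := mul_nonneg (sub_nonneg.2 hj.le) n1
    have m2 := mul_nonneg (sub_nonneg.2 hi.le) n2
    have m3 := mul_nonneg (sub_nonneg.2 hb.le) n3
    have m4 := mul_nonneg (sub_nonneg.2 ha.le) n4
    have z1 : orient (P (q a)) (P (q b)) (P i) = 0 := by
      have : (P j 1 - x 1) * orient (P (q a)) (P (q b)) (P i) = 0 := by linarith
      exact (mul_eq_zero.1 this).resolve_left (by linarith)
    have z2 : orient (P (q a)) (P (q b)) (P j) = 0 := by
      have : (x 1 - P i 1) * orient (P (q a)) (P (q b)) (P j) = 0 := by linarith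
      exact (mul_eq_zero.1 this).resolve_left (by linarith)
    rcases h.eq_zero _ _ hr i (h.mem _ _ hij).1 z1 with rfl | rfl
    · rcases h.eq_zero _ _ hr j (h.mem _ _ hij).2 z2 with rfl | rfl
      · linarith
      · exact hne rfl
    · linarith
  · simp

variable [DecidableEq ι]

open scoped Classical in
/-- The number of triangles of `S` to the left of the edge from `i` to `j`. -/
noncomputable def sideCount (P : ι → Plane) (S : Finset (Finset ι)) (i j : ι) : ℤ :=
  ∑ k, if 0 < orient (P i) (P j) (P k) ∧ ({i, j, k} : Finset ι) ∈ S then 1 else 0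

/-- A set of labelled triangles in which every oriented edge off the rim has as many triangles on
its left as on its right. -/
structure IsBalanced (P : ι → Plane) (G : Finset ι) (rim : ι → ι → Prop)
    (S : Finset (Finset ι)) : Prop where
  oriented : ∀ D ∈ S, ∃ i j k, 0 < orient (P i) (P j) (P k) ∧ D = {i, j, k}
  subset : ∀ D ∈ S, D ⊆ G
  balance : ∀ i j, sideCount P S i j - sideCount P S j i = indicator rim i j - indicator rim j i

theorem sideCount_nonneg (P : ι → Plane) (S : Finset (Finset ι)) (i j : ι) :
    0 ≤ sideCount P S i j :=
  Finset.sum_nonneg fun k _ => by split_ifs <;> simp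

theorem sideCount_pos {P : ι → Plane} {S : Finset (Finset ι)} {i j : ι} :
    0 < sideCount P S i j ↔ ∃ k, 0 < orient (P i) (P j) (P k) ∧ ({i, j, k} : Finset ι) ∈ S := by
  constructor
  · intro h
    by_contra! hc
    have : sideCount P S i j = 0 := Finset.sum_eq_zero fun k _ => if_neg fun hk => hc k hk.1 hk.2
    omega
  · rintro ⟨k, hk⟩
    refine Finset.sum_pos' (fun k _ => by split_ifs <;> simp) ⟨k, Finset.mem_univ _, ?_⟩
    rw [if_pos hk]; norm_num

end Tiling

/-! ### Balanced triangle systems tile the hull -/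

section Tiling

set_option linter.unusedSectionVars false

variable {ι : Type*} [Fintype ι] [DecidableEq ι] {P : ι → Plane} {G : Finset ι}
  {rim : ι → ι → Prop} {S : Finset (Finset ι)}

/-- Exactly three of the positively oriented labelled triples in `S` contain a generic inner
point, that is, exactly one triangle does. -/
theorem IsBalanced.card_inTriangle {N : ℕ} (hN : 3 ≤ N) {q : Fin N → ι} (hrim : IsRim P G q rim)
    (h : IsBalanced P G rim S) {x : Plane} (hx : IsGeneric P x)
    (hin : ∀ i j, rim i j → 0 < orient (P i) (P j) x) :
    ∃ Q : Finset (ι × ι × ι), Q.card = 3 ∧ ∀ t, t ∈ Q ↔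
      (0 < orient (P t.1) (P t.2.1) (P t.2.2) ∧ ({t.1, t.2.1, t.2.2} : Finset ι) ∈ S) ∧
        InTriangle (P t.1) (P t.2.1) (P t.2.2) x := by
  classical
  set R : Finset (ι × ι × ι) := Finset.univ.filter fun t =>
    0 < orient (P t.1) (P t.2.1) (P t.2.2) ∧ ({t.1, t.2.1, t.2.2} : Finset ι) ∈ S with hR
  refine ⟨R.filter fun t => InTriangle (P t.1) (P t.2.1) (P t.2.2) x, ?_, fun t => by simp [hR]⟩
  -- `R` contains the three rotations of each triangle, so the three edges of a triple contribute
  -- equally; this is why the final count is 3 and not 1.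
  have hrot : ∀ f : ι × ι × ι → ℤ, ∑ t ∈ R, f (t.2.1, t.2.2, t.1) = ∑ t ∈ R, f t := by
    intro f
    refine Finset.sum_bij' (fun t _ => (t.2.1, t.2.2, t.1)) (fun t _ => (t.2.2, t.1, t.2.1))
      ?_ ?_ ?_ ?_ ?_
    · rintro ⟨i, j, k⟩ ht
      simp only [hR, Finset.mem_filter, Finset.mem_univ, true_and] at ht ⊢
      rw [← orient_rotate, ← triple_rotate']
      exact ht
    · rintro ⟨i, j, k⟩ ht
      simp only [hR, Finset.mem_filter, Finset.mem_univ, true_and] at ht ⊢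
      rw [orient_rotate, triple_rotate']
      exact ht
    all_goals intros; rfl
  let κ : ι → ι → ℤ := fun i j => crossing x (P i) (P j)
  have e1 : (((R.filter fun t => InTriangle (P t.1) (P t.2.1) (P t.2.2) x).card : ℕ) : ℤ) =
      ∑ t ∈ R, (κ t.1 t.2.1 + κ t.2.1 t.2.2 + κ t.2.2 t.1) := by
    rw [Finset.card_filter]
    push_cast
    refine Finset.sum_congr rfl fun t ht => ?_
    have ho := (Finset.mem_filter.1 ht).2.1
    have hne : ∀ i j k, 0 < orient (P i) (P j) (P k) → orient (P i) (P j) x ≠ 0 := by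
      intro i j k hijk
      refine hx.2 i j fun he => ?_
      rw [he, orient_rotate, orient_self_left] at hijk
      exact lt_irrefl _ hijk
    refine (crossing_triangle ho (hx.1 _) (hx.1 _) (hx.1 _) (hne _ _ _ ho) ?_ ?_).symm
    · rw [orient_rotate] at ho; exact hne _ _ _ ho
    · rw [← orient_rotate] at ho; exact hne _ _ _ ho
  have e2 : ∑ t ∈ R, (κ t.1 t.2.1 + κ t.2.1 t.2.2 + κ t.2.2 t.1) = 3 * ∑ t ∈ R, κ t.1 t.2.1 := by
    rw [Finset.sum_add_distrib, Finset.sum_add_distrib, hrot (fun t => κ t.1 t.2.1),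
      ← hrot (fun t => κ t.2.2 t.1)]
    ring
  have e3 : ∑ t ∈ R, κ t.1 t.2.1 = ∑ e : ι × ι, sideCount P S e.1 e.2 * κ e.1 e.2 := by
    rw [hR, Finset.sum_filter, ← Finset.univ_product_univ, Finset.sum_product,
      ← Finset.univ_product_univ, Finset.sum_product]
    refine Finset.sum_congr rfl fun i _ => ?_
    rw [Finset.sum_product]
    refine Finset.sum_congr rfl fun j _ => ?_
    rw [sideCount, Finset.sum_mul]
    refine Finset.sum_congr rfl fun k _ => ?_
    split_ifs <;> simp
  have swap : ∀ f : ι → ι → ℤ, ∑ e : ι × ι, f e.1 e.2 * κ e.1 e.2 =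
      - ∑ e : ι × ι, f e.2 e.1 * κ e.1 e.2 := by
    intro f
    rw [← Finset.sum_neg_distrib]
    refine Fintype.sum_equiv (Equiv.prodComm ι ι) _ _ fun e => ?_
    simp only [Equiv.prodComm_apply, Prod.fst_swap, Prod.snd_swap, κ]
    rw [crossing_swap]
    ring
  -- Crossings are antisymmetric in the edge, so only the antisymmetric part of `sideCount` matters,
  -- and by balance it equals that of the rim.
  have e4 : ∑ e : ι × ι, sideCount P S e.1 e.2 * κ e.1 e.2 =
      ∑ e : ι × ι, indicator rim e.1 e.2 * κ e.1 e.2 := by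
    have h1 := swap (sideCount P S)
    have h2 := swap (indicator rim)
    have h3 : ∑ e : ι × ι, (sideCount P S e.1 e.2 - sideCount P S e.2 e.1) * κ e.1 e.2 =
        ∑ e : ι × ι, (indicator rim e.1 e.2 - indicator rim e.2 e.1) * κ e.1 e.2 :=
      Finset.sum_congr rfl fun e _ => by rw [h.balance]
    simp only [sub_mul, Finset.sum_sub_distrib] at h3
    linarith
  have e5 : ∑ e : ι × ι, indicator rim e.1 e.2 * κ e.1 e.2 = 1 := hrim.sum_crossing hN hx hin
  rw [e2, e3, e4, e5] at e1
  exact_mod_cast e1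

theorem IsBalanced.subset_hull (h : IsBalanced P G rim S) {D : Finset ι} (hD : D ∈ S) :
    cellHull P D ⊆ cellHull P G := cellHull_mono (h.subset D hD)

theorem IsRim.nonneg_of_mem_hull {N : ℕ} {q : Fin N → ι} (hrim : IsRim P G q rim) {x : Plane}
    (hx : x ∈ cellHull P G) {i j : ι} (hij : rim i j) : 0 ≤ orient (P i) (P j) x :=
  orient_nonneg_of_mem_cellHull hx (hrim.nonneg i j hij)

theorem IsRim.pos_of_generic {N : ℕ} {q : Fin N → ι} (hrim : IsRim P G q rim) {x : Plane}
    (hx : x ∈ cellHull P G) (hg : IsGeneric P x) {i j : ι} (hij : rim i j) :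
    0 < orient (P i) (P j) x :=
  lt_of_le_of_ne (hrim.nonneg_of_mem_hull hx hij) (hg.2 i j (hrim.ne i j hij)).symm

theorem IsBalanced.exists_mem {N : ℕ} (hN : 3 ≤ N) {q : Fin N → ι}
    (hrim : IsRim P G q rim) (h : IsBalanced P G rim S) {x : Plane} (hx : x ∈ cellHull P G)
    (hg : IsGeneric P x) : ∃ D ∈ S, x ∈ cellHull P D := by
  obtain ⟨Q, hQ, hmem⟩ := h.card_inTriangle hN hrim hg fun i j => hrim.pos_of_generic hx hg
  obtain ⟨⟨i, j, k⟩, ht⟩ := Finset.card_pos.1 (by omega : 0 < Q.card)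
  obtain ⟨⟨h1, h2⟩, h3⟩ := (hmem _).1 ht
  exact ⟨_, h2, intrinsicInterior_subset ((mem_relint_triple h1).2 h3)⟩

/-- Triangles of a balanced system whose interiors meet are equal. -/
theorem IsBalanced.unique {N : ℕ} (hN : 3 ≤ N) {q : Fin N → ι} (hrim : IsRim P G q rim)
    (h : IsBalanced P G rim S) {i j k i' j' k' : ι} (hD : ({i, j, k} : Finset ι) ∈ S)
    (hD' : ({i', j', k'} : Finset ι) ∈ S) (ho : 0 < orient (P i) (P j) (P k))
    (ho' : 0 < orient (P i') (P j') (P k')) {x : Plane} (hx : InTriangle (P i) (P j) (P k) x)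
    (hx' : InTriangle (P i') (P j') (P k') x) :
    ({i, j, k} : Finset ι) = {i', j', k'} := by
  by_contra hne
  obtain ⟨y, ⟨hy, hy'⟩, hg⟩ := exists_isGeneric P
    ((isOpen_inTriangle (P i) (P j) (P k)).inter (isOpen_inTriangle (P i') (P j') (P k')))
    ⟨x, hx, hx'⟩
  have hyG : y ∈ cellHull P G := h.subset_hull hD
    (intrinsicInterior_subset ((mem_relint_triple ho).2 hy))
  obtain ⟨Q, hQ, hmem⟩ := h.card_inTriangle hN hrim hg fun i j => hrim.pos_of_generic hyG hg
  obtain ⟨h1, h2, h3⟩ := ne_of_orient_pos ho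
  have rot : ∀ i j k, (i, j, k) ∈ Q → (j, k, i) ∈ Q := by
    intro i j k ht
    obtain ⟨⟨a1, a2⟩, a3⟩ := (hmem _).1 ht
    refine (hmem _).2 ⟨⟨?_, ?_⟩, ?_⟩
    · simp only at a1 ⊢; rwa [← orient_rotate]
    · simp only at a2 ⊢; rwa [← triple_rotate']
    · exact ⟨a3.2.1, a3.2.2, a3.1⟩
  have m1 : (i, j, k) ∈ Q := (hmem _).2 ⟨⟨ho, hD⟩, hy⟩
  have m2 := rot _ _ _ m1
  have m3 := rot _ _ _ m2
  have m4 : (i', j', k') ∈ Q := (hmem _).2 ⟨⟨ho', hD'⟩, hy'⟩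
  have hsub : ({(i, j, k), (j, k, i), (k, i, j)} : Finset (ι × ι × ι)) ⊆ Q := by
    intro t
    simp only [Finset.mem_insert, Finset.mem_singleton]
    rintro (rfl | rfl | rfl) <;> assumption
  have hc : ({(i, j, k), (j, k, i), (k, i, j)} : Finset (ι × ι × ι)).card = 3 :=
    Finset.card_eq_three.2 ⟨_, _, _, by simp [h1], by simp [h3], by simp [h2], rfl⟩
  have heq := Finset.eq_of_subset_of_card_le hsub (by omega)
  rw [← heq] at m4
  simp only [Finset.mem_insert, Finset.mem_singleton, Prod.mk.injEq] at m4
  rcases m4 with ⟨rfl, rfl, rfl⟩ | ⟨rfl, rfl, rfl⟩ | ⟨rfl, rfl, rfl⟩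
  · exact hne rfl
  · exact hne (triple_rotate' _ _ _)
  · exact hne (triple_rotate' _ _ _).symm

/-- Moving from any point of a triangle towards an inner point one enters the triangle. -/
theorem inTriangle_of_mem {i j k : ι} (ho : 0 < orient (P i) (P j) (P k)) {x c : Plane}
    (hx : x ∈ cellHull P {i, j, k}) (hc : InTriangle (P i) (P j) (P k) c) {t : ℝ} (ht : 0 < t)
    (ht1 : t ≤ 1) : InTriangle (P i) (P j) (P k) (x + t • (c - x)) := by
  obtain ⟨h1, h2, h3⟩ := (mem_cellHull_triple ho).1 hx
  have h4 : 0 ≤ 1 - t := by linarith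
  refine ⟨?_, ?_, ?_⟩ <;> rw [orient_lineMap]
  · have := mul_pos ht hc.1
    have := mul_nonneg h4 h1
    linarith
  · have := mul_pos ht hc.2.1
    have := mul_nonneg h4 h2
    linarith
  · have := mul_pos ht hc.2.2
    have := mul_nonneg h4 h3
    linarith

/-- Moving from `x` towards a generic inner point `c` of `D'` enters the triangle of the system
lying on that side of the edge, which must then be `D'`. If `c` is to the right, the edge cannot be
on the rim, so balance supplies a triangle there. -/
theorem IsBalanced.edge_absorb {N : ℕ} (hN : 3 ≤ N) {q : Fin N → ι} (hrim : IsRim P G q rim)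
    (h : IsBalanced P G rim S) {i j k : ι} (hD : ({i, j, k} : Finset ι) ∈ S)
    (ho : 0 < orient (P i) (P j) (P k)) {D' : Finset ι} (hD' : D' ∈ S) {x : Plane}
    (hx : x ∈ intrinsicInterior ℝ (cellHull P {i, j})) (hx' : x ∈ cellHull P D') :
    {i, j} ⊆ D' := by
  obtain ⟨i', j', k', ho', rfl⟩ := h.oriented D' hD'
  obtain ⟨c, hc, hg⟩ := exists_isGeneric P (isOpen_inTriangle (P i') (P j') (P k'))
    (exists_inTriangle ho')
  have hcG : c ∈ cellHull P G := h.subset_hull hD'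
    (intrinsicInterior_subset ((mem_relint_triple ho').2 hc))
  have hlt : ∀ᶠ t in 𝓝[>] (0 : ℝ), t < 1 :=
    (gt_mem_nhds zero_lt_one).filter_mono nhdsWithin_le_nhds
  have hne : P i ≠ P j := by
    intro he
    rw [he, orient_rotate, orient_self_left] at ho
    exact lt_irrefl _ ho
  have hin : ∀ t : ℝ, 0 < t → t < 1 → InTriangle (P i') (P j') (P k') (x + t • (c - x)) :=
    fun t ht ht1 => inTriangle_of_mem ho' hx' hc ht ht1.le
  rcases lt_or_gt_of_ne (hg.2 i j hne) with hneg | hpos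
  · have hji : 0 < orient (P j) (P i) c := by rw [orient_swap]; linarith
    have hnr : ¬ rim i j := fun hr => by
      have := hrim.nonneg_of_mem_hull hcG hr
      linarith
    have hb := h.balance i j
    have h1 : 0 < sideCount P S i j := sideCount_pos.2 ⟨k, ho, hD⟩
    have h2 : indicator rim i j = 0 := if_neg hnr
    have h3 : 0 ≤ indicator rim j i := by unfold indicator; split_ifs <;> simp
    obtain ⟨l, hl, hlS⟩ := sideCount_pos.1 (by omega : 0 < sideCount P S j i)
    obtain ⟨t, ht, ht1, ht0⟩ := ((eventually_inTriangle hl (by rwa [Finset.pair_comm]) hji).and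
      (hlt.and self_mem_nhdsWithin)).exists
    rw [← h.unique hN hrim hlS hD' hl ho' ht (hin t ht0 ht1)]
    intro v
    simp only [Finset.mem_insert, Finset.mem_singleton]
    tauto
  · obtain ⟨t, ht, ht1, ht0⟩ := ((eventually_inTriangle ho hx hpos).and
      (hlt.and self_mem_nhdsWithin)).exists
    rw [← h.unique hN hrim hD hD' ho ho' ht (hin t ht0 ht1)]
    intro v
    simp only [Finset.mem_insert, Finset.mem_singleton]
    tauto

theorem IsBalanced.triangle_absorb {N : ℕ} (hN : 3 ≤ N) {q : Fin N → ι}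
    (hrim : IsRim P G q rim) (h : IsBalanced P G rim S) {D D' : Finset ι} (hD : D ∈ S)
    (hD' : D' ∈ S) {x : Plane} (hx : x ∈ intrinsicInterior ℝ (cellHull P D))
    (hx' : x ∈ cellHull P D') : D = D' := by
  obtain ⟨i, j, k, ho, rfl⟩ := h.oriented D hD
  obtain ⟨i', j', k', ho', rfl⟩ := h.oriented D' hD'
  obtain ⟨c, hc⟩ := Hyper.exists_inTriangle ho'
  have hcont : Continuous fun t : ℝ => x + t • (c - x) := by fun_prop
  have hev : ∀ᶠ t in 𝓝[>] (0 : ℝ), InTriangle (P i) (P j) (P k) (x + t • (c - x)) := by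
    refine Filter.Eventually.filter_mono nhdsWithin_le_nhds ?_
    refine hcont.continuousAt.eventually ?_
    refine (isOpen_inTriangle (P i) (P j) (P k)).mem_nhds ?_
    simpa using (mem_relint_triple ho).1 hx
  have hlt : ∀ᶠ t in 𝓝[>] (0 : ℝ), t < 1 :=
    (gt_mem_nhds zero_lt_one).filter_mono nhdsWithin_le_nhds
  obtain ⟨t, ht, ht1, ht0⟩ := (hev.and (hlt.and self_mem_nhdsWithin)).exists
  exact h.unique hN hrim hD hD' ho ho' ht (inTriangle_of_mem ho' hx' hc ht0 (le_of_lt ht1))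

theorem oriented_of_edge {D C : Finset ι} (hD : ∃ i j k, 0 < orient (P i) (P j) (P k) ∧
    D = {i, j, k}) (hC : C ⊆ D) (hcard : C.card = 2) :
    ∃ i j k, 0 < orient (P i) (P j) (P k) ∧ D = {i, j, k} ∧ C = {i, j} := by
  obtain ⟨i, j, k, ho, rfl⟩ := hD
  obtain ⟨h1, h2, h3⟩ := ne_of_orient_pos ho
  have hcD : ({i, j, k} : Finset ι).card = 3 := Finset.card_eq_three.2 ⟨_, _, _, h1, h3, h2, rfl⟩
  have hsd : (({i, j, k} : Finset ι) \ C).card = 1 := by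
    rw [Finset.card_sdiff_of_subset hC]; omega
  obtain ⟨l, hl⟩ := Finset.card_eq_one.1 hsd
  have hCe : C = ({i, j, k} : Finset ι).erase l := by
    rw [← Finset.sdiff_singleton_eq_erase, ← hl, Finset.sdiff_sdiff_eq_self hC]
  have hlD : l ∈ ({i, j, k} : Finset ι) := (Finset.mem_sdiff.1 (hl ▸ Finset.mem_singleton_self l)).1
  simp only [Finset.mem_insert, Finset.mem_singleton] at hlD
  rcases hlD with rfl | rfl | rfl
  · refine ⟨j, k, l, by rwa [← orient_rotate], triple_rotate' _ _ _, ?_⟩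
    rw [hCe, Finset.erase_insert]
    simp [h1, h3]
  · refine ⟨k, i, l, by rwa [orient_rotate], (triple_rotate' _ _ _).symm, ?_⟩
    rw [hCe, ← triple_rotate' k i l]
    ext v
    simp only [Finset.mem_erase, Finset.mem_insert, Finset.mem_singleton]
    constructor
    · tauto
    · rintro (rfl | rfl) <;> simp [h1, h2.symm]
  · refine ⟨i, j, l, ho, rfl, ?_⟩
    rw [hCe]
    ext v
    simp only [Finset.mem_erase, Finset.mem_insert, Finset.mem_singleton]
    constructor
    · tauto
    · rintro (rfl | rfl) <;> simp [h2, h3]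

theorem card_of_oriented {D : Finset ι} (hD : ∃ i j k, 0 < orient (P i) (P j) (P k) ∧
    D = {i, j, k}) : D.card = 3 := by
  obtain ⟨i, j, k, ho, rfl⟩ := hD
  obtain ⟨h1, h2, h3⟩ := ne_of_orient_pos ho
  exact Finset.card_eq_three.2 ⟨_, _, _, h1, h3, h2, rfl⟩

theorem IsBalanced.absorb {N : ℕ} (hN : 3 ≤ N) {q : Fin N → ι}
    (hrim : IsRim P G q rim) (h : IsBalanced P G rim S) {C D D' : Finset ι} (hD : D ∈ S)
    (hC : C ⊆ D) (hcard : 2 ≤ C.card) (hD' : D' ∈ S) {x : Plane}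
    (hx : x ∈ intrinsicInterior ℝ (cellHull P C)) (hx' : x ∈ cellHull P D') : C ⊆ D' := by
  have hc3 := card_of_oriented (h.oriented D hD)
  rcases hcard.lt_or_eq with hlt | heq
  · obtain rfl : C = D := Finset.eq_of_subset_of_card_le hC (by omega)
    exact (h.triangle_absorb hN hrim hD hD' hx hx').subset
  · obtain ⟨i, j, k, ho, rfl, rfl⟩ := oriented_of_edge (h.oriented D hD) hC heq.symm
    exact h.edge_absorb hN hrim hD ho hD' hx hx'

/-- The cells of a triangle system: all nonempty sets of vertices of its triangles. -/
def downClosure (S : Finset (Finset ι)) : Set (Finset ι) := {C | C.Nonempty ∧ ∃ D ∈ S, C ⊆ D}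

/-- A balanced system of triangles is a polyhedral subdivision. -/
theorem IsBalanced.isPolyhedralSubdivision {N : ℕ} (hN : 3 ≤ N) {q : Fin N → ι}
    (hrim : IsRim P G q rim) (h : IsBalanced P G rim S)
    (hG : ∃ i ∈ G, ∃ j ∈ G, ∃ k ∈ G, 0 < orient (P i) (P j) (P k))
    (hinj : ∀ D ∈ S, ∀ D' ∈ S, ∀ i ∈ D, ∀ j ∈ D', P i = P j → i = j) :
    IsPolyhedralSubdivision P G (downClosure S) where
  subset := by
    rintro C ⟨-, D, hD, hCD⟩
    exact hCD.trans (h.subset D hD)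
  nonempty := fun C hC => hC.1
  closed := by
    rintro C ⟨-, D, hD, hCD⟩ F ⟨hF, w, hw⟩
    exact ⟨hF, D, hD, fun l hl => hCD ((hw l).1 hl).1⟩
  covers := by
    obtain ⟨i, hi, j, hj, k, hk, ho⟩ := hG
    have hF : IsClosed (⋃ D ∈ S, cellHull P D) :=
      S.finite_toSet.isClosed_biUnion fun D _ => isClosed_cellHull P D
    have h1 : cellHull P G ⊆ ⋃ D ∈ S, cellHull P D := by
      refine cellHull_subset_of_generic hi hj hk ho hF fun x hx hg => ?_
      obtain ⟨D, hD, hxD⟩ := h.exists_mem hN hrim (interior_subset hx) hg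
      exact Set.mem_biUnion hD hxD
    refine h1.trans (Set.iUnion₂_subset fun D hD => ?_)
    have hne : D.Nonempty := by
      rw [← Finset.card_pos, card_of_oriented (h.oriented D hD)]
      norm_num
    exact Set.subset_biUnion_of_mem (u := fun C => cellHull P C)
      (⟨hne, D, hD, subset_rfl⟩ : D ∈ downClosure S)
  disjoint := by
    rintro C ⟨hC, D, hD, hCD⟩ C' ⟨hC', D', hD', hCD'⟩ hne
    rw [Set.disjoint_left]
    intro x hx hx'
    apply hne
    have hxD : x ∈ cellHull P D := cellHull_mono hCD (intrinsicInterior_subset hx)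
    have hxD' : x ∈ cellHull P D' := cellHull_mono hCD' (intrinsicInterior_subset hx')
    -- By absorption, a cell with at least two labels is a face of the other triangle, and faces of
    -- one triangle are separated by `face_unique`. Two single labels need `hinj`, since different
    -- labels may name the same point.
    by_cases h2 : 2 ≤ C.card
    · have := h.absorb hN hrim hD hCD h2 hD' hx hxD'
      obtain ⟨i, j, k, ho, rfl⟩ := h.oriented D' hD'
      exact face_unique ho this hCD' hx hx'
    · by_cases h2' : 2 ≤ C'.card
      · have := h.absorb hN hrim hD' hCD' h2' hD hx' hxD
        obtain ⟨i, j, k, ho, rfl⟩ := h.oriented D hD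
        exact face_unique ho hCD this hx hx'
      · have h1 := Finset.card_pos.2 hC
        have h1' := Finset.card_pos.2 hC'
        obtain ⟨i, rfl⟩ := Finset.card_eq_one.1 (by omega : C.card = 1)
        obtain ⟨j, rfl⟩ := Finset.card_eq_one.1 (by omega : C'.card = 1)
        simp only [cellHull, Finset.coe_singleton, Set.image_singleton, convexHull_singleton,
          intrinsicInterior_singleton, Set.mem_singleton_iff] at hx hx'
        rw [hinj D hD D' hD' i (by simpa using hCD) j (by simpa using hCD') (hx ▸ hx')]

end Tiling

/-! ### Labels and cells of the regular polygon -/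

section Labels

variable {N : ℕ}

/-- In half-angle form the sign is visible: for increasing indices all three half differences lie
strictly between 0 and π. -/
theorem orient_circle (α β γ : ℝ) :
    orient !₂[Real.cos α, Real.sin α] !₂[Real.cos β, Real.sin β] !₂[Real.cos γ, Real.sin γ] =
      4 * Real.sin ((β - α) / 2) * Real.sin ((γ - β) / 2) * Real.sin ((γ - α) / 2) := by
  have h1 : orient !₂[Real.cos α, Real.sin α] !₂[Real.cos β, Real.sin β]
      !₂[Real.cos γ, Real.sin γ] =
      Real.sin (β - α) + Real.sin (γ - β) - Real.sin ((β - α) + (γ - β)) := by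
    rw [show (β - α) + (γ - β) = γ - α by ring]
    simp only [orient, Real.sin_sub, Matrix.cons_val_zero, Matrix.cons_val_one]
    ring
  rw [h1, show γ - α = (β - α) + (γ - β) by ring, add_div]
  generalize hu : (β - α) / 2 = u
  generalize hv : (γ - β) / 2 = v
  rw [show β - α = 2 * u by rw [← hu]; ring, show γ - β = 2 * v by rw [← hv]; ring,
    show 2 * u + 2 * v = 2 * (u + v) by ring, Real.sin_two_mul, Real.sin_two_mul,
    Real.sin_two_mul, Real.sin_add, Real.cos_add]
  have e1 := Real.sin_sq_add_cos_sq u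
  have e2 := Real.sin_sq_add_cos_sq v
  linear_combination (-2 * Real.sin v * Real.cos v) * e1 + (-2 * Real.sin u * Real.cos u) * e2

theorem orient_polygon_pos_of_lt {i j k : Fin N} (h1 : (i : ℕ) < j) (h2 : (j : ℕ) < k) :
    0 < orient (polygon N i) (polygon N j) (polygon N k) := by
  unfold polygon
  rw [orient_circle]
  have hk := k.isLt
  have hN : (0 : ℝ) < N := by exact_mod_cast (by omega : 0 < N)
  have key : ∀ a b : Fin N, (a : ℕ) < b →
      0 < Real.sin ((2 * Real.pi * (b : ℝ) / N - 2 * Real.pi * (a : ℝ) / N) / 2) := by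
    intro a b hab
    have hb := b.isLt
    have e : (2 * Real.pi * (b : ℝ) / N - 2 * Real.pi * (a : ℝ) / N) / 2 =
        Real.pi * (((b : ℝ) - a) / N) := by field_simp
    have hab' : (0 : ℝ) < (b : ℝ) - a := sub_pos.2 (by exact_mod_cast hab)
    have hlt : (b : ℝ) - a < N := by
      have h3 : ((b : ℕ) : ℝ) < N := by exact_mod_cast hb
      have h4 : (0 : ℝ) ≤ ((a : ℕ) : ℝ) := Nat.cast_nonneg _
      linarith
    rw [e]
    apply Real.sin_pos_of_pos_of_lt_pi
    · have := Real.pi_pos; positivity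
    · have : ((b : ℝ) - a) / N < 1 := by rwa [div_lt_one hN]
      have := Real.pi_pos
      nlinarith
  have a1 := key i j h1
  have a2 := key j k h2
  have a3 := key i k (h1.trans h2)
  positivity

theorem orient_polygon_pos {i j k : Fin N} (h : ccw i j k) :
    0 < orient (polygon N i) (polygon N j) (polygon N k) := by
  rcases h with h | h | h
  · exact orient_polygon_pos_of_lt h.1 h.2
  · rw [orient_rotate]; exact orient_polygon_pos_of_lt h.1 h.2
  · rw [← orient_rotate]; exact orient_polygon_pos_of_lt h.1 h.2

theorem orient_polygon_neg {i j k : Fin N} (h : ccw j i k) :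
    orient (polygon N i) (polygon N j) (polygon N k) < 0 := by
  have := orient_polygon_pos h
  rw [orient_swap] at this
  linarith

theorem orient_polygon_pos_iff {i j k : Fin N} :
    0 < orient (polygon N i) (polygon N j) (polygon N k) ↔ ccw i j k := by
  refine ⟨fun h => ?_, orient_polygon_pos⟩
  obtain ⟨h1, h2, h3⟩ := ne_of_orient_pos h
  rcases ccw_or h1 h2 h3 with hc | hc
  · exact hc
  · have := orient_polygon_neg hc.rotate.rotate
    linarith

theorem orient_polygon_ne_zero {i j k : Fin N} (h1 : i ≠ j) (h2 : j ≠ k) (h3 : i ≠ k) :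
    orient (polygon N i) (polygon N j) (polygon N k) ≠ 0 := by
  rcases ccw_or h1 h2 h3 with hc | hc
  · exact (orient_polygon_pos hc).ne'
  · exact (orient_polygon_neg hc.rotate.rotate).ne

theorem polygon_injective (hN : 3 ≤ N) : Function.Injective (polygon N) := by
  intro i j hij
  by_contra hne
  obtain ⟨k, hk⟩ : ∃ k : Fin N, k ∉ ({i, j} : Finset (Fin N)) := by
    by_contra! hc
    have h1 : (Finset.univ : Finset (Fin N)) ⊆ {i, j} := fun k _ => hc k
    have h2 := Finset.card_le_card h1
    have h3 := Finset.card_le_two (a := i) (b := j)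
    simp only [Finset.card_univ, Fintype.card_fin] at h2
    omega
  simp only [Finset.mem_insert, Finset.mem_singleton, not_or] at hk
  refine orient_polygon_ne_zero hne (Ne.symm hk.2) (Ne.symm hk.1) ?_
  rw [hij, orient_rotate, orient_self_left]

/-- The point of the plane with label `B`. -/
noncomputable def labelPoint (N : ℕ) (B : Finset (Fin N)) : Plane := projection (polygon N) (cubeVertex N B)

theorem labelPoint_eq_sum (B : Finset (Fin N)) : labelPoint N B = ∑ i ∈ B, polygon N i := by
  simp [labelPoint, cubeVertex, projection, map_sum]

theorem labelPoint_pair {i j : Fin N} (h : i ≠ j) :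
    labelPoint N {i, j} = polygon N i + polygon N j := by
  rw [labelPoint_eq_sum, Finset.sum_pair h]

theorem orient_add (a x y b c : Plane) :
    orient (a + x) (a + y) (b + c) = orient x y b + orient x y c - orient x y a := by
  simp only [orient, PiLp.add_apply]
  ring

theorem orient_label {a x y b c : Fin N} (hx : a ≠ x) (hy : a ≠ y) (hbc : b ≠ c) :
    orient (labelPoint N {a, x}) (labelPoint N {a, y}) (labelPoint N {b, c}) =
      orient (polygon N x) (polygon N y) (polygon N b) +
        orient (polygon N x) (polygon N y) (polygon N c) -
        orient (polygon N x) (polygon N y) (polygon N a) := by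
  rw [labelPoint_pair hx, labelPoint_pair hy, labelPoint_pair hbc, orient_add]

/-- The labels through `a` are placed as a translate of the polygon by `a`. -/
theorem orient_label_star {a x y z : Fin N} (hx : a ≠ x) (hy : a ≠ y) (hz : a ≠ z) :
    orient (labelPoint N {a, x}) (labelPoint N {a, y}) (labelPoint N {a, z}) =
      orient (polygon N x) (polygon N y) (polygon N z) := by
  rw [orient_label hx hy hz]; ring

/-- The three pair sums are the total minus the omitted vertex, a point reflection of the triangle
`y x a`; point reflections of the plane preserve orientation. -/
theorem orient_label_black {a x y : Fin N} (hx : a ≠ x) (hy : a ≠ y) (hxy : x ≠ y) :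
    orient (labelPoint N {a, x}) (labelPoint N {a, y}) (labelPoint N {x, y}) =
      orient (polygon N a) (polygon N y) (polygon N x) := by
  rw [orient_label hx hy hxy, orient_self_left, orient_self_right, ← orient_rotate,
    orient_swap]
  have := orient_swap (polygon N x) (polygon N y) (polygon N a)
  have := orient_rotate (polygon N y) (polygon N x) (polygon N a)
  have := orient_rotate (polygon N x) (polygon N a) (polygon N y)
  unfold orient at *
  linarith

/-- The labels `a x` with `x` in `s`. -/
def starCell (a : Fin N) (s : Finset (Fin N)) : Finset (Finset (Fin N)) := s.image fun x => {a, x}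

/-- The labels contained in `t`. -/
def blackCell (t : Finset (Fin N)) : Finset (Finset (Fin N)) := t.powersetCard 2

/-- The labels of the second hypersimplex. -/
def labels (N : ℕ) : Finset (Finset (Fin N)) := Finset.powersetCard 2 Finset.univ

theorem mem_labels {B : Finset (Fin N)} : B ∈ labels N ↔ B.card = 2 := by
  simp [labels, Finset.mem_powersetCard]

theorem pair_mem_labels {i j : Fin N} (h : i ≠ j) : ({i, j} : Finset (Fin N)) ∈ labels N :=
  mem_labels.2 (Finset.card_pair h)

theorem pair_left_injective {a x y : Fin N} (hx : a ≠ x) (h : ({a, x} : Finset (Fin N)) = {a, y}) :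
    x = y := by
  have : x ∈ ({a, y} : Finset (Fin N)) := by rw [← h]; simp
  simp only [Finset.mem_insert, Finset.mem_singleton] at this
  exact this.resolve_left hx.symm

theorem mem_starCell {a : Fin N} {s : Finset (Fin N)} {B : Finset (Fin N)} :
    B ∈ starCell a s ↔ ∃ x ∈ s, {a, x} = B := Finset.mem_image

theorem pair_mem_starCell {a x : Fin N} {s : Finset (Fin N)} (hx : x ≠ a) :
    ({a, x} : Finset (Fin N)) ∈ starCell a s ↔ x ∈ s := by
  rw [mem_starCell]
  constructor
  · rintro ⟨y, hy, he⟩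
    rwa [pair_left_injective hx.symm he.symm]
  · exact fun h => ⟨x, h, rfl⟩

theorem mem_blackCell {t B : Finset (Fin N)} : B ∈ blackCell t ↔ B ⊆ t ∧ B.card = 2 :=
  Finset.mem_powersetCard

theorem starCell_triple (a x y z : Fin N) :
    starCell a {x, y, z} = {({a, x} : Finset (Fin N)), {a, y}, {a, z}} := by
  simp [starCell, Finset.image_insert]

theorem blackCell_triple {x y z : Fin N} (hxy : x ≠ y) (hyz : y ≠ z) (hxz : x ≠ z) :
    blackCell {x, y, z} = {({x, y} : Finset (Fin N)), {x, z}, {y, z}} := by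
  symm
  refine Finset.eq_of_subset_of_card_le ?_ ?_
  · intro B
    simp only [Finset.mem_insert, Finset.mem_singleton, mem_blackCell]
    rintro (rfl | rfl | rfl)
    · exact ⟨by intro v; simp; tauto, Finset.card_pair hxy⟩
    · exact ⟨by intro v; simp; tauto, Finset.card_pair hxz⟩
    · exact ⟨by intro v; simp; tauto, Finset.card_pair hyz⟩
  · have h3 : ({x, y, z} : Finset (Fin N)).card = 3 :=
      Finset.card_eq_three.2 ⟨_, _, _, hxy, hxz, hyz, rfl⟩
    rw [blackCell, Finset.card_powersetCard, h3]
    refine ge_of_eq (Finset.card_eq_three.2 ⟨_, _, _, ?_, ?_, ?_, rfl⟩)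
    · exact fun h => hyz (pair_left_injective hxy h)
    · intro h
      have : x ∈ ({y, z} : Finset (Fin N)) := by rw [← h]; simp
      simp [hxy, hxz] at this
    · intro h
      have : x ∈ ({y, z} : Finset (Fin N)) := by rw [← h]; simp
      simp [hxy, hxz] at this

/-- The triangles of the plane that belong to a star system. -/
def cells (B : Finset (Finset (Fin N))) (V : Fin N → Finset (Finset (Fin N))) :
    Finset (Finset (Finset (Fin N))) :=
  B.image blackCell ∪ Finset.univ.biUnion fun a => (V a).image (starCell a)

theorem mem_cells {B : Finset (Finset (Fin N))} {V : Fin N → Finset (Finset (Fin N))}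
    {D : Finset (Finset (Fin N))} :
    D ∈ cells B V ↔ (∃ t ∈ B, blackCell t = D) ∨ ∃ a, ∃ t ∈ V a, starCell a t = D := by
  simp [cells]

/-- The oriented edges of the boundary of the polygon with vertices `a_i + a_{i+1}`. -/
def rim (E F : Finset (Fin N)) : Prop := ∃ a x y, Flank a x y ∧ E = {a, x} ∧ F = {a, y}

theorem Flank.orient_nonneg {a x y : Fin N} (h : Flank a x y) {b : Fin N} (hb : b ≠ a) :
    0 ≤ orient (polygon N x) (polygon N y) (polygon N b) := by
  by_cases hx : b = x
  · subst hx; rw [orient_self_left]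
  · by_cases hy : b = y
    · subst hy; rw [orient_self_right]
    · exact (orient_polygon_pos (h.2 b hb hx hy)).le

theorem Flank.orient_neg {a x y : Fin N} (h : Flank a x y) :
    orient (polygon N x) (polygon N y) (polygon N a) < 0 :=
  orient_polygon_neg h.1.rotate.rotate

theorem Flank.ne {a x y : Fin N} (h : Flank a x y) : a ≠ x ∧ a ≠ y ∧ x ≠ y :=
  ⟨h.1.ne.1.symm, h.1.ne.2.1, h.1.ne.2.2⟩

/-- Conversely to `Flank.orient_nonneg`, an edge with all labels on its left is on the rim. -/
theorem flank_of_nonneg {a x y : Fin N} (hx : a ≠ x) (hy : a ≠ y) (hxy : x ≠ y)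
    (h : ∀ B ∈ labels N, 0 ≤ orient (labelPoint N {a, x}) (labelPoint N {a, y}) (labelPoint N B)) :
    Flank a x y := by
  have h1 := h _ (pair_mem_labels hxy)
  rw [orient_label hx hy hxy, orient_self_left, orient_self_right] at h1
  refine ⟨?_, fun b hba hbx hby => ?_⟩
  · rcases ccw_or hx.symm hy hxy with hc | hc
    · exact hc
    · have := orient_polygon_pos hc
      linarith
  · have h2 := h _ (pair_mem_labels hba.symm)
    rw [orient_label hx hy hba.symm] at h2
    rcases ccw_or hxy hby.symm hbx.symm with hc | hc
    · exact hc
    · have := orient_polygon_neg hc.rotate.rotate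
      linarith

theorem exists_pair_of_mem_labels {B : Finset (Fin N)} (hB : B ∈ labels N) :
    ∃ b c, b ≠ c ∧ B = {b, c} := Finset.card_eq_two.1 (mem_labels.1 hB)

/-- With respect to the line through the two neighbours of `a`, only `a` is on the negative side.
The orientation of the label `b c` is the sum of the values at `b` and `c` minus the value at `a`,
and a label can use `a` at most once. -/
theorem Flank.label_nonneg {a x y : Fin N} (h : Flank a x y) {B : Finset (Fin N)}
    (hB : B ∈ labels N) :
    0 ≤ orient (labelPoint N {a, x}) (labelPoint N {a, y}) (labelPoint N B) := by
  obtain ⟨b, c, hbc, rfl⟩ := exists_pair_of_mem_labels hB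
  rw [orient_label h.ne.1 h.ne.2.1 hbc]
  have h0 := h.orient_neg
  by_cases hb : b = a
  · have := h.orient_nonneg (b := c) (fun hc => hbc (hb.trans hc.symm))
    rw [hb]; linarith
  · have h1 := h.orient_nonneg hb
    by_cases hc : c = a
    · rw [hc]; linarith
    · have := h.orient_nonneg hc
      linarith

theorem Flank.label_eq_zero {a x y : Fin N} (h : Flank a x y) {B : Finset (Fin N)}
    (hB : B ∈ labels N)
    (h0 : orient (labelPoint N {a, x}) (labelPoint N {a, y}) (labelPoint N B) = 0) :
    B = {a, x} ∨ B = {a, y} := by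
  have main : ∀ c, c ≠ a → orient (labelPoint N {a, x}) (labelPoint N {a, y})
      (labelPoint N {a, c}) = 0 → ({a, c} : Finset (Fin N)) = {a, x} ∨
        ({a, c} : Finset (Fin N)) = {a, y} := by
    intro c hc h1
    rw [orient_label_star h.ne.1 h.ne.2.1 hc.symm] at h1
    by_contra! hne
    refine orient_polygon_ne_zero h.ne.2.2 ?_ ?_ h1
    · rintro rfl; exact hne.2 rfl
    · rintro rfl; exact hne.1 rfl
  obtain ⟨b, c, hbc, rfl⟩ := exists_pair_of_mem_labels hB
  by_cases hb : b = a
  · subst hb; exact main c hbc.symm h0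
  · by_cases hc : c = a
    · subst hc
      rw [Finset.pair_comm b c] at h0 ⊢
      exact main b hbc h0
    · rw [orient_label h.ne.1 h.ne.2.1 hbc] at h0
      have h1 := h.orient_nonneg hb
      have h2 := h.orient_nonneg hc
      have h3 := h.orient_neg
      linarith

theorem isRim_rim (hN : 4 ≤ N) :
    ∃ q : Fin N → Finset (Fin N), IsRim (labelPoint N) (labels N) q rim := by
  choose s hs using fun a : Fin N => exists_next (by omega : 2 ≤ N) a
  refine ⟨fun a => {a, s a}, ?_, ?_, ?_, ?_, ?_⟩
  · rintro _ _ ⟨a, x, y, h, rfl, rfl⟩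
    exact ⟨pair_mem_labels h.ne.1, pair_mem_labels h.ne.2.1⟩
  · rintro _ _ ⟨a, x, y, h, rfl, rfl⟩
    rw [labelPoint_pair h.ne.1, labelPoint_pair h.ne.2.1]
    intro he
    exact h.ne.2.2 (polygon_injective (by omega) (add_left_cancel he))
  · rintro _ _ ⟨a, x, y, h, rfl, rfl⟩ l hl
    exact h.label_nonneg hl
  · rintro _ _ ⟨a, x, y, h, rfl, rfl⟩ l hl h0
    exact h.label_eq_zero hl h0
  · intro E F
    constructor
    · rintro ⟨a, x, y, h, rfl, rfl⟩
      have h1 := (flank_iff (by omega)).1 h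
      refine ⟨x, a, h1.1, ?_, ?_⟩
      · rw [(hs x).right_unique h1.1, Finset.pair_comm]
      · rw [(hs a).right_unique h1.2]
    · rintro ⟨c, d, hcd, rfl, rfl⟩
      refine ⟨d, c, s d, (flank_iff (by omega)).2 ⟨hcd, hs d⟩, ?_, rfl⟩
      rw [(hs c).right_unique hcd, Finset.pair_comm]

end Labels

/-! ### Balanced families of cells are star systems -/

section Balance

variable {N : ℕ}

theorem eq_of_mem_pairs {a b x y : Fin N} (hxy : x ≠ y) (h1 : b ∈ ({a, x} : Finset (Fin N)))
    (h2 : b ∈ ({a, y} : Finset (Fin N))) : b = a := by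
  simp only [Finset.mem_insert, Finset.mem_singleton] at h1 h2
  rcases h1 with h | h
  · exact h
  · rcases h2 with h' | h'
    · exact h'
    · exact absurd (h.symm.trans h') hxy

theorem eq_pair_of_mem {B : Finset (Fin N)} {a : Fin N} (hB : B.card = 2) (ha : a ∈ B) :
    ∃ x, a ≠ x ∧ B = {a, x} := by
  obtain ⟨u, v, huv, rfl⟩ := Finset.card_eq_two.1 hB
  simp only [Finset.mem_insert, Finset.mem_singleton] at ha
  rcases ha with rfl | rfl
  · exact ⟨v, huv, rfl⟩
  · exact ⟨u, huv.symm, Finset.pair_comm _ _⟩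

theorem rim_iff {a x y : Fin N} (hxy : x ≠ y) : rim ({a, x} : Finset (Fin N)) {a, y} ↔ Flank a x y := by
  constructor
  · rintro ⟨a', x', y', h, h1, h2⟩
    obtain rfl : a' = a := eq_of_mem_pairs hxy (by rw [h1]; simp) (by rw [h2]; simp)
    rwa [← pair_left_injective h.ne.1 h1.symm, ← pair_left_injective h.ne.2.1 h2.symm]
  · exact fun h => ⟨a, x, y, h, rfl, rfl⟩

theorem indicator_rim {a x y : Fin N} (hxy : x ≠ y) :
    indicator rim ({a, x} : Finset (Fin N)) {a, y} = flank a x y :=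
  by simp only [indicator, flank, rim_iff hxy]

/-- The sets of triangles `B` and `V a` have the shape required of a star system. -/
structure IsShape (B : Finset (Finset (Fin N))) (V : Fin N → Finset (Finset (Fin N))) : Prop where
  card_eq : ∀ t ∈ B, t.card = 3
  star_card_eq : ∀ a, ∀ t ∈ V a, t.card = 3
  notMem : ∀ a, ∀ t ∈ V a, a ∉ t

variable {B : Finset (Finset (Fin N))} {V : Fin N → Finset (Finset (Fin N))}

theorem IsStarSystem.isShape (h : IsStarSystem B V) : IsShape B V :=
  ⟨h.card_eq, h.star_card_eq, h.notMem⟩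

theorem exists_ccw_triple {t : Finset (Fin N)} (ht : t.card = 3) :
    ∃ x y z, ccw x y z ∧ t = {x, y, z} := by
  obtain ⟨v, hv⟩ := Finset.card_pos.1 (by omega : 0 < t.card)
  obtain ⟨x, y, h⟩ := exists_ccw_of_card ht hv
  exact ⟨v, x, y, h⟩

theorem oriented_starCell {a : Fin N} {t : Finset (Fin N)} (ht : t.card = 3) (ha : a ∉ t) :
    ∃ E F K, 0 < orient (labelPoint N E) (labelPoint N F) (labelPoint N K) ∧
      starCell a t = {E, F, K} := by
  obtain ⟨x, y, z, h, rfl⟩ := exists_ccw_triple ht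
  simp only [Finset.mem_insert, Finset.mem_singleton, not_or] at ha
  refine ⟨_, _, _, ?_, starCell_triple a x y z⟩
  rw [orient_label_star ha.1 ha.2.1 ha.2.2]
  exact orient_polygon_pos h

theorem oriented_blackCell {t : Finset (Fin N)} (ht : t.card = 3) :
    ∃ E F K, 0 < orient (labelPoint N E) (labelPoint N F) (labelPoint N K) ∧
      blackCell t = {E, F, K} := by
  obtain ⟨x, y, z, h, rfl⟩ := exists_ccw_triple ht
  obtain ⟨h1, h2, h3⟩ := h.ne
  refine ⟨_, _, _, ?_, (blackCell_triple h1 h2 h3).trans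
    (by rw [Finset.insert_comm] : _ = {({x, z} : Finset (Fin N)), {x, y}, {y, z}})⟩
  rw [Finset.pair_comm y z, orient_label_black h3 h1 h2.symm]
  exact orient_polygon_pos h

theorem IsShape.oriented (h : IsShape B V) {D : Finset (Finset (Fin N))} (hD : D ∈ cells B V) :
    ∃ E F K, 0 < orient (labelPoint N E) (labelPoint N F) (labelPoint N K) ∧ D = {E, F, K} := by
  rcases mem_cells.1 hD with ⟨t, ht, rfl⟩ | ⟨a, t, ht, rfl⟩
  · exact oriented_blackCell (h.card_eq t ht)
  · exact oriented_starCell (h.star_card_eq a t ht) (h.notMem a t ht)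

theorem starCell_subset_labels {a : Fin N} {t : Finset (Fin N)} (ha : a ∉ t) :
    starCell a t ⊆ labels N := by
  intro E hE
  obtain ⟨x, hx, rfl⟩ := mem_starCell.1 hE
  exact pair_mem_labels fun h => ha (h ▸ hx)

theorem blackCell_subset_labels (t : Finset (Fin N)) : blackCell t ⊆ labels N :=
  fun _ hE => mem_labels.2 (mem_blackCell.1 hE).2

theorem IsShape.subset_labels (h : IsShape B V) {D : Finset (Finset (Fin N))}
    (hD : D ∈ cells B V) : D ⊆ labels N := by
  rcases mem_cells.1 hD with ⟨t, ht, rfl⟩ | ⟨a, t, ht, rfl⟩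
  · exact blackCell_subset_labels t
  · exact starCell_subset_labels (h.notMem a t ht)

/-- Any two labels of a cell intersect. -/
theorem IsShape.exists_common (h : IsShape B V) {D : Finset (Finset (Fin N))}
    (hD : D ∈ cells B V) {E F : Finset (Fin N)} (hE : E ∈ D) (hF : F ∈ D) :
    ∃ a, a ∈ E ∧ a ∈ F := by
  rcases mem_cells.1 hD with ⟨t, ht, rfl⟩ | ⟨a, t, ht, rfl⟩
  · rw [mem_blackCell] at hE hF
    by_contra! hc
    have hd : Disjoint E F := Finset.disjoint_left.2 hc
    have h1 := Finset.card_le_card (Finset.union_subset hE.1 hF.1)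
    rw [Finset.card_union_of_disjoint hd, h.card_eq t ht] at h1
    omega
  · obtain ⟨x, hx, rfl⟩ := mem_starCell.1 hE
    obtain ⟨y, hy, rfl⟩ := mem_starCell.1 hF
    exact ⟨a, by simp, by simp⟩

theorem eq_triple_of_mem {t : Finset (Fin N)} {x y z : Fin N} (ht : t.card = 3) (hx : x ∈ t)
    (hy : y ∈ t) (hz : z ∈ t) (hxy : x ≠ y) (hyz : y ≠ z) (hxz : x ≠ z) : t = {x, y, z} := by
  symm
  refine Finset.eq_of_subset_of_card_le ?_ ?_
  · intro v
    simp only [Finset.mem_insert, Finset.mem_singleton]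
    rintro (rfl | rfl | rfl) <;> assumption
  · rw [ht]
    exact ge_of_eq (Finset.card_eq_three.2 ⟨_, _, _, hxy, hxz, hyz, rfl⟩)

/-- The triangles to the left of the edge from the label `a x` to the label `a y`. -/
theorem IsShape.left_iff (h : IsShape B V) {a x y : Fin N} (hx : a ≠ x) (hy : a ≠ y) (hxy : x ≠ y)
    (K : Finset (Fin N)) :
    (0 < orient (labelPoint N {a, x}) (labelPoint N {a, y}) (labelPoint N K) ∧
      ({{a, x}, {a, y}, K} : Finset (Finset (Fin N))) ∈ cells B V) ↔
    (∃ z, K = {a, z} ∧ ccw x y z ∧ ({x, y, z} : Finset (Fin N)) ∈ V a) ∨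
      (K = {x, y} ∧ ccw a y x ∧ ({a, y, x} : Finset (Fin N)) ∈ B) := by
  constructor
  · rintro ⟨ho, hD⟩
    obtain ⟨-, n2, n3⟩ := ne_of_orient_pos ho
    rcases mem_cells.1 hD with ⟨t, ht, he⟩ | ⟨b, t, ht, he⟩
    · right
      have h1 : ({a, x} : Finset (Fin N)) ∈ blackCell t := by rw [he]; simp
      have h2 : ({a, y} : Finset (Fin N)) ∈ blackCell t := by rw [he]; simp
      have h3 : K ∈ blackCell t := by rw [he]; simp
      rw [mem_blackCell, Finset.insert_subset_iff, Finset.singleton_subset_iff] at h1 h2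
      obtain rfl := eq_triple_of_mem (h.card_eq t ht) h1.1.1 h1.1.2 h2.1.2 hx hxy hy
      rw [blackCell_triple hx hxy hy] at h3
      simp only [Finset.mem_insert, Finset.mem_singleton] at h3
      obtain rfl : K = {x, y} := (h3.resolve_left n3.symm).resolve_left n2.symm
      rw [orient_label_black hx hy hxy] at ho
      refine ⟨rfl, orient_polygon_pos_iff.1 ho, ?_⟩
      rwa [Finset.pair_comm y x]
    · left
      have h1 : ({a, x} : Finset (Fin N)) ∈ starCell b t := by rw [he]; simp
      have h2 : ({a, y} : Finset (Fin N)) ∈ starCell b t := by rw [he]; simp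
      have h3 : K ∈ starCell b t := by rw [he]; simp
      obtain ⟨x', hx', e1⟩ := mem_starCell.1 h1
      obtain ⟨y', hy', e2⟩ := mem_starCell.1 h2
      obtain rfl : b = a := eq_of_mem_pairs hxy (by rw [← e1]; simp) (by rw [← e2]; simp)
      rw [pair_mem_starCell hx.symm] at h1
      rw [pair_mem_starCell hy.symm] at h2
      obtain ⟨z, hz, rfl⟩ := mem_starCell.1 h3
      have hbz : b ≠ z := fun e => h.notMem b t ht (e ▸ hz)
      rw [orient_label_star hx hy hbz] at ho
      have hc := orient_polygon_pos_iff.1 ho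
      refine ⟨z, rfl, hc, ?_⟩
      rwa [← eq_triple_of_mem (h.star_card_eq b t ht) h1 h2 hz hc.ne.1 hc.ne.2.1 hc.ne.2.2]
  · rintro (⟨z, rfl, hc, ht⟩ | ⟨rfl, hc, ht⟩)
    · have hz : a ≠ z := fun e => h.notMem a _ ht (by rw [e]; simp)
      rw [orient_label_star hx hy hz, ← starCell_triple]
      exact ⟨orient_polygon_pos hc, mem_cells.2 (Or.inr ⟨a, _, ht, rfl⟩)⟩
    · rw [orient_label_black hx hy hxy, ← blackCell_triple hx hxy hy]
      refine ⟨orient_polygon_pos hc, mem_cells.2 (Or.inl ⟨_, ht, ?_⟩)⟩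
      rw [Finset.pair_comm]

/-- A third label is either `{a, z}`, giving a star triangle at `a`, or `{x, y}`, giving a black
triangle. The latter appears as `a y x`, with the order of `x` and `y` exchanged, by
`orient_label_black`. -/
theorem IsShape.sideCount_cells (h : IsShape B V) {a x y : Fin N} (hx : a ≠ x) (hy : a ≠ y)
    (hxy : x ≠ y) :
    sideCount (labelPoint N) (cells B V) {a, x} {a, y} = leftCount (V a) x y + link B a y x := by
  classical
  have key : ∀ K : Finset (Fin N),
      (if 0 < orient (labelPoint N {a, x}) (labelPoint N {a, y}) (labelPoint N K) ∧
        ({{a, x}, {a, y}, K} : Finset (Finset (Fin N))) ∈ cells B V then (1 : ℤ) else 0) =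
      (∑ z, if K = {a, z} then
        (if ccw x y z ∧ ({x, y, z} : Finset (Fin N)) ∈ V a then 1 else 0) else 0) +
        if K = {x, y} then link B a y x else 0 := by
    intro K
    rw [if_congr (h.left_iff hx hy hxy K) rfl rfl]
    by_cases hK : K = {x, y}
    · have h1 : ∀ z, K ≠ {a, z} := fun z e => by
        have : a ∈ ({x, y} : Finset (Fin N)) := by rw [← hK, e]; simp
        simp [hx, hy] at this
      have h2 : ∀ z, ({x, y} : Finset (Fin N)) ≠ {a, z} := fun z => hK ▸ h1 z
      simp [h2, hK, link]
    · rw [if_neg hK, add_zero]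
      by_cases hex : ∃ z, K = {a, z} ∧ ccw x y z ∧ ({x, y, z} : Finset (Fin N)) ∈ V a
      · obtain ⟨z, rfl, hc, ht⟩ := hex
        rw [if_pos (Or.inl ⟨z, rfl, hc, ht⟩), Finset.sum_eq_single z]
        · simp [hc, ht]
        · intro z' _ hz'
          refine if_neg fun e => hz' ?_
          have hz : a ≠ z := fun e => h.notMem a _ ht (by rw [e]; simp)
          exact (pair_left_injective hz e).symm
        · simp
      · rw [if_neg (by rintro (h1 | h1); exacts [hex h1, hK h1.1])]
        refine (Finset.sum_eq_zero fun z _ => ?_).symm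
        by_cases hz : K = {a, z}
        · rw [if_pos hz, if_neg fun hh => hex ⟨z, hz, hh⟩]
        · rw [if_neg hz]
  unfold sideCount
  rw [Finset.sum_congr rfl fun K _ => key K, Finset.sum_add_distrib, Finset.sum_comm]
  simp [leftCount]

theorem exists_pairs {E F : Finset (Fin N)} (hE : E.card = 2) (hF : F.card = 2) (hne : E ≠ F)
    {a : Fin N} (haE : a ∈ E) (haF : a ∈ F) :
    ∃ x y, a ≠ x ∧ a ≠ y ∧ x ≠ y ∧ E = {a, x} ∧ F = {a, y} := by
  obtain ⟨x, hx, rfl⟩ := eq_pair_of_mem hE haE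
  obtain ⟨y, hy, rfl⟩ := eq_pair_of_mem hF haF
  exact ⟨x, y, hx, hy, fun h => hne (by rw [h]), rfl, rfl⟩

theorem IsShape.sideCount_pos_pairs (h : IsShape B V) {E F : Finset (Fin N)}
    (hp : 0 < sideCount (labelPoint N) (cells B V) E F) :
    ∃ a x y, a ≠ x ∧ a ≠ y ∧ x ≠ y ∧ E = {a, x} ∧ F = {a, y} := by
  obtain ⟨K, ho, hD⟩ := sideCount_pos.1 hp
  have hs := h.subset_labels hD
  obtain ⟨a, h1, h2⟩ := h.exists_common hD (by simp : E ∈ _) (by simp : F ∈ _)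
  exact ⟨a, exists_pairs (mem_labels.1 (hs (by simp))) (mem_labels.1 (hs (by simp)))
    (ne_of_orient_pos ho).1 h1 h2⟩

theorem indicator_pos_pairs {E F : Finset (Fin N)} (hp : indicator rim E F ≠ 0) :
    ∃ a x y, a ≠ x ∧ a ≠ y ∧ x ≠ y ∧ E = {a, x} ∧ F = {a, y} := by
  unfold indicator at hp
  obtain ⟨a, x, y, h, e1, e2⟩ : rim E F := by by_contra hc; simp [hc] at hp
  exact ⟨a, x, y, h.ne.1, h.ne.2.1, h.ne.2.2, e1, e2⟩

/-- Edges between labels with a common element give precisely the star equations; all other pairs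
carry neither triangles nor rim edges, so they impose nothing. -/
theorem IsShape.isBalanced_iff (h : IsShape B V) :
    IsBalanced (labelPoint N) (labels N) rim (cells B V) ↔ IsStarSystem B V := by
  constructor
  · intro hb
    refine ⟨h.card_eq, h.star_card_eq, h.notMem, fun a x y hx hy hxy => ?_⟩
    have := hb.balance {a, x} {a, y}
    rwa [h.sideCount_cells hx hy hxy, h.sideCount_cells hy hx hxy.symm, indicator_rim hxy,
      indicator_rim hxy.symm] at this
  · intro hs
    refine ⟨fun D => h.oriented, fun D => h.subset_labels, fun E F => ?_⟩
    by_cases hEF : ∃ a x y, a ≠ x ∧ a ≠ y ∧ x ≠ y ∧ E = {a, x} ∧ F = {a, y}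
    · obtain ⟨a, x, y, hx, hy, hxy, rfl, rfl⟩ := hEF
      rw [h.sideCount_cells hx hy hxy, h.sideCount_cells hy hx hxy.symm, indicator_rim hxy,
        indicator_rim hxy.symm]
      exact hs.boundary a x y hx hy hxy
    · have hFE : ¬ ∃ a x y, a ≠ x ∧ a ≠ y ∧ x ≠ y ∧ F = {a, x} ∧ E = {a, y} := by
        rintro ⟨a, x, y, hx, hy, hxy, e1, e2⟩
        exact hEF ⟨a, y, x, hy, hx, hxy.symm, e2, e1⟩
      have h1 := sideCount_nonneg (labelPoint N) (cells B V) E F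
      have h2 := sideCount_nonneg (labelPoint N) (cells B V) F E
      have h3 : ¬ 0 < sideCount (labelPoint N) (cells B V) E F :=
        fun hp => hEF (h.sideCount_pos_pairs hp)
      have h4 : ¬ 0 < sideCount (labelPoint N) (cells B V) F E :=
        fun hp => hFE (h.sideCount_pos_pairs hp)
      have h5 : indicator rim E F = 0 := by_contra fun hp => hEF (indicator_pos_pairs hp)
      have h6 : indicator rim F E = 0 := by_contra fun hp => hFE (indicator_pos_pairs hp)
      omega

end Balance

/-! ### Star systems give hypertriangulations -/

section Backward

variable {N : ℕ}

theorem orient_add_orient {a b c d : Plane} (h : a + b = c + d) :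
    orient a b c + orient a b d = 0 := by
  obtain rfl : d = a + b - c := by rw [h]; abel
  simp only [orient, PiLp.sub_apply, PiLp.add_apply]
  ring

variable {B : Finset (Finset (Fin N))} {V : Fin N → Finset (Finset (Fin N))}

theorem IsStarSystem.exists_triangle (hN : 3 ≤ N) (h : IsStarSystem B V)
    {D : Finset (Finset (Fin N))} (hD : D ∈ cells B V) {E : Finset (Fin N)} (hE : E ∈ D) :
    ∃ t ∈ B, E ⊆ t := by
  rcases mem_cells.1 hD with ⟨t, ht, rfl⟩ | ⟨a, t, ht, rfl⟩
  · exact ⟨t, ht, (mem_blackCell.1 hE).1⟩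
  · obtain ⟨x, hx, rfl⟩ := mem_starCell.1 hE
    obtain ⟨-, t', ht', h1, h2⟩ :=
      mem_starSet.1 ((((isStarSystem_iff hN).1 h).2 a).mem_of_mem ht hx)
    exact ⟨t', ht', by simp [Finset.insert_subset_iff, h1, h2]⟩

/-- Distinct labels of cells are distinct points. -/
theorem IsStarSystem.label_injective (hN : 3 ≤ N) (h : IsStarSystem B V)
    {D D' : Finset (Finset (Fin N))} (hD : D ∈ cells B V) (hD' : D' ∈ cells B V)
    {E F : Finset (Fin N)} (hE : E ∈ D) (hF : F ∈ D') (he : labelPoint N E = labelPoint N F) :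
    E = F := by
  by_contra hne
  have hcE := mem_labels.1 (h.isShape.subset_labels hD hE)
  have hcF := mem_labels.1 (h.isShape.subset_labels hD' hF)
  obtain ⟨s, hs, hEs⟩ := h.exists_triangle hN hD hE
  obtain ⟨t, ht, hFt⟩ := h.exists_triangle hN hD' hF
  by_cases hd : ∃ a, a ∈ E ∧ a ∈ F
  · obtain ⟨a, h1, h2⟩ := hd
    obtain ⟨x, y, hx, hy, hxy, rfl, rfl⟩ := exists_pairs hcE hcF hne h1 h2
    rw [labelPoint_pair hx, labelPoint_pair hy] at he
    exact hxy (polygon_injective hN (add_left_cancel he))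
  · push Not at hd
    obtain ⟨i, j, hij, rfl⟩ := Finset.card_eq_two.1 hcE
    obtain ⟨k, l, hkl, rfl⟩ := Finset.card_eq_two.1 hcF
    have hik : k ≠ i ∧ l ≠ i := by
      have := hd i (by simp)
      simp only [Finset.mem_insert, Finset.mem_singleton, not_or] at this
      exact ⟨Ne.symm this.1, Ne.symm this.2⟩
    have hjk : k ≠ j ∧ l ≠ j := by
      have := hd j (by simp)
      simp only [Finset.mem_insert, Finset.mem_singleton, not_or] at this
      exact ⟨Ne.symm this.1, Ne.symm this.2⟩
    rw [labelPoint_pair hij, labelPoint_pair hkl] at he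
    -- If two disjoint pairs have equal sums, `k` and `l` are on opposite sides of the line `i j`,
    -- so the two edges cross, although both belong to triangles of the noncrossing family `B`.
    have h0 := orient_add_orient he
    have hi : i ∈ s := hEs (by simp)
    have hj : j ∈ s := hEs (by simp)
    have hk : k ∈ t := hFt (by simp)
    have hl : l ∈ t := hFt (by simp)
    have hcard : 2 ≤ (Finset.univ : Finset (Fin N)).card := by simp; omega
    have hB := h.isTri hN
    rcases ccw_or hij hjk.1.symm hik.1.symm with c1 | c1 <;>
      rcases ccw_or hij hjk.2.symm hik.2.symm with c2 | c2
    · have := orient_polygon_pos c1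
      have := orient_polygon_pos c2
      linarith
    · exact hB.noncrossing_ccw hcard hs ht hi hj hk hl c1.rotate.rotate c2
    · exact hB.noncrossing_ccw hcard hs ht hi hj hl hk c2.rotate.rotate c1
    · have := orient_polygon_neg c1.rotate.rotate
      have := orient_polygon_neg c2.rotate.rotate
      linarith

theorem exists_functional (c : Fin N → ℝ) :
    ∃ w : (Fin N → ℝ) →ₗ[ℝ] ℝ, ∀ E, w (cubeVertex N E) = ∑ i ∈ E, c i := by
  refine ⟨Fintype.linearCombination ℝ c, fun E => ?_⟩
  simp [cubeVertex, map_sum]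

theorem isFaceOf_labels {C : Finset (Finset (Fin N))} (hC : C.Nonempty) (hsub : C ⊆ labels N)
    (c : Fin N → ℝ) (m : ℝ) (hm : ∀ i j, i ≠ j → m ≤ c i + c j)
    (heq : ∀ i j, i ≠ j → (c i + c j = m ↔ ({i, j} : Finset (Fin N)) ∈ C)) :
    IsFaceOf (cubeVertex N) C (labels N) := by
  obtain ⟨w, hw⟩ := exists_functional c
  have hlow : ∀ E ∈ labels N, m ≤ w (cubeVertex N E) := by
    intro E hE
    obtain ⟨i, j, hij, rfl⟩ := exists_pair_of_mem_labels hE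
    rw [hw, Finset.sum_pair hij]
    exact hm i j hij
  have hmem : ∀ E ∈ labels N, (w (cubeVertex N E) = m ↔ E ∈ C) := by
    intro E hE
    obtain ⟨i, j, hij, rfl⟩ := exists_pair_of_mem_labels hE
    rw [hw, Finset.sum_pair hij]
    exact heq i j hij
  obtain ⟨E₀, hE₀⟩ := hC
  refine ⟨⟨E₀, hE₀⟩, w, fun E => ⟨fun hE => ⟨hsub hE, fun F hF => ?_⟩, fun hE => ?_⟩⟩
  · rw [(hmem E (hsub hE)).2 hE]
    exact hlow F hF
  · rw [← hmem E hE.1]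
    refine le_antisymm ?_ (hlow E hE.1)
    rw [← (hmem E₀ (hsub hE₀)).2 hE₀]
    exact hE.2 E₀ (hsub hE₀)

theorem isFaceOf_starCell {a : Fin N} {s : Finset (Fin N)} (hs : s.Nonempty) (ha : a ∉ s) :
    IsFaceOf (cubeVertex N) (starCell a s) (labels N) := by
  -- The weights -2 at `a`, -1 on `s` and 0 elsewhere give the minimum -3 exactly on pairs joining
  -- `a` to `s`; two elements of `s` reach only -2.
  refine isFaceOf_labels (hs.image _) (starCell_subset_labels ha)
    (fun i => if i = a then -2 else if i ∈ s then -1 else 0) (-3) ?_ ?_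
  · intro i j hij
    by_cases h1 : i = a
    · have : j ≠ a := fun h => hij (h1.trans h.symm)
      simp only [h1, this, if_true, if_false]
      split_ifs <;> norm_num
    · by_cases h2 : j = a <;> simp only [h1, h2, if_true, if_false] <;> split_ifs <;> norm_num
  · intro i j hij
    by_cases h1 : i = a
    · subst h1
      rw [pair_mem_starCell hij.symm]
      by_cases h3 : j ∈ s <;> simp [hij.symm, h3] <;> norm_num
    · by_cases h2 : j = a
      · subst h2
        rw [Finset.pair_comm, pair_mem_starCell hij]
        by_cases h3 : i ∈ s <;> simp [hij, h3] <;> norm_num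
      · have hn : ({i, j} : Finset (Fin N)) ∉ starCell a s := by
          intro hc
          obtain ⟨x, -, he⟩ := mem_starCell.1 hc
          have : a ∈ ({i, j} : Finset (Fin N)) := by rw [← he]; simp
          simp [Ne.symm h1, Ne.symm h2] at this
        simp only [h1, h2, hn, if_false, iff_false]
        split_ifs <;> norm_num

theorem isFaceOf_blackCell {t : Finset (Fin N)} (ht : t.card = 3) :
    IsFaceOf (cubeVertex N) (blackCell t) (labels N) := by
  refine isFaceOf_labels ?_ (blackCell_subset_labels t) (fun i => if i ∈ t then -1 else 0) (-2) ?_ ?_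
  · rw [blackCell, Finset.powersetCard_nonempty]; omega
  · intro i j _
    split_ifs <;> norm_num
  · intro i j hij
    rw [mem_blackCell, Finset.card_pair hij, Finset.insert_subset_iff, Finset.singleton_subset_iff]
    by_cases h1 : i ∈ t <;> by_cases h2 : j ∈ t <;> simp [h1, h2] <;> norm_num

theorem exists_of_subset_starCell {a : Fin N} {s : Finset (Fin N)} {C : Finset (Finset (Fin N))}
    (hC : C ⊆ starCell a s) : ∃ s' ⊆ s, C = starCell a s' := by
  refine ⟨s.filter fun x => {a, x} ∈ C, Finset.filter_subset _ _, ?_⟩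
  ext E
  simp only [mem_starCell, Finset.mem_filter]
  constructor
  · intro hE
    obtain ⟨x, hx, rfl⟩ := mem_starCell.1 (hC hE)
    exact ⟨x, ⟨hx, hE⟩, rfl⟩
  · rintro ⟨x, ⟨-, h⟩, rfl⟩
    exact h

/-- A proper part of a black cell omits a pair, and the other two pairs share the vertex opposite to
it. So edges and vertices of black cells are also faces of star type. -/
theorem exists_of_subset_blackCell {t : Finset (Fin N)} (ht : t.card = 3)
    {C : Finset (Finset (Fin N))} (hC : C ⊆ blackCell t) (hne : C ≠ blackCell t) :
    ∃ a s, a ∉ s ∧ C ⊆ starCell a s := by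
  obtain ⟨E, hE, hEC⟩ : ∃ E ∈ blackCell t, E ∉ C := by
    by_contra! hc
    exact hne (Finset.Subset.antisymm hC hc)
  rw [mem_blackCell] at hE
  obtain ⟨x, hx⟩ : ∃ x ∈ t, x ∉ E := by
    by_contra! hc
    have := Finset.card_le_card (show t ⊆ E from hc)
    omega
  refine ⟨x, t.erase x, by simp, fun F hF => ?_⟩
  have hFt := mem_blackCell.1 (hC hF)
  have hxF : x ∈ F := by
    by_contra hxF
    have h1 : F ⊆ t.erase x := fun y hy =>
      Finset.mem_erase.2 ⟨fun e => hxF (e ▸ hy), hFt.1 hy⟩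
    have h2 : E ⊆ t.erase x := fun y hy =>
      Finset.mem_erase.2 ⟨fun e => hx.2 (e ▸ hy), hE.1 hy⟩
    have h3 : (t.erase x).card = 2 := by rw [Finset.card_erase_of_mem hx.1, ht]
    have e1 := Finset.eq_of_subset_of_card_le h1 (by omega)
    have e2 := Finset.eq_of_subset_of_card_le h2 (by omega)
    exact hEC (by rw [e2, ← e1]; exact hF)
  obtain ⟨y, hy, rfl⟩ := eq_pair_of_mem hFt.2 hxF
  exact (pair_mem_starCell hy.symm).2 (Finset.mem_erase.2 ⟨hy.symm, hFt.1 (by simp)⟩)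

theorem isFaceOf_of_subset_starCell {a : Fin N} {s : Finset (Fin N)} (ha : a ∉ s)
    {C : Finset (Finset (Fin N))} (hC : C ⊆ starCell a s) (hne : C.Nonempty) :
    IsFaceOf (cubeVertex N) C (labels N) := by
  obtain ⟨s', hs', rfl⟩ := exists_of_subset_starCell hC
  exact isFaceOf_starCell (Finset.image_nonempty.1 hne) fun h => ha (hs' h)

theorem IsShape.isFaceOf (h : IsShape B V) {C : Finset (Finset (Fin N))}
    (hC : C ∈ downClosure (cells B V)) : IsFaceOf (cubeVertex N) C (labels N) := by
  obtain ⟨hne, D, hD, hCD⟩ := hC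
  rcases mem_cells.1 hD with ⟨t, ht, rfl⟩ | ⟨a, t, ht, rfl⟩
  · by_cases he : C = blackCell t
    · rw [he]; exact isFaceOf_blackCell (h.card_eq t ht)
    · obtain ⟨a, s, ha, hs⟩ := exists_of_subset_blackCell (h.card_eq t ht) hCD he
      exact isFaceOf_of_subset_starCell ha hs hne
  · exact isFaceOf_of_subset_starCell (h.notMem a t ht) hCD hne

/-- A linear map that sends three points to the vertices of a triangle is injective on the plane
spanned by them. -/
theorem finrank_vectorSpan_of_orient {ι W : Type*} [DecidableEq ι] [AddCommGroup W] [Module ℝ W]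
    (v : ι → W) (π : W →ₗ[ℝ] Plane) {i j k : ι} (ho : 0 < orient (π (v i)) (π (v j)) (π (v k)))
    {C : Finset ι} (hC : C ⊆ {i, j, k}) :
    Module.finrank ℝ (vectorSpan ℝ (v '' (C : Set ι))) =
      Module.finrank ℝ (vectorSpan ℝ ((fun i => π (v i)) '' (C : Set ι))) := by
  have himg : (fun i => π (v i)) '' (C : Set ι) = π.toAffineMap '' (v '' (C : Set ι)) := by
    rw [Set.image_image]; rfl
  have hmap : vectorSpan ℝ ((fun i => π (v i)) '' (C : Set ι)) =
      (vectorSpan ℝ (v '' (C : Set ι))).map π := by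
    rw [himg, ← AffineMap.map_vectorSpan]; rfl
  have hle : vectorSpan ℝ (v '' (C : Set ι)) ≤
      Submodule.span ℝ {v j - v i, v k - v i} := by
    refine (vectorSpan_mono ℝ (Set.image_mono (Finset.coe_subset.2 hC))).trans ?_
    rw [vectorSpan_eq_span_vsub_set_right ℝ (p := v i) (by simp), Submodule.span_le]
    rintro _ ⟨_, ⟨l, hl, rfl⟩, rfl⟩
    simp only [Finset.coe_insert, Finset.coe_singleton, Set.mem_insert_iff,
      Set.mem_singleton_iff] at hl
    rcases hl with rfl | rfl | rfl
    · simp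
    · exact Submodule.subset_span (by simp)
    · exact Submodule.subset_span (by simp)
  rw [hmap, ← LinearMap.range_domRestrict]
  refine (LinearMap.finrank_range_of_inj ?_).symm
  rw [← LinearMap.ker_eq_bot, LinearMap.ker_eq_bot']
  rintro ⟨u, hu⟩ h0
  obtain ⟨s, t, rfl⟩ := Submodule.mem_span_pair.1 (hle hu)
  simp only [LinearMap.domRestrict_apply, map_add, map_smul, map_sub] at h0
  have e0 := congrArg (fun p : Plane => p 0) h0
  have e1 := congrArg (fun p : Plane => p 1) h0
  simp only [PiLp.add_apply, PiLp.smul_apply, PiLp.sub_apply, smul_eq_mul, PiLp.zero_apply]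
    at e0 e1
  have hs : s * orient (π (v i)) (π (v j)) (π (v k)) = 0 := by
    unfold orient
    linear_combination (π (v k) 1 - π (v i) 1) * e0 - (π (v k) 0 - π (v i) 0) * e1
  have ht : t * orient (π (v i)) (π (v j)) (π (v k)) = 0 := by
    unfold orient
    linear_combination (π (v j) 0 - π (v i) 0) * e1 - (π (v j) 1 - π (v i) 1) * e0
  have hs0 := (mul_eq_zero.1 hs).resolve_right ho.ne'
  have ht0 := (mul_eq_zero.1 ht).resolve_right ho.ne'
  simp [hs0, ht0]

theorem exists_orient_labels (hN : 3 ≤ N) : ∃ E ∈ labels N, ∃ F ∈ labels N, ∃ K ∈ labels N,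
    0 < orient (labelPoint N E) (labelPoint N F) (labelPoint N K) := by
  obtain ⟨t, -, ht⟩ := Finset.exists_subset_card_eq (s := (Finset.univ : Finset (Fin N))) (n := 3)
    (by simpa using hN)
  obtain ⟨E, F, K, ho, he⟩ := oriented_blackCell ht
  have hs := blackCell_subset_labels t
  rw [he] at hs
  exact ⟨E, hs (by simp), F, hs (by simp), K, hs (by simp), ho⟩

theorem IsStarSystem.isHypertriangulation (hN : 4 ≤ N) (h : IsStarSystem B V) :
    IsHypertriangulation (polygon N) 2 (downClosure (cells B V)) := by
  obtain ⟨q, hrim⟩ := isRim_rim hN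
  refine ⟨⟨?_, fun C hC => h.isShape.isFaceOf hC⟩, ?_⟩
  · exact (h.isShape.isBalanced_iff.2 h).isPolyhedralSubdivision (by omega) hrim
      (exists_orient_labels (by omega)) fun D hD D' hD' E hE F hF he =>
        h.label_injective (by omega) hD hD' hE hF he
  · rintro C ⟨-, D, hD, hCD⟩
    obtain ⟨E, F, K, ho, rfl⟩ := h.isShape.oriented hD
    exact finrank_vectorSpan_of_orient (cubeVertex N) (projection (polygon N)) ho hCD

end Backward

/-! ### Polyhedral subdivisions into triangles are balanced -/

section Local

set_option linter.unusedSectionVars false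

variable {ι : Type*} [DecidableEq ι] {P : ι → Plane} {G : Finset ι}
  {S : Set (Finset ι)} {T : Finset (Finset ι)}

/-- A polyhedral subdivision whose cells have at most three labels, and whose cells with three
labels are the triangles in `T`. -/
structure IsTriangular (P : ι → Plane) (G : Finset ι) (S : Set (Finset ι))
    (T : Finset (Finset ι)) : Prop where
  subdivision : IsPolyhedralSubdivision P G S
  mem_iff : ∀ D, D ∈ T ↔ D ∈ S ∧ D.card = 3
  card_le : ∀ C ∈ S, C.card ≤ 3
  oriented : ∀ D ∈ T, ∃ i j k, 0 < orient (P i) (P j) (P k) ∧ D = {i, j, k}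
  ne : ∀ i j, i ≠ j → ({i, j} : Finset ι) ∈ S → P i ≠ P j

theorem IsTriangular.eq_of_relint (h : IsTriangular P G S T) {C D : Finset ι} (hC : C ∈ S)
    (hD : D ∈ S) {x : Plane} (hx : x ∈ intrinsicInterior ℝ (cellHull P C))
    (hx' : x ∈ intrinsicInterior ℝ (cellHull P D)) : C = D := by
  by_contra hne
  exact Set.disjoint_left.1 (h.subdivision.disjoint C hC D hD hne) hx hx'

theorem IsTriangular.mem_of_subset (h : IsTriangular P G S T) {C D : Finset ι} (hD : D ∈ T)
    (hC : C.Nonempty) (hCD : C ⊆ D) : C ∈ S := by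
  obtain ⟨i, j, k, ho, rfl⟩ := h.oriented D hD
  exact h.subdivision.closed _ ((h.mem_iff _).1 hD).1 C (isFaceOf_triple ho hC hCD)

theorem orient_eq_zero_of_mem {i j : ι} {x : Plane} (hx : x ∈ cellHull P {i, j}) :
    orient (P i) (P j) x = 0 := by
  have e1 : 0 ≤ orient (P i) (P j) x := orient_nonneg_of_mem_cellHull hx fun v hv => by
    simp only [Finset.mem_insert, Finset.mem_singleton] at hv
    rcases hv with rfl | rfl
    · rw [orient_self_left]
    · rw [orient_self_right]
  have e2 : 0 ≤ orient (P j) (P i) x := orient_nonneg_of_mem_cellHull hx fun v hv => by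
    simp only [Finset.mem_insert, Finset.mem_singleton] at hv
    rcases hv with rfl | rfl
    · rw [orient_self_right]
    · rw [orient_self_left]
  rw [orient_swap] at e2
  linarith

/-- Cells with one or two labels contain no generic point, so triangles cover the generic points;
their union is closed. -/
theorem IsTriangular.covers [Finite ι] (h : IsTriangular P G S T)
    (hG : ∃ i ∈ G, ∃ j ∈ G, ∃ k ∈ G, 0 < orient (P i) (P j) (P k)) {x : Plane}
    (hx : x ∈ cellHull P G) : ∃ D ∈ T, x ∈ cellHull P D := by
  obtain ⟨i, hi, j, hj, k, hk, ho⟩ := hG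
  have hF : IsClosed (⋃ D ∈ T, cellHull P D) :=
    T.finite_toSet.isClosed_biUnion fun D _ => isClosed_cellHull P D
  suffices hsub : cellHull P G ⊆ ⋃ D ∈ T, cellHull P D by simpa using hsub hx
  refine cellHull_subset_of_generic hi hj hk ho hF fun y hy hg => ?_
  obtain ⟨C, hC, hyC⟩ : ∃ C ∈ S, y ∈ cellHull P C := by
    simpa using h.subdivision.covers (interior_subset hy)
  refine Set.mem_biUnion ((h.mem_iff C).2 ⟨hC, ?_⟩) hyC
  by_contra h3
  have h1 := h.card_le C hC
  have h2 := Finset.card_pos.2 (h.subdivision.nonempty C hC)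
  rcases (by omega : C.card = 1 ∨ C.card = 2) with hc | hc
  · obtain ⟨l, rfl⟩ := Finset.card_eq_one.1 hc
    simp only [cellHull, Finset.coe_singleton, Set.image_singleton, convexHull_singleton,
      Set.mem_singleton_iff] at hyC
    exact hg.1 l (by rw [hyC])
  · obtain ⟨l, m, hlm, rfl⟩ := Finset.card_eq_two.1 hc
    exact hg.2 l m (h.ne l m hlm hC) (orient_eq_zero_of_mem hyC)

theorem exists_mem_relint {C : Finset ι} (hC : C.Nonempty) :
    ∃ x, x ∈ intrinsicInterior ℝ (cellHull P C) :=
  Set.Nonempty.intrinsicInterior (convex_cellHull P C)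
    ⟨_, mem_cellHull_self hC.choose_spec⟩

/-- A cell of a triangular subdivision whose relative interior meets a triangle is a face of it. -/
theorem IsTriangular.subset_of_mem (h : IsTriangular P G S T) {C D : Finset ι} (hC : C ∈ S)
    (hD : D ∈ T) {x : Plane} (hx : x ∈ intrinsicInterior ℝ (cellHull P C))
    (hxD : x ∈ cellHull P D) : C ⊆ D := by
  obtain ⟨C', hC'D, hne, hx'⟩ := exists_support hxD
  rwa [h.eq_of_relint hC (h.mem_of_subset hD hne hC'D) hx hx']

/-- The subdivision is determined by its triangles: each cell has a relative interior point in some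
triangle, and is therefore a face of it. -/
theorem IsTriangular.eq_downClosure [Finite ι] (h : IsTriangular P G S T)
    (hG : ∃ i ∈ G, ∃ j ∈ G, ∃ k ∈ G, 0 < orient (P i) (P j) (P k)) : S = downClosure T := by
  ext C
  constructor
  · intro hC
    have hne := h.subdivision.nonempty C hC
    obtain ⟨x, hx⟩ := exists_mem_relint (P := P) hne
    obtain ⟨D, hD, hxD⟩ := h.covers hG
      (cellHull_mono (h.subdivision.subset C hC) (intrinsicInterior_subset hx))
    exact ⟨hne, D, hD, h.subset_of_mem hC hD hx hxD⟩
  · rintro ⟨hne, D, hD, hCD⟩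
    exact h.mem_of_subset hD hne hCD

/-- Two triangles on the left of one edge both contain the points just to the left of an inner point
of that edge. -/
theorem IsTriangular.left_unique (h : IsTriangular P G S T) {i j k k' : ι}
    (hD : ({i, j, k} : Finset ι) ∈ T) (hD' : ({i, j, k'} : Finset ι) ∈ T)
    (ho : 0 < orient (P i) (P j) (P k)) (ho' : 0 < orient (P i) (P j) (P k')) : k = k' := by
  obtain ⟨x, hx⟩ := exists_mem_relint (P := P) (Finset.insert_nonempty i {j})
  obtain ⟨t, h1, h2⟩ :=
    ((eventually_inTriangle ho hx ho).and (eventually_inTriangle ho' hx ho)).exists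
  have he := h.eq_of_relint ((h.mem_iff _).1 hD).1 ((h.mem_iff _).1 hD').1
    ((mem_relint_triple ho).2 h1) ((mem_relint_triple ho').2 h2)
  have hk : k ∈ ({i, j, k'} : Finset ι) := by rw [← he]; simp
  obtain ⟨-, n2, n3⟩ := ne_of_orient_pos ho
  simp only [Finset.mem_insert, Finset.mem_singleton] at hk
  exact (hk.resolve_left n3.symm).resolve_left n2.symm

theorem IsTriangular.exists_left [Fintype ι] (h : IsTriangular P G S T)
    (hG : ∃ i ∈ G, ∃ j ∈ G, ∃ k ∈ G, 0 < orient (P i) (P j) (P k)) {i j l : ι} (hij : i ≠ j)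
    (hS : ({i, j} : Finset ι) ∈ S) (hl : l ∈ G) (ho : 0 < orient (P i) (P j) (P l)) :
    ∃ k, 0 < orient (P i) (P j) (P k) ∧ ({i, j, k} : Finset ι) ∈ T := by
  obtain ⟨x, hx⟩ := exists_mem_relint (P := P) (Finset.insert_nonempty i {j})
  have hxe := intrinsicInterior_subset hx
  have hxG := cellHull_mono (h.subdivision.subset _ hS) hxe
  have hcover : ∀ᶠ t in 𝓝[>] (0 : ℝ), ∃ D ∈ T, x + t • (P l - x) ∈ cellHull P D := by
    filter_upwards [Ioo_mem_nhdsGT (zero_lt_one (α := ℝ))] with t ht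
    exact h.covers hG ((convex_cellHull P G).add_smul_sub_mem hxG (mem_cellHull_self hl)
      ⟨ht.1.le, ht.2.le⟩)
  -- Among finitely many triangles, one contains points of the path arbitrarily close to `x`. Being
  -- closed it contains `x`, hence has the edge as a face, and those path points force it to lie on
  -- the left.
  obtain ⟨D, hD, hfreq⟩ : ∃ D ∈ T, ∃ᶠ t in 𝓝[>] (0 : ℝ), x + t • (P l - x) ∈ cellHull P D := by
    by_contra! hc
    have h1 : ∀ᶠ t in 𝓝[>] (0 : ℝ), ∀ D ∈ T, x + t • (P l - x) ∉ cellHull P D :=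
      (Filter.eventually_all_finset T).2 fun D hD => hc D hD
    obtain ⟨t, ⟨D, hD, h2⟩, h3⟩ := (hcover.and h1).exists
    exact h3 D hD h2
  have hlim : Tendsto (fun t : ℝ => x + t • (P l - x)) (𝓝[>] 0) (𝓝 x) := by
    have hcont : Continuous fun t : ℝ => x + t • (P l - x) := by fun_prop
    have := hcont.tendsto 0
    simp only [zero_smul, add_zero] at this
    exact this.mono_left nhdsWithin_le_nhds
  have hxD : x ∈ cellHull P D := (isClosed_cellHull P D).mem_of_frequently_of_tendsto hfreq hlim
  have hsub := h.subset_of_mem hS hD hx hxD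
  obtain ⟨i', j', k, ho', rfl, he⟩ :=
    oriented_of_edge (h.oriented D hD) hsub (Finset.card_pair hij)
  have hi : i ∈ ({i', j'} : Finset ι) := by rw [← he]; simp
  have hj : j ∈ ({i', j'} : Finset ι) := by rw [← he]; simp
  simp only [Finset.mem_insert, Finset.mem_singleton] at hi hj
  rcases hi with rfl | rfl
  · obtain rfl := hj.resolve_left hij.symm
    exact ⟨k, ho', hD⟩
  · obtain rfl := hj.resolve_right hij.symm
    exfalso
    obtain ⟨t, h1, h2⟩ := (hfreq.and_eventually self_mem_nhdsWithin).exists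
    have h3 := ((mem_cellHull_triple ho').1 h1).1
    rw [orient_swap, orient_lineMap, orient_eq_zero_of_mem hxe] at h3
    have := mul_pos (Set.mem_Ioi.1 h2) ho
    linarith

variable {N : ℕ} {q : Fin N → ι} {rim : ι → ι → Prop}

/-- The cell containing an inner point `x` of the rim edge in its relative interior lies on the
supporting line, so its labels are among `i`, `j`. It is not a single label because `x` is strictly
between the two distinct ends. -/
theorem IsTriangular.rim_mem [Finite ι] (h : IsTriangular P G S T)
    (hG : ∃ i ∈ G, ∃ j ∈ G, ∃ k ∈ G, 0 < orient (P i) (P j) (P k)) (hrim : IsRim P G q rim)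
    {i j : ι} (hij : rim i j) : ({i, j} : Finset ι) ∈ S := by
  have hne : i ≠ j := fun e => hrim.ne i j hij (by rw [e])
  obtain ⟨x, hx⟩ := exists_mem_relint (P := P) (Finset.insert_nonempty i {j})
  have hxe := intrinsicInterior_subset hx
  have hsub : ({i, j} : Finset ι) ⊆ G := by
    simp [Finset.insert_subset_iff, hrim.mem i j hij]
  obtain ⟨D, hD, hxD⟩ := h.covers hG (cellHull_mono hsub hxe)
  have hDG := h.subdivision.subset D ((h.mem_iff D).1 hD).1
  obtain ⟨C, hCD, hC, hxC⟩ := exists_support hxD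
  have hCS := h.mem_of_subset hD hC hCD
  obtain ⟨w, hw, hw1, hwx⟩ := (mem_intrinsicInterior_cellHull hC).1 hxC
  have hsum : ∑ l ∈ C, w l * orient (P i) (P j) (P l) = 0 := by
    rw [← orient_sum _ _ _ _ _ hw1, hwx, orient_eq_zero_of_mem hxe]
  have hz := (Finset.sum_eq_zero_iff_of_nonneg fun l hl => mul_nonneg (hw l hl).le
    (hrim.nonneg i j hij l (hDG (hCD hl)))).1 hsum
  have hCe : C ⊆ {i, j} := fun l hl => by
    simpa using hrim.eq_zero i j hij l (hDG (hCD hl))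
      ((mul_eq_zero.1 (hz l hl)).resolve_left (hw l hl).ne')
  have hne' := hrim.ne i j hij
  obtain ⟨v, hv, hv1, hvx⟩ := (mem_intrinsicInterior_cellHull (Finset.insert_nonempty i {j})).1 hx
  rw [Finset.sum_pair hne] at hv1 hvx
  have hvi := hv i (by simp)
  have hvj := hv j (by simp)
  have hnot : ∀ l, C ≠ {l} ∨ (l ≠ i ∧ l ≠ j) := by
    intro l
    by_contra! hc
    obtain ⟨hc1, hc2⟩ := hc
    rw [hc1] at hw1 hwx
    simp only [Finset.sum_singleton] at hw1 hwx
    rw [hw1, one_smul] at hwx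
    have key : v i • P i + v j • P j = P l := hvx.trans hwx.symm
    by_cases hli : l = i
    · rw [hli] at key
      apply hne'
      have : v j • (P j - P i) = 0 := by
        rw [smul_sub, sub_eq_zero, ← add_right_inj (v i • P i), key, ← add_smul, hv1, one_smul]
      exact (sub_eq_zero.1 ((smul_eq_zero.1 this).resolve_left hvj.ne')).symm
    · rw [hc2 hli] at key
      apply hne'
      have : v i • (P i - P j) = 0 := by
        rw [smul_sub, sub_eq_zero, ← add_left_inj (v j • P j), key, ← add_smul, hv1, one_smul]
      exact sub_eq_zero.1 ((smul_eq_zero.1 this).resolve_left hvi.ne')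
  suffices he : C = {i, j} by rwa [← he]
  have hl := Finset.card_le_card hCe
  rw [Finset.card_pair hne] at hl
  have hpos := Finset.card_pos.2 hC
  by_cases h1 : C.card = 1
  · obtain ⟨l, hl⟩ := Finset.card_eq_one.1 h1
    have hlm : l ∈ ({i, j} : Finset ι) := hCe (by rw [hl]; simp)
    simp only [Finset.mem_insert, Finset.mem_singleton] at hlm
    rcases hnot l with h2 | h2
    · exact absurd hl h2
    · tauto
  · exact Finset.eq_of_subset_of_card_le hCe (by rw [Finset.card_pair hne]; omega)

theorem IsTriangular.sideCount_eq_one [Fintype ι] (h : IsTriangular P G S T) {i j k : ι}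
    (ho : 0 < orient (P i) (P j) (P k)) (hD : ({i, j, k} : Finset ι) ∈ T) :
    sideCount P T i j = 1 := by
  unfold sideCount
  rw [Finset.sum_eq_single k]
  · rw [if_pos ⟨ho, hD⟩]
  · exact fun k' _ hk' => if_neg fun hh => hk' (h.left_unique hh.2 hD hh.1 ho)
  · simp

theorem IsTriangular.isBalanced [Fintype ι] (h : IsTriangular P G S T)
    (hG : ∃ i ∈ G, ∃ j ∈ G, ∃ k ∈ G, 0 < orient (P i) (P j) (P k)) (hrim : IsRim P G q rim)
    (hconv : ∀ i j, i ≠ j → ({i, j} : Finset ι) ∈ S → (∀ l ∈ G, 0 ≤ orient (P i) (P j) (P l)) →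
      rim i j) : IsBalanced P G rim T := by
  have hsub : ∀ D ∈ T, D ⊆ G := fun D hD => h.subdivision.subset D ((h.mem_iff D).1 hD).1
  -- The left side of an edge cell carries exactly one triangle, or it faces outwards and the
  -- reversed edge is on the rim. Subtracting this for the two directions gives the balance.
  have key : ∀ i j, i ≠ j → ({i, j} : Finset ι) ∈ S →
      sideCount P T i j + indicator rim j i = 1 := by
    intro i j hij hS
    by_cases hl : ∃ l ∈ G, 0 < orient (P i) (P j) (P l)
    · obtain ⟨l, hl, ho⟩ := hl
      obtain ⟨k, hk, hD⟩ := h.exists_left hG hij hS hl ho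
      have hr : ¬ rim j i := fun hr => by
        have := hrim.nonneg j i hr l hl
        rw [orient_swap] at this
        linarith
      rw [h.sideCount_eq_one hk hD, indicator, if_neg hr, add_zero]
    · push Not at hl
      have hr : rim j i := hconv j i hij.symm (by rwa [Finset.pair_comm]) fun l hlG => by
        rw [orient_swap]
        linarith [hl l hlG]
      have h0 : ¬ 0 < sideCount P T i j := fun hp => by
        obtain ⟨k, ho, hD⟩ := sideCount_pos.1 hp
        linarith [hl k (hsub _ hD (by simp))]
      have := sideCount_nonneg P T i j
      rw [indicator, if_pos hr]
      omega
  have hzero : ∀ i j, ¬ (i ≠ j ∧ ({i, j} : Finset ι) ∈ S) →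
      sideCount P T i j = 0 ∧ indicator rim i j = 0 := by
    intro i j hn
    constructor
    · have h0 : ¬ 0 < sideCount P T i j := fun hp => by
        obtain ⟨k, ho, hD⟩ := sideCount_pos.1 hp
        refine hn ⟨(ne_of_orient_pos ho).1, h.mem_of_subset hD (by simp) ?_⟩
        intro v; simp; tauto
      have := sideCount_nonneg P T i j
      omega
    · refine if_neg fun hr => hn ⟨fun e => hrim.ne i j hr (by rw [e]), h.rim_mem hG hrim hr⟩
  refine ⟨h.oriented, hsub, fun i j => ?_⟩
  by_cases hij : i ≠ j ∧ ({i, j} : Finset ι) ∈ S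
  · have h1 := key i j hij.1 hij.2
    have h2 := key j i hij.1.symm (by rw [Finset.pair_comm]; exact hij.2)
    omega
  · obtain ⟨h1, h2⟩ := hzero i j hij
    obtain ⟨h3, h4⟩ := hzero j i fun hh => hij ⟨hh.1.symm, by rw [Finset.pair_comm]; exact hh.2⟩
    rw [h1, h2, h3, h4]

end Local

/-! ### Hypertriangulations come from star systems -/

section Forward

variable {N : ℕ}

theorem cubeVertex_apply (E : Finset (Fin N)) (x : Fin N) :
    cubeVertex N E x = if x ∈ E then 1 else 0 := by
  simp [cubeVertex, Finset.sum_apply, Pi.single_apply]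

variable {S : Set (Finset (Finset (Fin N)))} {C : Finset (Finset (Fin N))}

/-- By fineness the face above a cell has the dimension of its image in the plane, at most two. -/
theorem IsHypertriangulation.not_linearIndependent (h : IsHypertriangulation (polygon N) 2 S)
    (hC : C ∈ S) {E₀ E₁ E₂ E₃ : Finset (Fin N)} (h0 : E₀ ∈ C) (h1 : E₁ ∈ C) (h2 : E₂ ∈ C)
    (h3 : E₃ ∈ C) : ¬ LinearIndependent ℝ ![cubeVertex N E₁ - cubeVertex N E₀,
      cubeVertex N E₂ - cubeVertex N E₀, cubeVertex N E₃ - cubeVertex N E₀] := by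
  intro hli
  have hspan := finrank_span_eq_card hli
  have hle : Submodule.span ℝ (Set.range ![cubeVertex N E₁ - cubeVertex N E₀,
      cubeVertex N E₂ - cubeVertex N E₀, cubeVertex N E₃ - cubeVertex N E₀]) ≤
      vectorSpan ℝ (cubeVertex N '' (C : Set (Finset (Fin N)))) := by
    rw [Submodule.span_le]
    rintro _ ⟨i, rfl⟩
    fin_cases i
    · exact vsub_mem_vectorSpan ℝ (Set.mem_image_of_mem _ h1) (Set.mem_image_of_mem _ h0)
    · exact vsub_mem_vectorSpan ℝ (Set.mem_image_of_mem _ h2) (Set.mem_image_of_mem _ h0)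
    · exact vsub_mem_vectorSpan ℝ (Set.mem_image_of_mem _ h3) (Set.mem_image_of_mem _ h0)
  have e1 := Submodule.finrank_mono hle
  have e2 := Submodule.finrank_le (vectorSpan ℝ ((fun i => projection (polygon N)
    (cubeVertex N i)) '' (C : Set (Finset (Fin N)))))
  rw [hspan, h.fine C hC] at e1
  rw [finrank_euclideanSpace] at e2
  simp only [Fintype.card_fin] at e1 e2
  omega

theorem IsHypertriangulation.subset_labels (h : IsHypertriangulation (polygon N) 2 S)
    (hC : C ∈ S) : C ⊆ labels N := h.induced.subdivision.subset C hC

/-- If a face contains the disjoint pairs `{i, j}` and `{k, l}`, the minimized sums satisfy `c i + c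
j = c k + c l`. The pairs `{i, k}`, `{j, l}` and `{i, l}`, `{j, k}` have the same total, so each is
minimal too. The face then contains an octahedron, of dimension three. -/
theorem IsHypertriangulation.exists_common (h : IsHypertriangulation (polygon N) 2 S)
    (hC : C ∈ S) {E F : Finset (Fin N)} (hE : E ∈ C) (hF : F ∈ C) : ∃ a, a ∈ E ∧ a ∈ F := by
  by_contra! hd
  obtain ⟨i, j, hij, rfl⟩ := exists_pair_of_mem_labels (h.subset_labels hC hE)
  obtain ⟨k, l, hkl, rfl⟩ := exists_pair_of_mem_labels (h.subset_labels hC hF)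
  have hi := hd i (by simp)
  have hj := hd j (by simp)
  simp only [Finset.mem_insert, Finset.mem_singleton, not_or] at hi hj
  obtain ⟨-, w, hw⟩ := h.induced.isFace C hC
  let c : Fin N → ℝ := fun x => w (Pi.single x 1)
  have hc : ∀ x y, x ≠ y → w (cubeVertex N {x, y}) = c x + c y := fun x y hxy => by
    simp only [cubeVertex, Finset.sum_pair hxy, map_add, c]
  have mE := ((hw _).1 hE).2
  have mF := ((hw _).1 hF).2
  have hik := mE _ (pair_mem_labels hi.1)
  have hil := mE _ (pair_mem_labels hi.2)
  have hjk := mE _ (pair_mem_labels hj.1)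
  have hjl := mE _ (pair_mem_labels hj.2)
  have hEF := mE _ (pair_mem_labels hkl)
  have hFE := mF _ (pair_mem_labels hij)
  rw [hc i j hij, hc i k hi.1] at hik
  rw [hc i j hij, hc i l hi.2] at hil
  rw [hc i j hij, hc j k hj.1] at hjk
  rw [hc i j hij, hc j l hj.2] at hjl
  rw [hc i j hij, hc k l hkl] at hEF
  rw [hc i j hij, hc k l hkl] at hFE
  have hmem : ∀ x y, x ≠ y → c x + c y = c i + c j → ({x, y} : Finset (Fin N)) ∈ C := by
    intro x y hxy he
    refine (hw _).2 ⟨pair_mem_labels hxy, fun F hF => ?_⟩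
    rw [hc x y hxy, he, ← hc i j hij]
    exact mE F hF
  refine h.not_linearIndependent hC hE (hmem i k hi.1 (by linarith)) (hmem i l hi.2 (by linarith))
    (hmem j l hj.2 (by linarith)) ?_
  rw [Fintype.linearIndependent_iff]
  intro g hg
  rw [Fin.sum_univ_three] at hg
  have hI := congrFun hg i
  have hK := congrFun hg k
  have hL := congrFun hg l
  simp [cubeVertex_apply, hij, hkl, hi.1, hi.2, hkl.symm, Ne.symm hi.1,
    Ne.symm hi.2, Ne.symm hj.1, Ne.symm hj.2] at hI hK hL
  intro x
  fin_cases x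
  · simp; linarith
  · simp; linarith
  · simp; linarith

/-- Pairwise intersecting pairs either share one element or are the three sides of a triple. In the
first case four labels would already span dimension three. -/
theorem IsHypertriangulation.cell_shape (h : IsHypertriangulation (polygon N) 2 S) (hC : C ∈ S) :
    (∃ t, t.card = 3 ∧ C = blackCell t) ∨ ∃ a s, a ∉ s ∧ s.card ≤ 3 ∧ C = starCell a s := by
  classical
  have hlab := h.subset_labels hC
  by_cases hcom : ∃ a, ∀ E ∈ C, a ∈ E
  · right
    obtain ⟨a, ha⟩ := hcom
    have hs : ∀ x, x ∈ (Finset.univ.filter fun x : Fin N => x ≠ a ∧ ({a, x} : Finset (Fin N)) ∈ C)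
        ↔ x ≠ a ∧ ({a, x} : Finset (Fin N)) ∈ C := fun x => by simp
    refine ⟨a, Finset.univ.filter fun x => x ≠ a ∧ ({a, x} : Finset (Fin N)) ∈ C, ?_, ?_, ?_⟩
    · rw [hs]; simp
    · by_contra! hcard
      obtain ⟨x₀, hx₀⟩ := Finset.card_pos.1 (by omega : 0 < Finset.card
        (Finset.univ.filter fun x : Fin N => x ≠ a ∧ ({a, x} : Finset (Fin N)) ∈ C))
      have h3 := Finset.card_erase_of_mem hx₀
      obtain ⟨x, hx, y, hy, z, hz, hxy, hxz, hyz⟩ := Finset.two_lt_card.1 (by omega :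
        2 < ((Finset.univ.filter fun x : Fin N =>
          x ≠ a ∧ ({a, x} : Finset (Fin N)) ∈ C).erase x₀).card)
      rw [Finset.mem_erase, hs] at hx hy hz
      rw [hs] at hx₀
      refine h.not_linearIndependent hC hx₀.2 hx.2.2 hy.2.2 hz.2.2 ?_
      rw [Fintype.linearIndependent_iff]
      intro g hg
      rw [Fin.sum_univ_three] at hg
      have hX := congrFun hg x
      have hY := congrFun hg y
      have hZ := congrFun hg z
      simp [cubeVertex_apply, hxy, hxz, hyz, hxy.symm, hxz.symm, hyz.symm, hx.1, hy.1, hz.1,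
        hx.2.1, hy.2.1, hz.2.1] at hX hY hZ
      intro i
      fin_cases i
      · simpa using hX
      · simpa using hY
      · simpa using hZ
    · ext E
      rw [mem_starCell]
      constructor
      · intro hE
        obtain ⟨x, hx, rfl⟩ := eq_pair_of_mem (mem_labels.1 (hlab hE)) (ha E hE)
        exact ⟨x, (hs x).2 ⟨hx.symm, hE⟩, rfl⟩
      · rintro ⟨x, hx, rfl⟩
        exact ((hs x).1 hx).2
  · left
    push Not at hcom
    obtain ⟨E, hE⟩ := h.induced.subdivision.nonempty C hC
    obtain ⟨x, y, hxy, rfl⟩ := exists_pair_of_mem_labels (hlab hE)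
    obtain ⟨F, hF, hxF⟩ := hcom x
    obtain ⟨K, hK, hyK⟩ := hcom y
    have hyF : y ∈ F := by
      obtain ⟨v, h1, h2⟩ := h.exists_common hC hE hF
      simp only [Finset.mem_insert, Finset.mem_singleton] at h1
      rcases h1 with rfl | rfl
      · exact absurd h2 hxF
      · exact h2
    have hxK : x ∈ K := by
      obtain ⟨v, h1, h2⟩ := h.exists_common hC hE hK
      simp only [Finset.mem_insert, Finset.mem_singleton] at h1
      rcases h1 with rfl | rfl
      · exact h2
      · exact absurd h2 hyK
    obtain ⟨z, hyz, rfl⟩ := eq_pair_of_mem (mem_labels.1 (hlab hF)) hyF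
    obtain ⟨z', hxz, rfl⟩ := eq_pair_of_mem (mem_labels.1 (hlab hK)) hxK
    simp only [Finset.mem_insert, Finset.mem_singleton, not_or] at hxF hyK
    obtain rfl : z = z' := by
      obtain ⟨v, h1, h2⟩ := h.exists_common hC hF hK
      simp only [Finset.mem_insert, Finset.mem_singleton] at h1 h2
      rcases h1 with rfl | rfl
      · exact absurd h2 (by tauto)
      · rcases h2 with rfl | h2
        · exact absurd rfl hxF.2
        · exact h2
    refine ⟨{x, y, z}, Finset.card_eq_three.2 ⟨x, y, z, hxy, hxz, hyz, rfl⟩, ?_⟩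
    rw [blackCell_triple hxy hyz hxz]
    ext L
    simp only [Finset.mem_insert, Finset.mem_singleton]
    constructor
    · intro hL
      obtain ⟨a, ha1, ha2⟩ := h.exists_common hC hE hL
      have h2 := h.exists_common hC hF hL
      have h3 := h.exists_common hC hK hL
      obtain ⟨b, hab, rfl⟩ := eq_pair_of_mem (mem_labels.1 (hlab hL)) ha2
      simp only [Finset.mem_insert, Finset.mem_singleton] at ha1 h2 h3
      rcases ha1 with rfl | rfl
      · obtain ⟨v, rfl | rfl, h4⟩ := h2
        · rw [h4.resolve_left hxy.symm]; simp
        · rw [h4.resolve_left hxz.symm]; simp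
      · obtain ⟨v, rfl | rfl, h4⟩ := h3
        · rw [h4.resolve_left hxy, Finset.pair_comm]; simp
        · rw [h4.resolve_left hyz.symm]; simp
    · rintro (rfl | rfl | rfl) <;> assumption

theorem card_blackCell {t : Finset (Fin N)} (ht : t.card = 3) : (blackCell t).card = 3 := by
  rw [blackCell, Finset.card_powersetCard, ht]; rfl

theorem card_starCell {a : Fin N} {s : Finset (Fin N)} (ha : a ∉ s) :
    (starCell a s).card = s.card :=
  Finset.card_image_of_injOn fun x hx _ _ he =>
    pair_left_injective (fun e : a = x => ha (by rw [e]; exact hx)) he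

theorem IsHypertriangulation.isTriangular (hN : 3 ≤ N)
    (h : IsHypertriangulation (polygon N) 2 S) {T : Finset (Finset (Finset (Fin N)))}
    (hT : ∀ D, D ∈ T ↔ D ∈ S ∧ D.card = 3) : IsTriangular (labelPoint N) (labels N) S T where
  subdivision := h.induced.subdivision
  mem_iff := hT
  card_le := fun C hC => by
    rcases h.cell_shape hC with ⟨t, ht, rfl⟩ | ⟨a, s, ha, hs, rfl⟩
    · exact (card_blackCell ht).le
    · rwa [card_starCell ha]
  oriented := fun D hD => by
    obtain ⟨hDS, hD3⟩ := (hT D).1 hD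
    rcases h.cell_shape hDS with ⟨t, ht, rfl⟩ | ⟨a, s, ha, hs, rfl⟩
    · exact oriented_blackCell ht
    · rw [card_starCell ha] at hD3
      exact oriented_starCell hD3 ha
  ne := fun E F hne hS he => by
    obtain ⟨a, h1, h2⟩ := h.exists_common hS (Finset.mem_insert_self _ _) (by simp : F ∈ _)
    have hlab := h.subset_labels hS
    obtain ⟨x, y, hx, hy, hxy, rfl, rfl⟩ := exists_pairs (mem_labels.1 (hlab (by simp)))
      (mem_labels.1 (hlab (by simp))) hne h1 h2
    rw [labelPoint_pair hx, labelPoint_pair hy] at he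
    exact hxy (polygon_injective hN (add_left_cancel he))

theorem IsHypertriangulation.exists_isStarSystem (hN : 4 ≤ N)
    (h : IsHypertriangulation (polygon N) 2 S) :
    ∃ B V, IsStarSystem B V ∧ downClosure (cells B V) = S := by
  classical
  obtain ⟨T, hT⟩ : ∃ T : Finset (Finset (Finset (Fin N))), ∀ D, D ∈ T ↔ D ∈ S ∧ D.card = 3 :=
    ⟨Finset.univ.filter fun D => D ∈ S ∧ D.card = 3, fun D => by simp⟩
  have htri := h.isTriangular (by omega) hT
  have hG := exists_orient_labels (N := N) (by omega)
  obtain ⟨q, hrim⟩ := isRim_rim hN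
  have hbal := htri.isBalanced hG hrim fun E F hne hS hnn => by
    obtain ⟨a, h1, h2⟩ := h.exists_common hS (Finset.mem_insert_self _ _) (by simp : F ∈ _)
    have hlab := h.subset_labels hS
    obtain ⟨x, y, hx, hy, hxy, rfl, rfl⟩ := exists_pairs (mem_labels.1 (hlab (by simp)))
      (mem_labels.1 (hlab (by simp))) hne h1 h2
    exact ⟨a, x, y, flank_of_nonneg hx hy hxy hnn, rfl, rfl⟩
  let B : Finset (Finset (Fin N)) := Finset.univ.filter fun t => t.card = 3 ∧ blackCell t ∈ T
  let V : Fin N → Finset (Finset (Fin N)) := fun a =>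
    Finset.univ.filter fun t => t.card = 3 ∧ a ∉ t ∧ starCell a t ∈ T
  have hB : ∀ t, t ∈ B ↔ t.card = 3 ∧ blackCell t ∈ T := fun t => by simp [B]
  have hV : ∀ a t, t ∈ V a ↔ t.card = 3 ∧ a ∉ t ∧ starCell a t ∈ T := fun a t => by simp [V]
  have hshape : IsShape B V := ⟨fun t ht => ((hB t).1 ht).1, fun a t ht => ((hV a t).1 ht).1,
    fun a t ht => ((hV a t).1 ht).2.1⟩
  have hcells : cells B V = T := by
    ext D
    rw [mem_cells]
    constructor
    · rintro (⟨t, ht, rfl⟩ | ⟨a, t, ht, rfl⟩)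
      · exact ((hB t).1 ht).2
      · exact ((hV a t).1 ht).2.2
    · intro hD
      obtain ⟨hDS, hD3⟩ := (hT D).1 hD
      rcases h.cell_shape hDS with ⟨t, ht, rfl⟩ | ⟨a, s, ha, hs, rfl⟩
      · exact Or.inl ⟨t, (hB t).2 ⟨ht, hD⟩, rfl⟩
      · rw [card_starCell ha] at hD3
        exact Or.inr ⟨a, s, (hV a s).2 ⟨hD3, ha, hD⟩, rfl⟩
  refine ⟨B, V, hshape.isBalanced_iff.1 (hcells ▸ hbal), ?_⟩
  rw [hcells, ← htri.eq_downClosure hG]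

/-! ### Recovering a star system from its cells -/

theorem blackCell_injective {t t' : Finset (Fin N)} (ht : t.card = 3)
    (h : blackCell t = blackCell t') : t ⊆ t' := by
  intro x hx
  obtain ⟨y, hy⟩ := Finset.card_pos.1
    (by rw [Finset.card_erase_of_mem hx]; omega : 0 < (t.erase x).card)
  rw [Finset.mem_erase] at hy
  have : ({x, y} : Finset (Fin N)) ∈ blackCell t' := by
    rw [← h, mem_blackCell]
    exact ⟨by simp [Finset.insert_subset_iff, hx, hy.2], Finset.card_pair hy.1.symm⟩
  exact (mem_blackCell.1 this).1 (by simp)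

/-- Whatever `a` is, some pair inside `t` avoids it. -/
theorem blackCell_ne_starCell {t : Finset (Fin N)} (ht : t.card = 3) (a : Fin N)
    (s : Finset (Fin N)) : blackCell t ≠ starCell a s := by
  intro h
  have hc := Finset.pred_card_le_card_erase (s := t) (a := a)
  obtain ⟨E, hE, hE2⟩ := Finset.exists_subset_card_eq (by omega : 2 ≤ (t.erase a).card)
  have hmem : E ∈ starCell a s := by
    rw [← h, mem_blackCell]
    exact ⟨hE.trans (Finset.erase_subset _ _), hE2⟩
  obtain ⟨x, -, rfl⟩ := mem_starCell.1 hmem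
  exact Finset.ne_of_mem_erase (hE (Finset.mem_insert_self a {x})) rfl

theorem starCell_injective {a b : Fin N} {s s' : Finset (Fin N)} (hs : s.card = 3) (ha : a ∉ s)
    (hb : b ∉ s') (h : starCell a s = starCell b s') : a = b ∧ s = s' := by
  obtain ⟨x, hx, y, hy, hxy⟩ := Finset.one_lt_card.1 (by omega : 1 < s.card)
  have hmem : ∀ z ∈ s, b ∈ ({a, z} : Finset (Fin N)) := by
    intro z hz
    have : ({a, z} : Finset (Fin N)) ∈ starCell b s' := by
      rw [← h]; exact mem_starCell.2 ⟨z, hz, rfl⟩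
    obtain ⟨w, -, hw⟩ := mem_starCell.1 this
    rw [← hw]; simp
  obtain rfl := eq_of_mem_pairs hxy (hmem x hx) (hmem y hy)
  refine ⟨rfl, Finset.ext fun z => ?_⟩
  by_cases hz : z = b
  · rw [hz]; exact iff_of_false ha hb
  · rw [← pair_mem_starCell hz, ← pair_mem_starCell hz, h]

variable {B : Finset (Finset (Fin N))} {V : Fin N → Finset (Finset (Fin N))}

theorem IsShape.mem_black_iff (h : IsShape B V) {t : Finset (Fin N)} :
    t ∈ B ↔ t.card = 3 ∧ blackCell t ∈ cells B V := by
  constructor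
  · exact fun ht => ⟨h.card_eq t ht, mem_cells.2 (Or.inl ⟨t, ht, rfl⟩)⟩
  · rintro ⟨ht, hc⟩
    rcases mem_cells.1 hc with ⟨t', ht', he⟩ | ⟨a, s, hs, he⟩
    · rwa [Finset.Subset.antisymm (blackCell_injective ht he.symm)
        (blackCell_injective (h.card_eq t' ht') he)]
    · exact absurd he.symm (blackCell_ne_starCell ht a s)

theorem IsShape.mem_star_iff (h : IsShape B V) {a : Fin N} {t : Finset (Fin N)} :
    t ∈ V a ↔ t.card = 3 ∧ a ∉ t ∧ starCell a t ∈ cells B V := by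
  constructor
  · exact fun ht => ⟨h.star_card_eq a t ht, h.notMem a t ht, mem_cells.2 (Or.inr ⟨a, t, ht, rfl⟩)⟩
  · rintro ⟨ht, ha, hc⟩
    rcases mem_cells.1 hc with ⟨t', ht', he⟩ | ⟨b, s, hs, he⟩
    · exact absurd he (blackCell_ne_starCell (h.card_eq t' ht') a t)
    · obtain ⟨rfl, rfl⟩ := starCell_injective ht ha (h.notMem b s hs) he.symm
      exact hs

/-- The triangles are exactly the cells with three labels, so passing to all faces loses no
information. -/
theorem IsShape.mem_cells_iff (h : IsShape B V) {D : Finset (Finset (Fin N))} :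
    D ∈ cells B V ↔ D ∈ downClosure (cells B V) ∧ D.card = 3 := by
  constructor
  · intro hD
    have h3 := card_of_oriented (h.oriented hD)
    exact ⟨⟨Finset.card_pos.1 (by omega), D, hD, subset_rfl⟩, h3⟩
  · rintro ⟨⟨-, D', hD', hsub⟩, h3⟩
    rwa [Finset.eq_of_subset_of_card_le hsub (by rw [h3, card_of_oriented (h.oriented hD')])]

/-- Hypertriangulations correspond to star systems. -/
theorem hypercatalan_two (hN : 4 ≤ N) : hypercatalan N 2 = (starSystems N).card := by
  have hmem : ∀ p, p ∈ starSystems N ↔ IsStarSystem p.1 p.2 := fun p => by simp [starSystems]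
  have hset : {S : Set (Finset (Finset (Fin N))) | IsHypertriangulation (polygon N) 2 S} =
      (fun p : Finset (Finset (Fin N)) × (Fin N → Finset (Finset (Fin N))) =>
        downClosure (cells p.1 p.2)) '' (starSystems N : Set _) := by
    ext S
    constructor
    · intro hS
      obtain ⟨B, V, h, rfl⟩ := IsHypertriangulation.exists_isStarSystem hN hS
      exact ⟨(B, V), (hmem _).2 h, rfl⟩
    · rintro ⟨p, hp, rfl⟩
      exact ((hmem p).1 hp).isHypertriangulation hN
  rw [hypercatalan, hset, Set.InjOn.ncard_image, Set.ncard_coe_finset]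
  rintro ⟨B, V⟩ hp ⟨B', V'⟩ hp' he
  have h := ((hmem _).1 hp).isShape
  have h' := ((hmem _).1 hp').isShape
  simp only at h h' he
  have hc : cells B V = cells B' V' := by
    ext D
    rw [h.mem_cells_iff, h'.mem_cells_iff, he]
  have hB : B = B' := by
    ext t
    rw [h.mem_black_iff, h'.mem_black_iff, hc]
  have hV : V = V' := by
    funext a
    ext t
    rw [h.mem_star_iff, h'.mem_star_iff, hc]
  rw [hB, hV]

end Forward

end Hyper

/-! ### The bounds with real exponents -/

theorem mainTheorem10 (n : ℕ) (hn : 4 ≤ n) :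
    (∀ T : Finset (Fin (n + 2) × Fin (n + 2)), Hyper.IsTriangulation T →
      (2 : ℝ) ^ ((n : ℝ) - 2) ≤ ∏ i, (catalan (Hyper.degree T i) : ℝ) ∧
      ∏ i, (catalan (Hyper.degree T i) : ℝ) ≤ (2 : ℝ) ^ ((5 / 2 : ℝ) * n - 7)) ∧
    (2 : ℝ) ^ ((n : ℝ) - 2) ≤ (Hyper.hypercatalan (n + 2) 2 : ℝ) / (catalan n : ℝ) ∧
    (Hyper.hypercatalan (n + 2) 2 : ℝ) / (catalan n : ℝ) ≤ (2 : ℝ) ^ ((5 / 2 : ℝ) * n - 7) := by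
  have hlow : (2 : ℝ) ^ ((n : ℝ) - 2) = ((2 ^ (n - 2) : ℕ) : ℝ) := by
    rw [← Nat.cast_ofNat, ← Nat.cast_sub (by omega), Real.rpow_natCast]
    push_cast
    rfl
  -- Both upper bounds are compared after squaring, which makes the exponent the natural number `5 *
  -- n - 14`.
  have hup : ((2 : ℝ) ^ ((5 / 2 : ℝ) * n - 7)) ^ 2 = ((2 ^ (5 * n - 14) : ℕ) : ℝ) := by
    rw [← Real.rpow_natCast, ← Real.rpow_mul (by norm_num)]
    push_cast
    rw [← Real.rpow_natCast, Nat.cast_sub (by omega)]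
    congr 1
    push_cast
    ring
  have hpos : (0 : ℝ) ≤ (2 : ℝ) ^ ((5 / 2 : ℝ) * n - 7) := by positivity
  refine ⟨fun T hT => ?_, ?_⟩
  · obtain ⟨h1, h2⟩ := hT.catalan_prod_bounds hn
    rw [hlow]
    refine ⟨by exact_mod_cast h1, (pow_le_pow_iff_left₀ (by positivity) hpos two_ne_zero).1 ?_⟩
    rw [hup]
    exact_mod_cast h2
  · obtain ⟨h1, h2⟩ := Hyper.card_starSystems_bounds hn
    rw [← Hyper.hypercatalan_two (by omega)] at h1 h2
    have hc : (0 : ℝ) < catalan n := by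
      have := Hyper.two_pow_le_catalan n
      have h3 : 0 < catalan n := lt_of_lt_of_le (by positivity) this
      exact_mod_cast h3
    rw [hlow, le_div_iff₀ hc, div_le_iff₀ hc]
    refine ⟨by exact_mod_cast h1, (pow_le_pow_iff_left₀ (by positivity) (by positivity) two_ne_zero).1 ?_⟩
    rw [mul_pow, hup]
    exact_mod_cast h2
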